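/- Fix integers $L\ge 2$, $N\ge 1$ and constants $\theta=(\theta_0,\dots,\theta_N)\in\mathbb C^{N+1}$. Write $\boldsymbol x=(x_1,x_2,\dots)$, $\boldsymbol y=(y_1,y_2,\dots)$, $[t]=(t,t^2/2,t^3/3,\dots)$, $\xi(\boldsymbol x,k)=\sum_{n\ge1}x_nk^n$, $\delta_t=\sum_{n\ge1}(t^n\partial_{x_n}-t^{-n}\partial_{y_n})$, $E=\sum_{n\ge 1}(nx_n\partial_{x_n}-ny_n\partial_{y_n})$, and $D_v F\cdot G=(vF)G-F(vG)$ for a vector field $v$. **Tau functions.** Let $d_{m,n}\in\mathbb C$ $(m,n\in\mathbb Z)$ satisfy $d_{m+L,n}=d_{m,n+L}=d_{m,n}$ and $d_{m,n}+d_{m+1,n+1}=d_{m,n+1}+d_{m+1,n}$. Let $\tau_{m,n}(\boldsymbol x,\boldsymbol y)$ be holomorphic on an open set $\Omega$ of pairs of sequences of at most geometric growth (for instance entire), with $\tau_{m+L,n}=\tau_{m,n+L}=\tau_{m,n}$, $E\tau_{m,n}=d_{m,n}\tau_{m,n}$, and, for $t,s\in\mathbb C^\times$ (with $t\ne s$ in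 the third equation) and whenever all points involved lie in $\Omega$, the equations of the UC hierarchy $$(t-s)\,\tau_{m,n}(\boldsymbol x-[t]-[s],\boldsymbol y-[t^{-1}]-[s^{-1}])\,\tau_{m+1,n+1}(\boldsymbol x,\boldsymbol y)-t\,\tau_{m,n+1}(\boldsymbol x-[t],\boldsymbol y-[t^{-1}])\,\tau_{m+1,n}(\boldsymbol x-[s],\boldsymbol y-[s^{-1}])+s\,\tau_{m,n+1}(\boldsymbol x-[s],\boldsymbol y-[s^{-1}])\,\tau_{m+1,n}(\boldsymbol x-[t],\boldsymbol y-[t^{-1}])=0,$$ $$(D_{\delta_t}-1)\,\tau_{m,n+1}\cdot\tau_{m+1,n}+\tau_{m,n}(\boldsymbol x-[t],\boldsymbol y-[t^{-1}])\,\tau_{m+1,n+1}(\boldsymbol x+[t],\boldsymbol y+[t^{-1}])=0,$$ $$\Big(D_{\delta_t}+\tfrac{t}{s-t}\Big)\tau_{m,n}(\boldsymbol x-[s],\boldsymbol y-[s^{-1}])\cdot\tau_{m+1,n}(\boldsymbol x,\boldsymbol y)+\tfrac{t}{t-s}\,\tau_{m,n}(\boldsymbol x-[t],\boldsymbol y-[t^{-1}])\,\tau_{m+1,n}(\boldsymbol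 x+[t]-[s],\boldsymbol y+[t^{-1}]-[s^{-1}])=0 .$$ Put $\psi_{m,n}=\dfrac{\tau_{m,n-1}(\boldsymbol x-[k^{-1}],\boldsymbol y-[k])}{\tau_{m,n}(\boldsymbol x,\boldsymbol y)}e^{\xi(\boldsymbol x,k)}$. Let $\sigma_{m,n}(\theta,\boldsymbol t)$ and $\phi_{m,n}(\theta,\boldsymbol t,k)$ be obtained from $\tau_{m,n}$ and $\psi_{m,n}$ by the substitution $x_n=\frac1n\sum_{i=0}^N\theta_it_i^n$, $y_n=\frac1n\sum_{i=0}^N\theta_it_i^{-n}$; "$(\theta_i+1)$" means that only $\theta_i$ is shifted. Put $$f^{(i)}_{m,n}=\frac{\sigma_{m,n-1}(\theta_i+1)\,\sigma_{m-1,n-1}}{\sigma_{m-1,n}(\theta_i+1)\,\sigma_{m,n-2}},\qquad g^{(i)}_{m,n}=\frac{t_iD_{\partial/\partial t_i}\,\sigma_{m,n-1}\cdot\sigma_{m-1,n}}{\sigma_{m,n-1}\,\sigma_{m-1,n}}+\theta_i .$$ Let $\boldsymbol t$ vary in an open set $T$ on which $t_i\ne0$ and $t_i^L\neq t_j^L$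 $(i\ne j)$, and $(\boldsymbol t,k)$ in an open set $W$ over $T$ with $k\ne0$ and $|t_ik|<1$. Assume, for the statements about the $\tau_{m,n}$, that for $\boldsymbol t\in T$, $(\boldsymbol t,k)\in W$ and all $\nu\in\mathbb Z^{N+1}$ the points $(\boldsymbol x,\boldsymbol y)$ and $(\boldsymbol x-[k^{-1}],\boldsymbol y-[k])$ given by the substitution with $\theta+\nu$ in place of $\theta$ lie in $\Omega$, and that no $\sigma_{m,n}$ and no $\sigma_{m,n}(\theta_i+1)$ vanishes on $T$. **(1)** The $\phi_{m,n}$ are holomorphic on $W$ and satisfy, for all $m,n\in\mathbb Z$, $0\le i\le N$, $$\phi_{m,n}=\frac1{f^{(i)}_{m+1,n+1}}\phi_{m,n+1}(\theta_i+1)-t_ik\,\phi_{m+1,n}(\theta_i+1),$$ $$t_i\frac{\partial\phi_{m,n}}{\partial t_i}=(g^{(i)}_{m+1,n}-\theta_i)\phi_{m,n}+t_ik\,g^{(i)}_{m+1,n}\,\phi_{m+1,n}(\theta_i+1),$$ $$\Big(k\frac{\partial}{\partial k}-\sum_{i=0}^Nt_i\frac{\partial}{\partial t_i}\Big)\phi_{m,n}=(d_{m,n}-d_{m,n-1})\phi_{m,n}.$$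 **The matrices.** Put $z=k^L$, $u_i=t_i^{-L}$ $(0\le i\le N)$, $u_{N+1}=0$, $\kappa_{m,n}=d_{m,n-1}-d_{m-1,n}+\sum_i\theta_i$, $\kappa_n=\kappa_{n,-n}/L$, $e_n=(d_{n,-n-1}-d_{n-1,-n-1}+n)/L$. Call families of holomorphic functions $f^{(i)}_j$ (without zeros) and $g^{(i)}_j$ on $T$ $(0\le i\le N$, $j\in\mathbb Z/L)$ *admissible* if $\prod_jf^{(i)}_j=1$, $\sum_jg^{(i)}_j=L\theta_i$, $\sum_ig^{(i)}_j=\kappa_{j,-j}$. For $0\le m\le L-1$, $1\le b\le L$ let $v^{(i)}_{m,m+b}=\frac{g^{(i)}_m}{L}\prod_{a=1}^bt_if^{(i)}_{m+a}$, the second index being taken modulo $L$. For $0\le m,n\le L-1$ define * for $0\le i\le N$: $(A_i)_{m,n}=-v^{(i)}_{m,n}$ if $m<n$, and $-u_iv^{(i)}_{m,n}$ if $m\ge n$; * $A_{N+1}$ upper triangular with diagonal entries $e_n$ and $(A_{N+1})_{m,n}=\sum_{i=0}^Nv^{(i)}_{m,n}$ for $m<n$; $A_{N+2}=-\sum_{i=0}^{N+1}A_i$;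 $A=\sum_{i=0}^{N+1}\frac{A_i}{z-u_i}$; * $B_i$ with entries $\frac{v^{(i)}_{m,n}}{z-u_i}$ if $m<n$, $\frac{z\,v^{(i)}_{m,n}}{z-u_i}$ if $m>n$, and $\frac{\theta_i}{Lu_i}-v^{(i)}_{n,n}+\frac{z\,v^{(i)}_{n,n}}{z-u_i}$ if $m=n$. The system $\mathcal G_{L,N}$ for an admissible family is: for all $i\ne l$ and all $j$, $$t_i\frac{\partial f^{(i)}_j}{\partial t_i}=\Big(\kappa_{j,1-j}-g^{(i)}_j+\sum_{l\neq i}(U^{(l,i)}_{j-1}-V^{(l,i)}_j)\Big)f^{(i)}_j,\qquad t_l\frac{\partial f^{(i)}_j}{\partial t_l}=\big(-g^{(l)}_j-U^{(l,i)}_{j-1}+V^{(l,i)}_j\big)f^{(i)}_j,$$ $$t_i\frac{\partial g^{(i)}_j}{\partial t_i}=-\sum_{l\ne i}\big(U^{(i,l)}_jg^{(l)}_j+V^{(l,i)}_jg^{(i)}_j\big),\qquad t_l\frac{\partial g^{(i)}_j}{\partial t_l}=U^{(i,l)}_jg^{(l)}_j+V^{(l,i)}_jg^{(i)}_j,$$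 where $$U^{(i,l)}_j=\frac1{(t_i/t_l)^L-1}\sum_{b=1}^Lg^{(i)}_{j-b+1}\prod_{a=1}^{b-1}\frac{t_if^{(i)}_{j-a+1}}{t_lf^{(l)}_{j-a+1}},\qquad V^{(i,l)}_j=\frac1{(t_i/t_l)^L-1}\sum_{b=1}^Lg^{(i)}_{j-b}\prod_{a=0}^{b-1}\frac{t_if^{(i)}_{j-a}}{t_lf^{(l)}_{j-a}} .$$ **(2)** With $f^{(i)}_j=f^{(i)}_{j,1-j}$ and $g^{(i)}_j=g^{(i)}_{j,-j}$ coming from the $\tau_{m,n}$, the family is admissible, it solves $\mathcal G_{L,N}$, the compatibility condition $[\partial_{u_i}-B_i,\partial_z-A]=0$ holds for $0\le i\le N$, and $\Phi={}^{\mathrm T}(\phi_{-1,0},k\phi_{0,-1},\dots,k^{L-1}\phi_{L-2,-L+1})$ satisfies on $W$ $$\frac{\partial\Phi}{\partial z}=\sum_{i=0}^{N+1}\frac{A_i}{z-u_i}\Phi,\qquad\frac{\partial\Phi}{\partial u_i}=B_i\Phi\quad(0\le i\le N).$$ **(3)** For every admissible family the finite singular points $u_0,\dots,u_{N+1}$ are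 distinct (with $u_{N+2}=\infty$ there are $N+3$), and the residue matrices have characteristic polynomials $X^{L-1}(X+\theta_i)$ for $A_i$ $(i\le N)$, $\prod_n(X-e_n)$ for $A_{N+1}$, and $\prod_n(X-\kappa_n+e_n)$ for $A_{N+2}$, where $\sum_ne_n=\frac{L-1}2$ and $\sum_n\kappa_n=\sum_i\theta_i$. For $i\le N$, $A_i=\boldsymbol b^{(i)}\boldsymbol c^{(i)}$ with the column $\boldsymbol b^{(i)}=\big(-g^{(i)}_n/(Lt_i^n\prod_{m=1}^nf^{(i)}_m)\big)_{0\le n<L}$ and the row $\boldsymbol c^{(i)}=\big(t_i^n\prod_{m=1}^nf^{(i)}_m\big)_{0\le n<L}$, $\boldsymbol c^{(i)}\boldsymbol b^{(i)}=-\theta_i$, and $A_i$ has rank one if $\theta_i\ne0$. The spectral type (the multiplicities of the eigenvalues) is $((L-1,1)^{N+1},(1^L)^2)$ for generic exponents: $A_i$ has type $(L-1,1)$ if $\theta_i\neq0$, and $A_{N+1}$ (resp. $A_{N+2}$) has type $(1^L)$ if the $e_n$ (resp. the $\kappa_n-e_n$) are pairwise distinct. **(4)** For an admissible family, $\mathcal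 G_{L,N}$ implies (a) and (b) below; conversely, if all $\theta_i\ne0$, each of (a) and (b) implies $\mathcal G_{L,N}$. (a) The compatibility condition $[\partial_{u_i}-B_i,\partial_z-A]=0$ holds for all $0\le i\le N$. (b) Locally on $T$ there is a holomorphic invertible lower triangular matrix $Q(\boldsymbol t)$ with $\partial Q/\partial u_i=B_i|_{z=\infty}Q$ for $0\le i\le N$ such that the matrices $A_i'=Q^{-1}A_iQ$ $(0\le i\le N+1)$ satisfy the Schlesinger system $$\frac{\partial A'_i}{\partial u_j}=\frac{[A'_i,A'_j]}{u_i-u_j}\quad(i\ne j),\qquad \frac{\partial A'_j}{\partial u_j}=-\sum_{l\ne j}\frac{[A'_j,A'_l]}{u_j-u_l},\qquad 0\le j\le N,\ 0\le i,l\le N+1 .$$ -/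

import Mathlib

open scoped BigOperators

noncomputable section

namespace UCReduction

/-! ### Functions of the two infinite families of variables -/

/-- A pair `(x, y)` of sequences `x = (x₁, x₂, …)`, `y = (y₁, y₂, …)`. -/
abbrev Pt : Type := (ℕ+ → ℂ) × (ℕ+ → ℂ)

/-- The sequence `[t] = (t, t² / 2, t³ / 3, …)`. -/
def bracket (t : ℂ) : ℕ+ → ℂ := fun n => t ^ (n : ℕ) / ((n : ℕ) : ℂ)

/-- The pair `([t], [t⁻¹])`, by which the variables `(x, y)` are shifted. -/
def shiftBy (t : ℂ) : Pt := (bracket t, bracket t⁻¹)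

/-- The partial derivative `∂F / ∂xₙ`. -/
def partialX (n : ℕ+) (F : Pt → ℂ) (p : Pt) : ℂ :=
  deriv (fun s => F (Function.update p.1 n s, p.2)) (p.1 n)

/-- The partial derivative `∂F / ∂yₙ`. -/
def partialY (n : ℕ+) (F : Pt → ℂ) (p : Pt) : ℂ :=
  deriv (fun s => F (p.1, Function.update p.2 n s)) (p.2 n)

/-- The vector field `δ_t = ∑ₙ (tⁿ ∂/∂xₙ - t⁻ⁿ ∂/∂yₙ)`. -/
def delta (t : ℂ) (F : Pt → ℂ) (p : Pt) : ℂ :=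
  ∑' n : ℕ+, (t ^ (n : ℕ) * partialX n F p - t⁻¹ ^ (n : ℕ) * partialY n F p)

/-- The Euler operator `E = ∑ₙ (n xₙ ∂/∂xₙ - n yₙ ∂/∂yₙ)`. -/
def euler (F : Pt → ℂ) (p : Pt) : ℂ :=
  ∑' n : ℕ+, (((n : ℕ) : ℂ) * p.1 n * partialX n F p - ((n : ℕ) : ℂ) * p.2 n * partialY n F p)

/-- The Hirota differential `D_{δ_t} F · G = (δ_t F) G - F (δ_t G)`. -/
def hirotaDelta (t : ℂ) (F G : Pt → ℂ) (p : Pt) : ℂ :=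
  delta t F p * G p - F p * delta t G p

/-- The pair of sequences `(Rⁿ aₙ, Rⁿ bₙ)` for absolutely summable `a`, `b`.  When `R` varies,
these are exactly the pairs of sequences of at most geometric growth. -/
def weighted (R : ℝ) (a : lp (fun _ : ℕ+ => ℂ) 1 × lp (fun _ : ℕ+ => ℂ) 1) : Pt :=
  (fun n => (R : ℂ) ^ (n : ℕ) * a.1 n, fun n => (R : ℂ) ^ (n : ℕ) * a.2 n)

/-- `Ω` is an open set of pairs of sequences of at most geometric growth. -/
structure IsDomainOfTimes (Ω : Set Pt) : Prop where
  geometric : ∀ p ∈ Ω, ∃ R : ℝ, 0 < R ∧ p ∈ Set.range (weighted R)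
  isOpen : ∀ R : ℝ, 0 < R → IsOpen (weighted R ⁻¹' Ω)

/-- Holomorphy on `Ω` of a function of the infinitely many variables `(x, y)`. -/
def IsHolomorphicOn (Ω : Set Pt) (F : Pt → ℂ) : Prop :=
  ∀ R : ℝ, 0 < R → DifferentiableOn ℂ (fun a => F (weighted R a)) (weighted R ⁻¹' Ω)

/-! ### Homogeneous periodic sequences of tau functions -/

/-- The degrees `d_{m,n}`: an `(L, L)`-periodic array fulfilling the balancing condition. -/
structure IsDegreeArray (L : ℕ) (d : ℤ → ℤ → ℂ) : Prop where
  periodic_left : ∀ m n, d (m + L) n = d m n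
  periodic_right : ∀ m n, d m (n + L) = d m n
  balanced : ∀ m n, d m n + d (m + 1) (n + 1) = d m (n + 1) + d (m + 1) n

/-- A sequence `τ_{m,n}` of functions holomorphic on `Ω`, which satisfies there the three
difference (and differential) equations of the UC hierarchy, is homogeneous of degrees `d_{m,n}`
and is `(L, L)`-periodic. -/
structure IsTauSequence (L : ℕ) (d : ℤ → ℤ → ℂ) (Ω : Set Pt) (τ : ℤ → ℤ → Pt → ℂ) : Prop where
  domain : IsDomainOfTimes Ω
  holomorphic : ∀ m n, IsHolomorphicOn Ω (τ m n)
  difference : ∀ (m n : ℤ) (p : Pt) (t s : ℂ), t ≠ 0 → s ≠ 0 →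
    p ∈ Ω → p - shiftBy t ∈ Ω → p - shiftBy s ∈ Ω → p - shiftBy t - shiftBy s ∈ Ω →
    (t - s) * τ m n (p - shiftBy t - shiftBy s) * τ (m + 1) (n + 1) p
      - t * τ m (n + 1) (p - shiftBy t) * τ (m + 1) n (p - shiftBy s)
      + s * τ m (n + 1) (p - shiftBy s) * τ (m + 1) n (p - shiftBy t) = 0
  differential : ∀ (m n : ℤ) (p : Pt) (t : ℂ), t ≠ 0 →
    p ∈ Ω → p - shiftBy t ∈ Ω → p + shiftBy t ∈ Ω →
    hirotaDelta t (τ m (n + 1)) (τ (m + 1) n) p - τ m (n + 1) p * τ (m + 1) n p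
      + τ m n (p - shiftBy t) * τ (m + 1) (n + 1) (p + shiftBy t) = 0
  mixed : ∀ (m n : ℤ) (p : Pt) (t s : ℂ), t ≠ 0 → s ≠ 0 → t ≠ s →
    p ∈ Ω → p - shiftBy s ∈ Ω → p - shiftBy t ∈ Ω → p + shiftBy t - shiftBy s ∈ Ω →
    hirotaDelta t (fun q => τ m n (q - shiftBy s)) (τ (m + 1) n) p
      + t / (s - t) * (τ m n (p - shiftBy s) * τ (m + 1) n p)
      + t / (t - s) * (τ m n (p - shiftBy t) * τ (m + 1) n (p + shiftBy t - shiftBy s)) = 0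
  homogeneous : ∀ (m n : ℤ), ∀ p ∈ Ω, euler (τ m n) p = d m n * τ m n p
  periodic_left : ∀ (m n : ℤ), ∀ p ∈ Ω, τ (m + L) n p = τ m n p
  periodic_right : ∀ (m n : ℤ), ∀ p ∈ Ω, τ m (n + L) p = τ m n p

/-- The wave function
`ψ_{m,n}(x, y, k) = τ_{m,n-1}(x - [k⁻¹], y - [k]) / τ_{m,n}(x, y) * exp (∑ₙ xₙ kⁿ)`. -/
def psi (τ : ℤ → ℤ → Pt → ℂ) (m n : ℤ) (p : Pt) (k : ℂ) : ℂ :=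
  τ m (n - 1) (p - shiftBy k⁻¹) / τ m n p * Complex.exp (∑' j : ℕ+, p.1 j * k ^ (j : ℕ))

/-! ### The reduction to the variables `t = (t₀, …, t_N)` -/

variable {N : ℕ}

/-- The substitution `xₙ = (1/n) ∑ᵢ θᵢ tᵢⁿ`, `yₙ = (1/n) ∑ᵢ θᵢ tᵢ⁻ⁿ`. -/
def powerSum (θ t : Fin (N + 1) → ℂ) : Pt :=
  (fun n => (1 / ((n : ℕ) : ℂ)) * ∑ i, θ i * t i ^ (n : ℕ),
   fun n => (1 / ((n : ℕ) : ℂ)) * ∑ i, θ i * (t i)⁻¹ ^ (n : ℕ))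

/-- The reduced tau function `σ_{m,n}(θ, t)`. -/
def sigma (τ : ℤ → ℤ → Pt → ℂ) (m n : ℤ) (θ t : Fin (N + 1) → ℂ) : ℂ := τ m n (powerSum θ t)

/-- The reduced wave function `φ_{m,n}(θ, t, k)`. -/
def phi (τ : ℤ → ℤ → Pt → ℂ) (m n : ℤ) (θ t : Fin (N + 1) → ℂ) (k : ℂ) : ℂ :=
  psi τ m n (powerSum θ t) k

/-- `θ` with `θᵢ` replaced by `θᵢ + 1`. -/
def raise (θ : Fin (N + 1) → ℂ) (i : Fin (N + 1)) : Fin (N + 1) → ℂ := θ + Pi.single i 1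

/-- The partial derivative `∂F / ∂tᵢ`. -/
def pd (i : Fin (N + 1)) (F : (Fin (N + 1) → ℂ) → ℂ) (t : Fin (N + 1) → ℂ) : ℂ :=
  deriv (fun s => F (Function.update t i s)) (t i)

/-- The partial derivative `∂F / ∂uᵢ` with respect to `uᵢ = tᵢ^{-L}`. -/
def pdU (L : ℕ) (i : Fin (N + 1)) (F : (Fin (N + 1) → ℂ) → ℂ) (t : Fin (N + 1) → ℂ) : ℂ :=
  pd i F t / deriv (fun s : ℂ => (s ^ L)⁻¹) (t i)

/-- The variable
`f^{(i)}_{m,n} = σ_{m,n-1}(θᵢ+1) σ_{m-1,n-1} / (σ_{m-1,n}(θᵢ+1) σ_{m,n-2})`. -/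
def fVar (τ : ℤ → ℤ → Pt → ℂ) (θ : Fin (N + 1) → ℂ) (i : Fin (N + 1)) (m n : ℤ)
    (t : Fin (N + 1) → ℂ) : ℂ :=
  (sigma τ m (n - 1) (raise θ i) t * sigma τ (m - 1) (n - 1) θ t) /
    (sigma τ (m - 1) n (raise θ i) t * sigma τ m (n - 2) θ t)

/-- The variable `g^{(i)}_{m,n} = (tᵢ Dᵢ σ_{m,n-1} · σ_{m-1,n}) / (σ_{m,n-1} σ_{m-1,n}) + θᵢ`. -/
def gVar (τ : ℤ → ℤ → Pt → ℂ) (θ : Fin (N + 1) → ℂ) (i : Fin (N + 1)) (m n : ℤ)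
    (t : Fin (N + 1) → ℂ) : ℂ :=
  t i * (pd i (sigma τ m (n - 1) θ) t * sigma τ (m - 1) n θ t
      - sigma τ m (n - 1) θ t * pd i (sigma τ (m - 1) n θ) t) /
    (sigma τ m (n - 1) θ t * sigma τ (m - 1) n θ t) + θ i

/-- `T` is an open set of values of `t`, and `W` an open set of values of `(t, k)` over `T`, on
which the reduced functions are defined: all the points at which tau functions are evaluated
lie in `Ω`, the series `∑ₙ xₙ kⁿ` converges, and the tau functions that occur as denominators do
not vanish. -/
structure IsReductionDomain (Ω : Set Pt) (τ : ℤ → ℤ → Pt → ℂ) (θ : Fin (N + 1) → ℂ)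
    (T : Set (Fin (N + 1) → ℂ)) (W : Set ((Fin (N + 1) → ℂ) × ℂ)) : Prop where
  isOpen : IsOpen W
  mem_T : ∀ q ∈ W, q.1 ∈ T
  k_ne_zero : ∀ q ∈ W, q.2 ≠ 0
  convergent : ∀ q ∈ W, ∀ i, ‖q.1 i * q.2‖ < 1
  mem_domain : ∀ t ∈ T, ∀ ν : Fin (N + 1) → ℤ, powerSum (fun i => θ i + ν i) t ∈ Ω
  mem_domain_wave : ∀ q ∈ W, ∀ ν : Fin (N + 1) → ℤ,
    powerSum (fun i => θ i + ν i) q.1 - shiftBy q.2⁻¹ ∈ Ω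
  sigma_ne_zero : ∀ t ∈ T, ∀ m n, sigma τ m n θ t ≠ 0
  sigma_raise_ne_zero : ∀ t ∈ T, ∀ m n i, sigma τ m n (raise θ i) t ≠ 0

/-! ### The nonlinear system

The system is closed with respect to the variables `f i j = f^{(i)}_{j,1-j}` and
`g i j = g^{(i)}_{j,-j}`, with `j` regarded modulo `L`. -/

/-- A family of dependent variables, indexed by `i = 0, …, N` and `j ∈ ℤ`. -/
abbrev Family (N : ℕ) : Type := Fin (N + 1) → ℤ → (Fin (N + 1) → ℂ) → ℂ

/-- The family `f^{(i)}_{j,1-j}` given by the tau functions. -/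
def fFamily (τ : ℤ → ℤ → Pt → ℂ) (θ : Fin (N + 1) → ℂ) : Family N :=
  fun i j => fVar τ θ i j (1 - j)

/-- The family `g^{(i)}_{j,-j}` given by the tau functions. -/
def gFamily (τ : ℤ → ℤ → Pt → ℂ) (θ : Fin (N + 1) → ℂ) : Family N :=
  fun i j => gVar τ θ i j (-j)

/-- The constants `κ_{m,n} = d_{m,n-1} - d_{m-1,n} + ∑ᵢ θᵢ`. -/
def kappa (d : ℤ → ℤ → ℂ) (θ : Fin (N + 1) → ℂ) (m n : ℤ) : ℂ :=
  d m (n - 1) - d (m - 1) n + ∑ i, θ i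

/-- `U^{(i,l)}_{j,-j}` as a rational expression in the dependent variables. -/
def auxU (L : ℕ) (f g : Family N) (i l : Fin (N + 1)) (j : ℤ) (t : Fin (N + 1) → ℂ) : ℂ :=
  1 / ((t i / t l) ^ L - 1) * ∑ b ∈ Finset.Icc 1 L, g i (j - b + 1) t *
    ∏ a ∈ Finset.Ico 1 b, (t i * f i (j - a + 1) t) / (t l * f l (j - a + 1) t)

/-- `V^{(i,l)}_{j,-j}` as a rational expression in the dependent variables. -/
def auxV (L : ℕ) (f g : Family N) (i l : Fin (N + 1)) (j : ℤ) (t : Fin (N + 1) → ℂ) : ℂ :=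
  1 / ((t i / t l) ^ L - 1) * ∑ b ∈ Finset.Icc 1 L, g i (j - b) t *
    ∏ a ∈ Finset.range b, (t i * f i (j - a) t) / (t l * f l (j - a) t)

/-- The phase space: holomorphic `L`-periodic families `f` (without zeros) and `g` subject to the
conservation laws `∏ⱼ f^{(i)}_j = 1`, `∑ⱼ g^{(i)}_j = L θᵢ` and `∑ᵢ g^{(i)}_j = κ_{j,-j}`. -/
structure IsAdmissible (L : ℕ) (d : ℤ → ℤ → ℂ) (θ : Fin (N + 1) → ℂ)
    (T : Set (Fin (N + 1) → ℂ)) (f g : Family N) : Prop where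
  holomorphic_f : ∀ i j, DifferentiableOn ℂ (f i j) T
  holomorphic_g : ∀ i j, DifferentiableOn ℂ (g i j) T
  periodic_f : ∀ i j, ∀ t ∈ T, f i (j + L) t = f i j t
  periodic_g : ∀ i j, ∀ t ∈ T, g i (j + L) t = g i j t
  f_ne_zero : ∀ i j, ∀ t ∈ T, f i j t ≠ 0
  prod_f : ∀ i, ∀ t ∈ T, ∏ j ∈ Finset.range L, f i j t = 1
  sum_g : ∀ i, ∀ t ∈ T, ∑ j ∈ Finset.range L, g i j t = L * θ i
  sum_g_kappa : ∀ j, ∀ t ∈ T, ∑ i, g i j t = kappa d θ j (-j)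

/-- The system `G_{L,N}` of nonlinear differential equations. -/
structure SolvesG (L : ℕ) (d : ℤ → ℤ → ℂ) (θ : Fin (N + 1) → ℂ)
    (T : Set (Fin (N + 1) → ℂ)) (f g : Family N) : Prop where
  f_same : ∀ i j, ∀ t ∈ T, t i * pd i (f i j) t =
    (kappa d θ j (1 - j) - g i j t +
      ∑ l ∈ Finset.univ.erase i, (auxU L f g l i (j - 1) t - auxV L f g l i j t)) * f i j t
  f_other : ∀ i l j, l ≠ i → ∀ t ∈ T, t l * pd l (f i j) t =
    (- g l j t - auxU L f g l i (j - 1) t + auxV L f g l i j t) * f i j t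
  g_same : ∀ i j, ∀ t ∈ T, t i * pd i (g i j) t =
    - ∑ l ∈ Finset.univ.erase i, (auxU L f g i l j t * g l j t + auxV L f g l i j t * g i j t)
  g_other : ∀ i l j, l ≠ i → ∀ t ∈ T, t l * pd l (g i j) t =
    auxU L f g i l j t * g l j t + auxV L f g l i j t * g i j t

/-! ### The linear system in `z = k^L` and `uᵢ = tᵢ^{-L}` -/

/-- The exponents `e_n = (d_{n,-n-1} - d_{n-1,-n-1} + n) / L` at `z = 0`. -/
def expZero (L : ℕ) (d : ℤ → ℤ → ℂ) (n : Fin L) : ℂ :=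
  (d (n : ℤ) (-(n : ℤ) - 1) - d ((n : ℤ) - 1) (-(n : ℤ) - 1) + (n : ℕ)) / L

/-- The constants `κ_n = κ_{n,-n} / L`. -/
def kappaBar (L : ℕ) (d : ℤ → ℤ → ℂ) (θ : Fin (N + 1) → ℂ) (n : Fin L) : ℂ :=
  kappa d θ (n : ℤ) (-(n : ℤ)) / L

/-- The entry `v^{(i)}_{m,n}` with `n` regarded modulo `L`, that is, `v^{(i)}_{m,m+b}` with
`1 ≤ b ≤ L`, where `v^{(i)}_{m,m+b} = (g^{(i)}_{m,-m} / L) ∏_{a=1}^{b} tᵢ f^{(i)}_{m+a,-m-a+1}`. -/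
def vEntry (L : ℕ) (f g : Family N) (i : Fin (N + 1)) (t : Fin (N + 1) → ℂ) (m n : Fin L) : ℂ :=
  g i (m : ℤ) t / L *
    ∏ a ∈ Finset.Icc 1 (if m < n then (n : ℕ) - m else (n : ℕ) + L - m),
      (t i * f i ((m : ℤ) + (a : ℤ)) t)

/-- The residue matrix `Aᵢ`, `0 ≤ i ≤ N`. -/
def resA (L : ℕ) (f g : Family N) (i : Fin (N + 1)) (t : Fin (N + 1) → ℂ) :
    Matrix (Fin L) (Fin L) ℂ :=
  Matrix.of fun m n =>
    if m < n then - vEntry L f g i t m n else - ((t i ^ L)⁻¹ * vEntry L f g i t m n)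

/-- The residue matrix `A_{N+1}` at `z = 0`. -/
def resZero (L : ℕ) (d : ℤ → ℤ → ℂ) (f g : Family N) (t : Fin (N + 1) → ℂ) :
    Matrix (Fin L) (Fin L) ℂ :=
  Matrix.of fun m n =>
    if m = n then expZero L d n else if m < n then ∑ i, vEntry L f g i t m n else 0

/-- All the residue matrices `A₀, …, A_{N+1}` at the finite singular points. -/
def residues (L : ℕ) (d : ℤ → ℤ → ℂ) (f g : Family N) (i : Fin (N + 2))
    (t : Fin (N + 1) → ℂ) : Matrix (Fin L) (Fin L) ℂ :=
  Fin.snoc (α := fun _ => Matrix (Fin L) (Fin L) ℂ)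
    (fun i : Fin (N + 1) => resA L f g i t) (resZero L d f g t) i

/-- The finite singular points `uᵢ = tᵢ^{-L}` for `i ≤ N`, and `u_{N+1} = 0`. -/
def sing (L : ℕ) (t : Fin (N + 1) → ℂ) (i : Fin (N + 2)) : ℂ :=
  Fin.snoc (α := fun _ => ℂ) (fun i : Fin (N + 1) => (t i ^ L)⁻¹) 0 i

/-- The residue matrix `A_{N+2} = - ∑ᵢ Aᵢ` at `z = ∞`. -/
def resInfty (L : ℕ) (d : ℤ → ℤ → ℂ) (f g : Family N) (t : Fin (N + 1) → ℂ) :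
    Matrix (Fin L) (Fin L) ℂ :=
  - ∑ i, residues L d f g i t

/-- The coefficient matrix `A = ∑ᵢ Aᵢ / (z - uᵢ)`. -/
def coeffA (L : ℕ) (d : ℤ → ℤ → ℂ) (f g : Family N) (t : Fin (N + 1) → ℂ) (z : ℂ) :
    Matrix (Fin L) (Fin L) ℂ :=
  ∑ i : Fin (N + 2), (1 / (z - sing L t i)) • residues L d f g i t

/-- The coefficient matrix `Bᵢ` of the deformation equation. -/
def coeffB (L : ℕ) (θ : Fin (N + 1) → ℂ) (f g : Family N) (i : Fin (N + 1))
    (t : Fin (N + 1) → ℂ) (z : ℂ) : Matrix (Fin L) (Fin L) ℂ :=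
  Matrix.diagonal (fun n => θ i / (L * (t i ^ L)⁻¹) - vEntry L f g i t n n)
    + (1 / (z - (t i ^ L)⁻¹)) •
      Matrix.of (fun m n => if m < n then vEntry L f g i t m n else 0)
    + (z / (z - (t i ^ L)⁻¹)) •
      Matrix.of (fun m n => if n ≤ m then vEntry L f g i t m n else 0)

/-- The value of `Bᵢ` at `z = ∞`. -/
def coeffBInfty (L : ℕ) (θ : Fin (N + 1) → ℂ) (f g : Family N) (i : Fin (N + 1))
    (t : Fin (N + 1) → ℂ) : Matrix (Fin L) (Fin L) ℂ :=
  Matrix.diagonal (fun n => θ i / (L * (t i ^ L)⁻¹) - vEntry L f g i t n n)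
    + Matrix.of (fun m n => if n ≤ m then vEntry L f g i t m n else 0)

/-- The column vector `b^{(i)}`. -/
def bVec (L : ℕ) (f g : Family N) (i : Fin (N + 1)) (t : Fin (N + 1) → ℂ) : Fin L → ℂ :=
  fun n => - g i (n : ℤ) t / (L * t i ^ (n : ℕ) * ∏ m ∈ Finset.Icc 1 (n : ℕ), f i (m : ℤ) t)

/-- The row vector `c^{(i)}`. -/
def cVec (L : ℕ) (f : Family N) (i : Fin (N + 1)) (t : Fin (N + 1) → ℂ) : Fin L → ℂ :=
  fun n => t i ^ (n : ℕ) * ∏ m ∈ Finset.Icc 1 (n : ℕ), f i (m : ℤ) t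

/-- The vector `Φ = (φ_{-1,0}, k φ_{0,-1}, …, k^{L-1} φ_{L-2,-L+1})`. -/
def PhiVec (L : ℕ) (τ : ℤ → ℤ → Pt → ℂ) (θ t : Fin (N + 1) → ℂ) (k : ℂ) : Fin L → ℂ :=
  fun j => k ^ (j : ℕ) * phi τ ((j : ℤ) - 1) (-(j : ℤ)) θ t k

/-- The multiset of algebraic multiplicities of the distinct eigenvalues of a matrix. -/
def multiplicities {L : ℕ} (M : Matrix (Fin L) (Fin L) ℂ) : Multiset ℕ :=
  M.charpoly.roots.dedup.map fun a => M.charpoly.roots.count a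

/-- The compatibility condition `[∂/∂uᵢ - Bᵢ, ∂/∂z - A] = 0`, that is,
`∂A/∂uᵢ - ∂Bᵢ/∂z + A Bᵢ - Bᵢ A = 0`, for all `i` and all `z` off the singular points. -/
def IsCompatible (L : ℕ) (d : ℤ → ℤ → ℂ) (θ : Fin (N + 1) → ℂ)
    (T : Set (Fin (N + 1) → ℂ)) (f g : Family N) : Prop :=
  ∀ t ∈ T, ∀ z : ℂ, (∀ l, z ≠ sing L t l) → ∀ i : Fin (N + 1),
    Matrix.of (fun m n => pdU L i (fun s => coeffA L d f g s z m n) t)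
      - Matrix.of (fun m n => deriv (fun w => coeffB L θ f g i t w m n) z)
      + (coeffA L d f g t z * coeffB L θ f g i t z
          - coeffB L θ f g i t z * coeffA L d f g t z) = 0

/-- The Schlesinger system on `V`: `∂Mᵢ/∂u_j = [Mᵢ, M_j] / (uᵢ - u_j)` for `i ≠ j`, and
`∂M_j/∂u_j = - ∑_{l ≠ j} [M_j, M_l] / (u_j - u_l)`, where `u_{N+1} = 0`. -/
def SolvesSchlesinger (L : ℕ) (V : Set (Fin (N + 1) → ℂ))
    (M : Fin (N + 2) → (Fin (N + 1) → ℂ) → Matrix (Fin L) (Fin L) ℂ) : Prop :=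
  ∀ t ∈ V, ∀ j : Fin (N + 1),
    (∀ i : Fin (N + 2), i ≠ j.castSucc →
      Matrix.of (fun m n => pdU L j (fun s => M i s m n) t) =
        (1 / (sing L t i - sing L t j.castSucc)) •
          (M i t * M j.castSucc t - M j.castSucc t * M i t)) ∧
    Matrix.of (fun m n => pdU L j (fun s => M j.castSucc s m n) t) =
      - ∑ l ∈ Finset.univ.erase j.castSucc, (1 / (sing L t j.castSucc - sing L t l)) •
          (M j.castSucc t * M l t - M l t * M j.castSucc t)

/-- Locally on `T`, the gauge transformation `Φ = Q Φ'` with an invertible lower triangular `Q`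
independent of `z` which normalizes the deformation equations at infinity
(`∂Q/∂uᵢ = Bᵢ|_{z=∞} Q`) turns the residue matrices into a solution of the Schlesinger system. -/
def IsSchlesingerUpToGauge (L : ℕ) (d : ℤ → ℤ → ℂ) (θ : Fin (N + 1) → ℂ)
    (T : Set (Fin (N + 1) → ℂ)) (f g : Family N) : Prop :=
  ∀ t₀ ∈ T, ∃ V : Set (Fin (N + 1) → ℂ), IsOpen V ∧ t₀ ∈ V ∧ V ⊆ T ∧
    ∃ Q : (Fin (N + 1) → ℂ) → Matrix (Fin L) (Fin L) ℂ,
      (∀ m n, DifferentiableOn ℂ (fun t => Q t m n) V) ∧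
      (∀ t ∈ V, IsUnit (Q t).det) ∧
      (∀ t ∈ V, ∀ m n, m < n → Q t m n = 0) ∧
      (∀ t ∈ V, ∀ i, Matrix.of (fun m n => pdU L i (fun s => Q s m n) t) =
        coeffBInfty L θ f g i t * Q t) ∧
      SolvesSchlesinger L V (fun i t => (Q t)⁻¹ * residues L d f g i t * Q t)

end UCReduction

end

open scoped BigOperators

noncomputable section

namespace UCReduction

section

variable {N : ℕ}

/-! ### Calculus of the partial derivatives -/

/-! One elementary object carries the whole proof: a first-order recursion around the cycle ℤ/L with
a nontrivial multiplier.

For an admissible family put c_n = t_i^n f_1 ⋯ f_n (`cNat`). The f multiply to 1 over a period, so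
c_{n+L} = t_i^L c_n, and the two cases in the definition of A_i collapse into the single formula
-g_m c_n / (L c_m). This gives the rank-one factorization and the exponents. The functions U^{(i,l)}
are the periodic solutions of U_j + g_j = (t_i f^{(i)}_j / t_l f^{(l)}_j) U_{j-1}, unique because
t_i^L ≠ t_l^L. Multiplied by c^{(l)}_n / c^{(i)}_n the recursion becomes a summation, so U is a sum
over one period with weight 1 up to the index n and weight (t_i/t_l)^L beyond it
(`quasiperiodic_recursion`, `auxU_eq_sum`).

Compatibility. Since B_i = B_i(∞) - A_i/(z - u_i), the double poles cancel, and the condition says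
that the residues at the finite singular points vanish (`isCompatible_iff`). For i ≠ j the residue
at u_i of the j-th condition is ∂A_i/∂u_j minus the commutator of A_i with a copy of A_j, rescaled,
whose strictly lower entries carry an extra weight. The entries of this commutator are sums of the
kind just described, so the equation gives t_j ∂/∂t_j of g_m c_n / c_m in terms of U
(`residue_rhs_apply`). The equation for ∂A_i/∂u_i is traded for the sum over j with weights u_j.
There the pole terms collapse to a commutator with a constant diagonal matrix, which expresses
homogeneity under dilation (`sum_smul_residueDefect`). The system G has the same shape: given its
other equations, those for t_i-derivatives of f^{(i)} and g^{(i)} amount to homogeneity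
(`solvesG_iff_flow`). The residue at z = 0 follows from the others by triangularity
(`residueDefect_last_eq_zero`). Conversely, the entries of A_i determine the derivatives of f^{(i)}
and g^{(i)} once some g^{(i)}_m is nonzero, and θ_i ≠ 0 ensures this because the g^{(i)}_m add up to
Lθ_i (`fderiv_of_fderiv_resEntry`).

Schlesinger form. B_i(∞) is a scalar plus a multiple of the strictly lower part of A_i. The residue
equations, projected to strictly lower matrices, make this connection flat
(`flat_of_solvesResidue`). It is then integrated locally, row by row, with the Poincaré lemma
(`exists_gauge`). Conjugation by the resulting Q removes B_i(∞) and turns the residue equations into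
the Schlesinger system (`solvesSchlesinger_gauge_iff`).

Tau functions. The power-sum substitution sends θ_i δ_{t_i} to t_i ∂/∂t_i and E to the Euler field,
and raising θ_i is translation by ([t_i], [t_i⁻¹]). The first UC equation then shows that certain
quotients of tau functions satisfy the recursion of U, so they are U (`auxU_of_tau`), and the mixed
equation gives the derivatives of g (`solvesFlow_of_tau`). A wave function is of the same type, with
one more variable k⁻¹ of exponent -1. Its difference equation along (m, -m) is once more a
quasi-periodic recursion, with multiplier u_i/z. Solving it expresses the raised wave functions
through Φ and closes the linear system (`wave_recursion`). -/

theorem hasDerivAt_comp_update {F : (Fin (N + 1) → ℂ) → ℂ} {t : Fin (N + 1) → ℂ}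
    (i : Fin (N + 1)) (hF : DifferentiableAt ℂ F t) :
    HasDerivAt (fun s => F (Function.update t i s)) (fderiv ℂ F t (Pi.single i 1)) (t i) := by
  have h1 := hasDerivAt_update t i (t i)
  have h2 : HasFDerivAt F (fderiv ℂ F t) (Function.update t i (t i)) := by
    simpa using hF.hasFDerivAt
  exact h2.comp_hasDerivAt (t i) h1

theorem pd_eq_fderiv {F : (Fin (N + 1) → ℂ) → ℂ} {t : Fin (N + 1) → ℂ}
    (i : Fin (N + 1)) (hF : DifferentiableAt ℂ F t) :
    pd i F t = fderiv ℂ F t (Pi.single i 1) :=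
  (hasDerivAt_comp_update i hF).deriv

theorem pd_congr {F G : (Fin (N + 1) → ℂ) → ℂ} {t : Fin (N + 1) → ℂ} (i : Fin (N + 1))
    (h : F =ᶠ[nhds t] G) : pd i F t = pd i G t := by
  refine Filter.EventuallyEq.deriv_eq ?_
  have h1 : Filter.Tendsto (fun s => Function.update t i s) (nhds (t i)) (nhds t) := by
    have := (hasDerivAt_update t i (t i)).continuousAt.tendsto
    simpa using this
  exact h1.eventually h

theorem pd_congr_of_eqOn {F G : (Fin (N + 1) → ℂ) → ℂ} {T : Set (Fin (N + 1) → ℂ)}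
    (hT : IsOpen T) {t : Fin (N + 1) → ℂ} (ht : t ∈ T) (i : Fin (N + 1))
    (h : ∀ s ∈ T, F s = G s) : pd i F t = pd i G t :=
  pd_congr i (Filter.eventually_of_mem (hT.mem_nhds ht) h)

@[simp]
theorem pd_const (i : Fin (N + 1)) (c : ℂ) (t : Fin (N + 1) → ℂ) :
    pd i (fun _ => c) t = 0 := by simp [pd]

theorem pd_coord (i j : Fin (N + 1)) (t : Fin (N + 1) → ℂ) :
    pd i (fun s => s j) t = if j = i then 1 else 0 := by
  unfold pd
  split_ifs with h
  · subst h; simp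
  · simp [Function.update_of_ne h]

section
variable {F G : (Fin (N + 1) → ℂ) → ℂ} {t : Fin (N + 1) → ℂ} (i : Fin (N + 1))

theorem pd_sub (hF : DifferentiableAt ℂ F t) (hG : DifferentiableAt ℂ G t) :
    pd i (fun s => F s - G s) t = pd i F t - pd i G t := by
  have h := (hasDerivAt_comp_update i hF).sub (hasDerivAt_comp_update i hG)
  rw [pd_eq_fderiv i hF, pd_eq_fderiv i hG]; exact h.deriv

theorem pd_mul (hF : DifferentiableAt ℂ F t) (hG : DifferentiableAt ℂ G t) :
    pd i (fun s => F s * G s) t = pd i F t * G t + F t * pd i G t := by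
  have h := (hasDerivAt_comp_update i hF).mul (hasDerivAt_comp_update i hG)
  rw [pd_eq_fderiv i hF, pd_eq_fderiv i hG]
  exact Eq.trans h.deriv (by simp)

theorem pd_div (hF : DifferentiableAt ℂ F t) (hG : DifferentiableAt ℂ G t) (h0 : G t ≠ 0) :
    pd i (fun s => F s / G s) t = (pd i F t * G t - F t * pd i G t) / G t ^ 2 := by
  have h := (hasDerivAt_comp_update i hF).div (hasDerivAt_comp_update i hG) (by simpa using h0)
  rw [pd_eq_fderiv i hF, pd_eq_fderiv i hG]
  exact Eq.trans h.deriv (by simp)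

theorem pd_neg : pd i (fun s => - F s) t = - pd i F t := by
  simp [pd, deriv.fun_neg]

theorem pd_const_mul (c : ℂ) : pd i (fun s => c * F s) t = c * pd i F t := by
  simp [pd]

theorem pd_inv (hF : DifferentiableAt ℂ F t) (h0 : F t ≠ 0) :
    pd i (fun s => (F s)⁻¹) t = - pd i F t / F t ^ 2 := by
  have h := (hasDerivAt_comp_update i hF).inv (by simpa using h0)
  rw [pd_eq_fderiv i hF]
  exact Eq.trans h.deriv (by simp)

theorem pd_pow (n : ℕ) (hF : DifferentiableAt ℂ F t) :
    pd i (fun s => F s ^ n) t = n * F t ^ (n - 1) * pd i F t := by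
  have h := (hasDerivAt_comp_update i hF).pow n
  rw [pd_eq_fderiv i hF]
  exact Eq.trans h.deriv (by simp)

theorem pd_exp (hF : DifferentiableAt ℂ F t) :
    pd i (fun s => Complex.exp (F s)) t = Complex.exp (F t) * pd i F t := by
  have h := (hasDerivAt_comp_update i hF).cexp
  rw [pd_eq_fderiv i hF]
  exact Eq.trans h.deriv (by simp)

end

theorem pd_sum {ι : Type*} (S : Finset ι) {F : ι → (Fin (N + 1) → ℂ) → ℂ} {t : Fin (N + 1) → ℂ}
    (i : Fin (N + 1)) (hF : ∀ a ∈ S, DifferentiableAt ℂ (F a) t) :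
    pd i (fun s => ∑ a ∈ S, F a s) t = ∑ a ∈ S, pd i (F a) t := by
  have h := HasDerivAt.fun_sum (u := S) (A := fun a s => F a (Function.update t i s))
    (fun a ha => hasDerivAt_comp_update i (hF a ha))
  rw [Finset.sum_congr rfl fun a ha => pd_eq_fderiv i (hF a ha)]
  exact h.deriv

theorem differentiableAt_prod {E ι : Type*} [NormedAddCommGroup E] [NormedSpace ℂ E] {S : Finset ι}
    {F : ι → E → ℂ} {t : E} (hF : ∀ a ∈ S, DifferentiableAt ℂ (F a) t) :
    DifferentiableAt ℂ (fun s => ∏ a ∈ S, F a s) t := by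
  classical
  induction S using Finset.induction_on with
  | empty => simp
  | insert a S ha ih =>
    simp only [Finset.prod_insert ha]
    exact (hF a (Finset.mem_insert_self a S)).fun_mul
      (ih fun b hb => hF b (Finset.mem_insert_of_mem hb))

theorem differentiableAt_div {E : Type*} [NormedAddCommGroup E] [NormedSpace ℂ E]
    {F G : E → ℂ} {t : E} (hF : DifferentiableAt ℂ F t) (hG : DifferentiableAt ℂ G t)
    (h : G t ≠ 0) : DifferentiableAt ℂ (fun s => F s / G s) t := by
  simp only [div_eq_mul_inv]
  exact hF.fun_mul (hG.fun_inv h)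

theorem differentiableAt_coord (i : Fin (N + 1)) (t : Fin (N + 1) → ℂ) :
    DifferentiableAt ℂ (fun s : Fin (N + 1) → ℂ => s i) t := by fun_prop

/-- The total derivative in terms of the partial derivatives. -/
theorem fderiv_apply_eq_sum_pd {F : (Fin (N + 1) → ℂ) → ℂ} {t : Fin (N + 1) → ℂ}
    (hF : DifferentiableAt ℂ F t) (v : Fin (N + 1) → ℂ) :
    fderiv ℂ F t v = ∑ i, v i * pd i F t := by
  conv_lhs => rw [← Finset.univ_sum_single v, map_sum]
  refine Finset.sum_congr rfl fun i _ => ?_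
  rw [pd_eq_fderiv i hF, ← smul_eq_mul, ← map_smul]
  congr 1
  ext j; simp [Pi.single_apply]

/-! ### The derivations `∂ / ∂uᵢ` on functions and matrices -/

theorem deriv_inv_pow (L : ℕ) {x : ℂ} (hx : x ≠ 0) :
    deriv (fun s : ℂ => (s ^ L)⁻¹) x = - L * (x ^ L)⁻¹ / x := by
  have h := ((hasDerivAt_id x).pow L).inv (pow_ne_zero L hx)
  have h' : HasDerivAt (fun s : ℂ => (s ^ L)⁻¹) _ x := h
  rw [h'.deriv]
  rcases L with _ | L
  · simp
  · simp; field_simp; ring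

/-- Since du_i/dt_i = -L u_i / t_i, logarithmic derivatives in u_i and t_i differ only by the
constant -1/L. The nonlinear system is written in t and the matrix equations in u; this is the
dictionary. -/
theorem pdU_eq {L : ℕ} (i : Fin (N + 1)) {F : (Fin (N + 1) → ℂ) → ℂ} {t : Fin (N + 1) → ℂ}
    (hL : L ≠ 0) (ht : t i ≠ 0) :
    pdU L i F t = - (t i ^ L / L) * (t i * pd i F t) := by
  have : (L : ℂ) ≠ 0 := by exact_mod_cast hL
  rw [pdU, deriv_inv_pow L ht]
  field_simp

theorem pd_eq_pdU {L : ℕ} (i : Fin (N + 1)) {F : (Fin (N + 1) → ℂ) → ℂ} {t : Fin (N + 1) → ℂ}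
    (hL : L ≠ 0) (ht : t i ≠ 0) :
    pd i F t = deriv (fun s : ℂ => (s ^ L)⁻¹) (t i) * pdU L i F t := by
  have hL' : (L : ℂ) ≠ 0 := by exact_mod_cast hL
  have h : deriv (fun s : ℂ => (s ^ L)⁻¹) (t i) ≠ 0 := by
    rw [deriv_inv_pow L ht]; simp [hL', ht]
  rw [pdU, mul_div_cancel₀ _ h]

theorem pdU_congr {L : ℕ} {F G : (Fin (N + 1) → ℂ) → ℂ} {t : Fin (N + 1) → ℂ} (i : Fin (N + 1))
    (h : F =ᶠ[nhds t] G) : pdU L i F t = pdU L i G t := by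
  rw [pdU, pdU, pd_congr i h]

/-- Entrywise differentiability of a matrix function. -/
def MDiff {L : ℕ} (M : (Fin (N + 1) → ℂ) → Matrix (Fin L) (Fin L) ℂ) (t : Fin (N + 1) → ℂ) : Prop :=
  ∀ m n, DifferentiableAt ℂ (fun s => M s m n) t

/-- The entrywise derivative `∂M / ∂uᵢ`. -/
def mpdU (L : ℕ) (i : Fin (N + 1)) (M : (Fin (N + 1) → ℂ) → Matrix (Fin L) (Fin L) ℂ)
    (t : Fin (N + 1) → ℂ) : Matrix (Fin L) (Fin L) ℂ :=
  Matrix.of fun m n => pdU L i (fun s => M s m n) t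

section
variable {L : ℕ} {M P : (Fin (N + 1) → ℂ) → Matrix (Fin L) (Fin L) ℂ} {t : Fin (N + 1) → ℂ}
  (i : Fin (N + 1))

theorem mpdU_congr (h : M =ᶠ[nhds t] P) : mpdU L i M t = mpdU L i P t := by
  ext m n
  exact pdU_congr i (h.mono fun s hs => by simp [hs])

theorem MDiff.mul (hM : MDiff M t) (hP : MDiff P t) : MDiff (fun s => M s * P s) t := by
  intro m n
  simp only [Matrix.mul_apply]
  exact DifferentiableAt.fun_sum fun a _ => (hM m a).mul (hP a n)

theorem mpdU_mul (hM : MDiff M t) (hP : MDiff P t) :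
    mpdU L i (fun s => M s * P s) t = mpdU L i M t * P t + M t * mpdU L i P t := by
  ext m n
  simp only [mpdU, Matrix.of_apply, Matrix.add_apply, Matrix.mul_apply, pdU]
  rw [pd_sum _ _ fun a _ => (hM m a).fun_mul (hP a n), Finset.sum_div, ← Finset.sum_add_distrib]
  refine Finset.sum_congr rfl fun a _ => ?_
  rw [pd_mul i (hM m a) (hP a n)]
  ring

theorem MDiff.neg (hM : MDiff M t) : MDiff (fun s => - M s) t := fun m n => (hM m n).fun_neg

theorem mpdU_neg : mpdU L i (fun s => - M s) t = - mpdU L i M t := by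
  ext m n
  simp [mpdU, pdU, pd_neg, neg_div]

theorem mpdU_sum {ι : Type*} {S : Finset ι} {M : ι → (Fin (N + 1) → ℂ) → Matrix (Fin L) (Fin L) ℂ}
    (hM : ∀ a ∈ S, MDiff (M a) t) :
    mpdU L i (fun s => ∑ a ∈ S, M a s) t = ∑ a ∈ S, mpdU L i (M a) t := by
  ext m n
  simp only [mpdU, Matrix.of_apply, Matrix.sum_apply, pdU]
  rw [pd_sum _ _ fun a ha => hM a ha m n, Finset.sum_div]

theorem MDiff.smul {c : (Fin (N + 1) → ℂ) → ℂ} (hc : DifferentiableAt ℂ c t) (hM : MDiff M t) :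
    MDiff (fun s => c s • M s) t := fun m n => hc.fun_mul (hM m n)

theorem mpdU_smul {c : (Fin (N + 1) → ℂ) → ℂ} (hc : DifferentiableAt ℂ c t) (hM : MDiff M t) :
    mpdU L i (fun s => c s • M s) t = pdU L i c t • M t + c t • mpdU L i M t := by
  ext m n
  simp only [mpdU, Matrix.of_apply, Matrix.smul_apply, Matrix.add_apply, pdU, smul_eq_mul]
  rw [pd_mul i hc (hM m n)]
  ring

theorem mpdU_const (A : Matrix (Fin L) (Fin L) ℂ) : mpdU L i (fun _ => A) t = 0 := by
  ext m n; simp [mpdU, pdU]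

theorem differentiableAt_det (hM : MDiff M t) : DifferentiableAt ℂ (fun s => (M s).det) t := by
  simp only [Matrix.det_apply']
  refine DifferentiableAt.fun_sum fun σ _ => DifferentiableAt.const_mul ?_ _
  exact differentiableAt_prod fun a _ => hM (σ a) a

theorem MDiff.inv (hM : MDiff M t) (h : IsUnit (M t).det) : MDiff (fun s => (M s)⁻¹) t := by
  intro m n
  simp only [Matrix.inv_def, Ring.inverse_eq_inv', Matrix.smul_apply, smul_eq_mul,
    Matrix.adjugate_apply]
  refine ((differentiableAt_det hM).fun_inv h.ne_zero).fun_mul (differentiableAt_det ?_)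
  intro a b
  simp only [Matrix.updateRow_apply]
  split_ifs
  · exact differentiableAt_const _
  · exact hM a b

/-- Differentiate M M⁻¹ = 1, an identity that persists near t because the determinant stays nonzero
there. -/
theorem mpdU_inv (hM : MDiff M t) (h : IsUnit (M t).det) :
    mpdU L i (fun s => (M s)⁻¹) t = - ((M t)⁻¹ * mpdU L i M t * (M t)⁻¹) := by
  have h1 := mpdU_mul i hM (hM.inv h)
  have h2 : mpdU L i (fun s => M s * (M s)⁻¹) t = 0 := by
    rw [← mpdU_const (t := t) i (1 : Matrix (Fin L) (Fin L) ℂ)]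
    refine mpdU_congr i ?_
    have : ∀ᶠ s in nhds t, (M s).det ≠ 0 :=
      (differentiableAt_det hM).continuousAt.eventually_ne h.ne_zero
    filter_upwards [this] with s hs
    exact Matrix.mul_nonsing_inv _ (isUnit_iff_ne_zero.mpr hs)
  rw [h2] at h1
  have h3 : (M t)⁻¹ * (M t * mpdU L i (fun s => (M s)⁻¹) t)
      = (M t)⁻¹ * (- (mpdU L i M t * (M t)⁻¹)) := by
    rw [eq_neg_of_add_eq_zero_right h1.symm]
  rw [← mul_assoc, Matrix.nonsing_inv_mul _ h, one_mul] at h3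
  rw [h3, mul_neg, mul_assoc]

/-- Derivative of a matrix after a gauge transformation by a fundamental solution. -/
theorem mpdU_gauge {A Q : (Fin (N + 1) → ℂ) → Matrix (Fin L) (Fin L) ℂ}
    {B : Matrix (Fin L) (Fin L) ℂ} (hA : MDiff A t) (hQ : MDiff Q t) (h : IsUnit (Q t).det)
    (hB : mpdU L i Q t = B * Q t) :
    mpdU L i (fun s => (Q s)⁻¹ * A s * Q s) t =
      (Q t)⁻¹ * (mpdU L i A t - (B * A t - A t * B)) * Q t := by
  rw [mpdU_mul i ((hQ.inv h).mul hA) hQ, mpdU_mul i (hQ.inv h) hA, mpdU_inv i hQ h, hB]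
  have : B * Q t * (Q t)⁻¹ = B := by rw [mul_assoc, Matrix.mul_nonsing_inv _ h, mul_one]
  rw [mul_assoc ((Q t)⁻¹) (B * Q t), this]
  noncomm_ring

end

end

section

variable {N : ℕ}

/-! ### Existence of the gauge transformation -/

theorem pd_comp_coord_of_ne {i j : Fin (N + 1)} (h : i ≠ j) (c : ℂ → ℂ) (t : Fin (N + 1) → ℂ) :
    pd j (fun s => c (s i)) t = 0 := by
  simp [pd, Function.update_of_ne h]

/-- The Poincaré lemma in the coordinates `uᵢ`. -/
theorem exists_primitive {L : ℕ} (hL : L ≠ 0) {V : Set (Fin (N + 1) → ℂ)} (hV : IsOpen V)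
    (hc : Convex ℝ V) (h0 : ∀ t ∈ V, ∀ i, t i ≠ 0) (S : Fin (N + 1) → (Fin (N + 1) → ℂ) → ℂ)
    (hS : ∀ i, DifferentiableOn ℂ (S i) V)
    (hsymm : ∀ t ∈ V, ∀ i j, i ≠ j → pdU L j (S i) t = pdU L i (S j) t) :
    ∃ F : (Fin (N + 1) → ℂ) → ℂ, DifferentiableOn ℂ F V ∧ ∀ t ∈ V, ∀ i, pdU L i F t = S i t := by
  have hL' : (L : ℂ) ≠ 0 := by exact_mod_cast hL
  -- Here du_i = c(t_i) dt_i, so the form ∑ S_i du_i has coefficients w_i = c(t_i) S_i in the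
  -- coordinates t_i.
  set c : ℂ → ℂ := fun x => - L * (x ^ L)⁻¹ / x with hcdef
  set w : Fin (N + 1) → (Fin (N + 1) → ℂ) → ℂ := fun i t => c (t i) * S i t with hw
  have hcd : ∀ t ∈ V, ∀ i, DifferentiableAt ℂ (fun s : Fin (N + 1) → ℂ => c (s i)) t := by
    intro t ht i
    have h := h0 t ht i
    have h1 : DifferentiableAt ℂ (fun s : Fin (N + 1) → ℂ => s i) t := differentiableAt_coord i t
    have h2 : DifferentiableAt ℂ (fun s : Fin (N + 1) → ℂ => - (L : ℂ) * (s i ^ L)⁻¹) t :=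
      ((h1.fun_pow L).fun_inv (pow_ne_zero L h)).const_mul _
    exact differentiableAt_div h2 h1 h
  have hSd : ∀ t ∈ V, ∀ i, DifferentiableAt ℂ (S i) t := fun t ht i =>
    (hS i).differentiableAt (hV.mem_nhds ht)
  have hwd : ∀ t ∈ V, ∀ i, DifferentiableAt ℂ (w i) t := fun t ht i =>
    (hcd t ht i).fun_mul (hSd t ht i)
  -- For i ≠ j the factor c(t_i) is constant in t_j, so closedness in the u-coordinates is
  -- closedness in the t-coordinates.
  have hwpd : ∀ t ∈ V, ∀ i j, pd j (w i) t = pd i (w j) t := by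
    intro t ht i j
    rcases eq_or_ne i j with rfl | hij
    · rfl
    · have e1 : ∀ i j, i ≠ j → pd j (w i) t = c (t i) * (c (t j) * pdU L j (S i) t) := by
        intro i j hij
        rw [hw, pd_mul j (hcd t ht i) (hSd t ht i), pd_comp_coord_of_ne hij,
          pd_eq_pdU j hL (h0 t ht j), deriv_inv_pow L (h0 t ht j)]
        ring
      rw [e1 i j hij, e1 j i hij.symm, hsymm t ht i j hij]
      ring
  set ω : (Fin (N + 1) → ℂ) → ((Fin (N + 1) → ℂ) →L[ℂ] ℂ) :=
    fun t => ∑ i, w i t • ContinuousLinearMap.proj (R := ℂ) (φ := fun _ : Fin (N + 1) => ℂ) i with hω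
  have hωd : ∀ t ∈ V, HasFDerivAt ω (∑ i, (fderiv ℂ (w i) t).smulRight
      (ContinuousLinearMap.proj (R := ℂ) (φ := fun _ : Fin (N + 1) => ℂ) i)) t := by
    intro t ht
    refine HasFDerivAt.fun_sum fun i _ => ?_
    exact HasFDerivAt.smul_const (hwd t ht i).hasFDerivAt
      (ContinuousLinearMap.proj (R := ℂ) (φ := fun _ : Fin (N + 1) => ℂ) i)
  obtain ⟨F, hF⟩ := hc.exists_forall_hasFDerivAt_of_fderiv_symmetric hV (ω := ω)
    (fun t ht => ((hωd t ht).restrictScalars ℝ).differentiableAt.differentiableWithinAt)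
    (fun t ht x y => by
      rw [((hωd t ht).restrictScalars ℝ).fderiv]
      simp only [ContinuousLinearMap.coe_restrictScalars', sum_apply,
        ContinuousLinearMap.smulRight_apply, smul_apply,
        ContinuousLinearMap.proj_apply, smul_eq_mul]
      simp only [fderiv_apply_eq_sum_pd (hwd t ht _), Finset.sum_mul]
      rw [Finset.sum_comm]
      refine Finset.sum_congr rfl fun i _ => Finset.sum_congr rfl fun j _ => ?_
      rw [hwpd t ht j i]
      ring)
  refine ⟨F, fun t ht => (hF t ht).differentiableAt.differentiableWithinAt, fun t ht i => ?_⟩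
  rw [pdU, pd_eq_fderiv i (hF t ht).differentiableAt, (hF t ht).fderiv, deriv_inv_pow L (h0 t ht i)]
  have : c (t i) ≠ 0 := by simp [hcdef, hL', h0 t ht i]
  simp only [hω, sum_apply, smul_apply,
    ContinuousLinearMap.proj_apply, smul_eq_mul, Pi.single_apply, mul_ite, mul_one, mul_zero,
    Finset.sum_ite_eq', Finset.mem_univ, if_true, hw]
  change c (t i) * S i t / c (t i) = S i t
  field_simp

/-- A flat strictly lower triangular connection has unipotent horizontal sections: one column. -/
theorem exists_horizontal_column {L : ℕ} (hL : L ≠ 0) {V : Set (Fin (N + 1) → ℂ)} (hV : IsOpen V)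
    (hc : Convex ℝ V) (h0 : ∀ t ∈ V, ∀ i, t i ≠ 0)
    (C : Fin (N + 1) → (Fin (N + 1) → ℂ) → Matrix (Fin L) (Fin L) ℂ)
    (hC : ∀ t ∈ V, ∀ i, MDiff (C i) t)
    (hlow : ∀ t i m n, m ≤ n → C i t m n = 0)
    (hflat : ∀ t ∈ V, ∀ i j, i ≠ j →
      mpdU L j (C i) t + C i t * C j t = mpdU L i (C j) t + C j t * C i t)
    (n : Fin L) (k : ℕ) :
    ∃ q : Fin L → (Fin (N + 1) → ℂ) → ℂ,
      (∀ m : Fin L, (m : ℕ) < k → DifferentiableOn ℂ (q m) V ∧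
        ∀ t ∈ V, ∀ i, pdU L i (q m) t = ∑ p, C i t m p * q p t) ∧
      (∀ m < n, q m = fun _ => 0) ∧ q n = fun _ => 1 := by
  -- Rows are filled from the top. Strict triangularity means that the equation of row m involves
  -- only rows p < m: entries above the diagonal are 0, the diagonal entry is 1, and each later row
  -- is the primitive of a known closed form.
  induction k with
  | zero => exact ⟨fun m _ => if m = n then 1 else 0, by simp,
      fun m hm => by simp [hm.ne], by simp⟩
  | succ k ih =>
    obtain ⟨q, hq, hq0, hq1⟩ := ih
    by_cases hk : k < L
    swap
    · exact ⟨q, fun m _ => hq m (lt_of_lt_of_le m.2 (not_lt.mp hk)), hq0, hq1⟩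
    set m : Fin L := ⟨k, hk⟩ with hm
    by_cases hmn : m ≤ n
    · refine ⟨q, fun m' hm' => ?_, hq0, hq1⟩
      rcases Nat.lt_succ_iff_lt_or_eq.mp hm' with h | h
      · exact hq m' h
      · have hmm : m' = m := Fin.ext h
        rw [hmm]
        have hz : ∀ t i, ∑ p, C i t m p * q p t = 0 := fun t i => Finset.sum_eq_zero fun p _ => by
          by_cases hp : m ≤ p
          · rw [hlow t i _ _ hp, zero_mul]
          · rw [hq0 p (lt_of_lt_of_le (not_le.mp hp) hmn), mul_zero]
        simp only [hz]
        rcases hmn.lt_or_eq with h' | h'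
        · rw [hq0 _ h']; exact ⟨differentiableOn_const _, by simp [pdU]⟩
        · rw [h', hq1]; exact ⟨differentiableOn_const _, by simp [pdU]⟩
    · rw [not_le] at hmn
      set S : Fin (N + 1) → (Fin (N + 1) → ℂ) → ℂ := fun i t =>
        ∑ p ∈ Finset.univ.filter (· < m), C i t m p * q p t with hS
      have hqd : ∀ t ∈ V, ∀ p ∈ Finset.univ.filter (· < m), DifferentiableAt ℂ (q p) t :=
        fun t ht p hp => (hq p (Finset.mem_filter.mp hp).2).1.differentiableAt (hV.mem_nhds ht)
      have hSd : ∀ t ∈ V, ∀ i, DifferentiableAt ℂ (S i) t := fun t ht i =>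
        DifferentiableAt.fun_sum fun p hp => (hC t ht i m p).fun_mul (hqd t ht p hp)
      have hfull : ∀ (x : Fin L → ℂ) i t,
          ∑ p ∈ Finset.univ.filter (· < m), C i t m p * x p = ∑ p, C i t m p * x p := by
        intro x i t
        refine Finset.sum_subset (Finset.filter_subset _ _) fun p _ hp => ?_
        rw [hlow t i m p (by simpa using hp), zero_mul]
      have hmul : ∀ t i j, ∑ p, C i t m p * ∑ r, C j t p r * q r t =
          ∑ r, (C i t * C j t) m r * q r t := by
        intro t i j
        simp only [Matrix.mul_apply, Finset.sum_mul, Finset.mul_sum]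
        rw [Finset.sum_comm]
        simp only [mul_assoc]
      -- Differentiating the source C_i q gives (∂_j C_i + C_i C_j) q; its symmetry in i and j is
      -- the flatness hypothesis, so the source is closed.
      have hSU : ∀ t ∈ V, ∀ i j, pdU L j (S i) t =
          ∑ r, (mpdU L j (C i) t + C i t * C j t) m r * q r t := by
        intro t ht i j
        simp only [Matrix.add_apply, add_mul, Finset.sum_add_distrib]
        rw [← hmul, ← hfull]
        have e1 : ∑ r, mpdU L j (C i) t m r * q r t =
            ∑ p ∈ Finset.univ.filter (· < m), mpdU L j (C i) t m p * q p t := by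
          symm
          refine Finset.sum_subset (Finset.filter_subset _ _) fun p _ hp => ?_
          have : mpdU L j (C i) t m p = 0 := by
            simp [mpdU, pdU, hlow _ i m p (by simpa using hp)]
          rw [this, zero_mul]
        rw [e1, pdU, hS, pd_sum _ _ fun p hp => (hC t ht i m p).fun_mul (hqd t ht p hp),
          Finset.sum_div, ← Finset.sum_add_distrib]
        refine Finset.sum_congr rfl fun p hp => ?_
        rw [pd_mul j (hC t ht i m p) (hqd t ht p hp), ← (hq p (Finset.mem_filter.mp hp).2).2 t ht j]
        simp only [mpdU, pdU, Matrix.of_apply]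
        ring
      obtain ⟨F, hFd, hF⟩ := exists_primitive hL hV hc h0 S
        (fun i t ht => (hSd t ht i).differentiableWithinAt)
        (fun t ht i j hij => by rw [hSU t ht, hSU t ht, hflat t ht i j hij])
      -- Changing row m leaves the equations of the rows up to m intact, since the column m of C
      -- vanishes in these rows.
      refine ⟨Function.update q m F, fun m' hm' => ?_, fun m' h' => ?_, ?_⟩
      · have hsum : ∀ t i, ∀ m' ≤ m, ∑ p, C i t m' p * Function.update q m F p t =
            ∑ p, C i t m' p * q p t := by
          intro t i m' hm'
          refine Finset.sum_congr rfl fun p _ => ?_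
          rcases eq_or_ne p m with rfl | hp
          · rw [hlow t i _ _ hm', zero_mul, zero_mul]
          · rw [Function.update_of_ne hp]
        rcases Nat.lt_succ_iff_lt_or_eq.mp hm' with h | h
        · have hne : m' ≠ m := fun h' => by rw [h', hm] at h; exact lt_irrefl _ h
          have hle : m' ≤ m := Fin.mk_le_mk.mpr h.le
          simp only [hsum _ _ m' hle]
          rw [Function.update_of_ne hne]
          exact hq m' h
        · have hmm : m' = m := Fin.ext h
          rw [hmm]
          simp only [hsum _ _ m le_rfl, Function.update_self]
          exact ⟨hFd, fun t ht i => (hF t ht i).trans (hfull (fun p => q p t) i t)⟩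
      · rw [Function.update_of_ne (h'.trans hmn).ne]; exact hq0 m' h'
      · rw [Function.update_of_ne hmn.ne]; exact hq1

/-- Local fundamental solutions of a flat lower triangular connection with scalar diagonal. -/
theorem exists_gauge {L : ℕ} (hL : L ≠ 0) {V : Set (Fin (N + 1) → ℂ)} (hV : IsOpen V)
    (hc : Convex ℝ V) (h0 : ∀ t ∈ V, ∀ i, t i ≠ 0) (θ : Fin (N + 1) → ℂ)
    (C : Fin (N + 1) → (Fin (N + 1) → ℂ) → Matrix (Fin L) (Fin L) ℂ)
    (hC : ∀ t ∈ V, ∀ i, MDiff (C i) t)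
    (hlow : ∀ t i m n, m ≤ n → C i t m n = 0)
    (hflat : ∀ t ∈ V, ∀ i j, i ≠ j →
      mpdU L j (C i) t + C i t * C j t = mpdU L i (C j) t + C j t * C i t) :
    ∃ Q : (Fin (N + 1) → ℂ) → Matrix (Fin L) (Fin L) ℂ,
      (∀ m n, DifferentiableOn ℂ (fun t => Q t m n) V) ∧
      (∀ t ∈ V, IsUnit (Q t).det) ∧
      (∀ t ∈ V, ∀ m n, m < n → Q t m n = 0) ∧
      (∀ t ∈ V, ∀ i, mpdU L i Q t =
        ((θ i / (L * (t i ^ L)⁻¹)) • (1 : Matrix (Fin L) (Fin L) ℂ) + C i t) * Q t) := by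
  choose q hq hq0 hq1 using fun n =>
    exists_horizontal_column hL hV hc h0 C hC hlow hflat n L
  -- The scalar part integrates separately: its coefficient along u_i depends on t_i alone, so the
  -- form is closed and contributes the factor exp F.
  obtain ⟨F, hFd, hF⟩ := exists_primitive hL hV hc h0
    (fun i t => θ i / (L * (t i ^ L)⁻¹))
    (fun i t ht => by
      have h := h0 t ht i
      have hL' : (L : ℂ) ≠ 0 := by exact_mod_cast hL
      refine DifferentiableAt.differentiableWithinAt ?_
      have h1 : DifferentiableAt ℂ (fun s : Fin (N + 1) → ℂ => s i) t := differentiableAt_coord i t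
      have h2 : DifferentiableAt ℂ (fun s : Fin (N + 1) → ℂ => (L : ℂ) * (s i ^ L)⁻¹) t :=
        ((h1.fun_pow L).fun_inv (pow_ne_zero L h)).const_mul _
      exact differentiableAt_div (differentiableAt_const (θ i)) h2
        (mul_ne_zero hL' (inv_ne_zero (pow_ne_zero L h))))
    (fun t ht i j hij => by
      simp only [pdU]
      rw [pd_comp_coord_of_ne hij (fun x => θ i / (L * (x ^ L)⁻¹)),
        pd_comp_coord_of_ne hij.symm (fun x => θ j / (L * (x ^ L)⁻¹)), zero_div, zero_div])
  have hqd : ∀ t ∈ V, ∀ m n, DifferentiableAt ℂ (q n m) t := fun t ht m n =>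
    (hq n m m.2).1.differentiableAt (hV.mem_nhds ht)
  have hFd' : ∀ t ∈ V, DifferentiableAt ℂ F t := fun t ht => hFd.differentiableAt (hV.mem_nhds ht)
  refine ⟨fun t => Complex.exp (F t) • Matrix.of fun m n => q n m t, fun m n t ht => ?_,
    fun t ht => ?_, fun t ht m n hmn => ?_, fun t ht i => ?_⟩
  · exact ((hFd' t ht).cexp.fun_mul (hqd t ht m n)).differentiableWithinAt
  · rw [Matrix.det_smul]
    refine isUnit_iff_ne_zero.mpr (mul_ne_zero (pow_ne_zero _ (Complex.exp_ne_zero _)) ?_)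
    rw [Matrix.det_of_isLowerTriangular]
    · simp [hq1]
    · intro m n hmn
      have hmn' : m < n := by simpa using hmn
      simp [hq0 n m hmn']
  · simp [hq0 n m hmn]
  · have hM : MDiff (fun s => Matrix.of fun m n => q n m s) t := fun m n => hqd t ht m n
    rw [mpdU_smul i (hFd' t ht).cexp hM]
    have e1 : pdU L i (fun s => Complex.exp (F s)) t =
        Complex.exp (F t) * (θ i / (L * (t i ^ L)⁻¹)) := by
      rw [← hF t ht i, pdU, pd_exp i (hFd' t ht), pdU, mul_div_assoc]
    have e2 : mpdU L i (fun s => Matrix.of fun m n => q n m s) t =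
        C i t * Matrix.of fun m n => q n m t := by
      ext m n
      simp only [mpdU, Matrix.of_apply, Matrix.mul_apply]
      exact (hq n m m.2).2 t ht i
    rw [e1, e2, add_mul, Matrix.smul_mul, one_mul, Matrix.mul_smul, smul_smul, mul_comm]

end

section

variable {N : ℕ}

/-! ### Residues of the compatibility condition -/

@[simp]
theorem residues_castSucc (L : ℕ) (d : ℤ → ℤ → ℂ) (f g : Family N) (i : Fin (N + 1))
    (t : Fin (N + 1) → ℂ) : residues L d f g i.castSucc t = resA L f g i t := by
  simp [residues]

@[simp]
theorem residues_last (L : ℕ) (d : ℤ → ℤ → ℂ) (f g : Family N) (t : Fin (N + 1) → ℂ) :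
    residues L d f g (Fin.last (N + 1)) t = resZero L d f g t := by
  simp [residues]

@[simp]
theorem sing_castSucc (L : ℕ) (t : Fin (N + 1) → ℂ) (i : Fin (N + 1)) :
    sing L t i.castSucc = (t i ^ L)⁻¹ := by simp [sing]

@[simp]
theorem sing_last (L : ℕ) (t : Fin (N + 1) → ℂ) : sing L t (Fin.last (N + 1)) = 0 := by
  simp [sing]

theorem sing_injective {L : ℕ} {t : Fin (N + 1) → ℂ} (h0 : ∀ i, t i ≠ 0)
    (hd : ∀ i j, i ≠ j → t i ^ L ≠ t j ^ L) : Function.Injective (sing L t) := by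
  intro i j
  induction i using Fin.lastCases with
  | last =>
    induction j using Fin.lastCases with
    | last => simp
    | cast j =>
      intro h
      rw [sing_last, sing_castSucc] at h
      exact absurd h.symm (inv_ne_zero (pow_ne_zero L (h0 j)))
  | cast i =>
    induction j using Fin.lastCases with
    | last =>
      intro h
      rw [sing_last, sing_castSucc] at h
      exact absurd h (inv_ne_zero (pow_ne_zero L (h0 i)))
    | cast j =>
      intro h
      by_contra hij
      exact hd i j (fun h' => hij (by rw [h'])) (by simpa using h)

/-- Linear independence of the functions `1 / (z - u_l)`. -/
theorem eq_zero_of_sum_simple_poles {n : ℕ} {u e : Fin n → ℂ} (hu : Function.Injective u)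
    (h : ∀ z, (∀ l, z ≠ u l) → ∑ l, 1 / (z - u l) * e l = 0) (k : Fin n) : e k = 0 := by
  -- G is (z - u_k) times the sum, with the singularity at u_k removed by hand. It is continuous at
  -- u_k with value e_k there, and it vanishes on a punctured neighbourhood.
  set G : ℂ → ℂ := fun z => e k + (z - u k) * ∑ l ∈ Finset.univ.erase k, 1 / (z - u l) * e l
  have hG : ContinuousAt G (u k) := by
    refine continuousAt_const.add ((continuousAt_id.sub continuousAt_const).mul ?_)
    refine tendsto_finsetSum _ fun l hl => ?_
    have : u k - u l ≠ 0 := sub_ne_zero.mpr fun h' => (Finset.ne_of_mem_erase hl) (hu h'.symm)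
    exact ContinuousAt.mul (ContinuousAt.div continuousAt_const
      (continuousAt_id.sub continuousAt_const) this) continuousAt_const
  have h1 : Filter.Tendsto G (nhdsWithin (u k) {u k}ᶜ) (nhds (G (u k))) := hG.mono_left inf_le_left
  have h2 : ∀ᶠ z in nhdsWithin (u k) {u k}ᶜ, G z = 0 := by
    have h3 : ∀ᶠ z in nhds (u k), ∀ l ∈ Finset.univ.erase k, z ≠ u l := by
      rw [Filter.eventually_all_finset]
      intro l hl
      exact continuousAt_id.eventually_ne fun h' => (Finset.ne_of_mem_erase hl) (hu h'.symm)
    filter_upwards [h3.filter_mono inf_le_left, self_mem_nhdsWithin] with z hz hzk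
    have hzk' : z - u k ≠ 0 := sub_ne_zero.mpr hzk
    have h4 := h z fun l => by
      rcases eq_or_ne l k with rfl | hl
      · exact hzk
      · exact hz l (by simp [hl])
    rw [← Finset.add_sum_erase _ _ (Finset.mem_univ k)] at h4
    change e k + (z - u k) * ∑ l ∈ Finset.univ.erase k, 1 / (z - u l) * e l = 0
    have h5 : (z - u k) * (1 / (z - u k) * e k) = e k := by field_simp
    linear_combination (z - u k) * h4 - h5
  have h3 : Filter.Tendsto G (nhdsWithin (u k) {u k}ᶜ) (nhds 0) :=
    tendsto_const_nhds.congr' (h2.mono fun z hz => hz.symm)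
  have h4 := tendsto_nhds_unique h1 h3
  simpa [G] using h4

/-- The residue form of the compatibility condition. -/
def SolvesResidue (L : ℕ) (d : ℤ → ℤ → ℂ) (θ : Fin (N + 1) → ℂ)
    (T : Set (Fin (N + 1) → ℂ)) (f g : Family N) : Prop :=
  ∀ t ∈ T, ∀ j : Fin (N + 1),
    (∀ i : Fin (N + 2), i ≠ j.castSucc →
      mpdU L j (residues L d f g i) t =
        coeffBInfty L θ f g j t * residues L d f g i t
          - residues L d f g i t * coeffBInfty L θ f g j t
          + (1 / (sing L t i - sing L t j.castSucc)) •
            (residues L d f g i t * residues L d f g j.castSucc t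
              - residues L d f g j.castSucc t * residues L d f g i t)) ∧
    mpdU L j (residues L d f g j.castSucc) t =
      coeffBInfty L θ f g j t * residues L d f g j.castSucc t
        - residues L d f g j.castSucc t * coeffBInfty L θ f g j t
        - ∑ l ∈ Finset.univ.erase j.castSucc, (1 / (sing L t j.castSucc - sing L t l)) •
          (residues L d f g j.castSucc t * residues L d f g l t
            - residues L d f g l t * residues L d f g j.castSucc t)

theorem IsAdmissible.differentiableAt_f {L : ℕ} {d : ℤ → ℤ → ℂ} {θ : Fin (N + 1) → ℂ}
    {T : Set (Fin (N + 1) → ℂ)} {f g : Family N} (h : IsAdmissible L d θ T f g) (hT : IsOpen T)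
    {t : Fin (N + 1) → ℂ} (ht : t ∈ T) (i j) : DifferentiableAt ℂ (f i j) t :=
  (h.holomorphic_f i j).differentiableAt (hT.mem_nhds ht)

theorem IsAdmissible.differentiableAt_g {L : ℕ} {d : ℤ → ℤ → ℂ} {θ : Fin (N + 1) → ℂ}
    {T : Set (Fin (N + 1) → ℂ)} {f g : Family N} (h : IsAdmissible L d θ T f g) (hT : IsOpen T)
    {t : Fin (N + 1) → ℂ} (ht : t ∈ T) (i j) : DifferentiableAt ℂ (g i j) t :=
  (h.holomorphic_g i j).differentiableAt (hT.mem_nhds ht)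

section
variable {L : ℕ} {d : ℤ → ℤ → ℂ} {θ : Fin (N + 1) → ℂ} {T : Set (Fin (N + 1) → ℂ)} {f g : Family N}

theorem differentiableAt_vEntry (h : IsAdmissible L d θ T f g) (hT : IsOpen T)
    {t : Fin (N + 1) → ℂ} (ht : t ∈ T) (i : Fin (N + 1)) (m n : Fin L) :
    DifferentiableAt ℂ (fun s => vEntry L f g i s m n) t := by
  unfold vEntry
  refine DifferentiableAt.fun_mul ?_ (differentiableAt_prod fun a _ => ?_)
  · simpa [div_eq_mul_inv] using (h.differentiableAt_g hT ht i m).mul_const _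
  · exact (differentiableAt_coord i t).fun_mul (h.differentiableAt_f hT ht i _)

theorem mdiff_resA (h : IsAdmissible L d θ T f g) (hT : IsOpen T) (hT0 : ∀ t ∈ T, ∀ i, t i ≠ 0)
    {t : Fin (N + 1) → ℂ} (ht : t ∈ T) (i : Fin (N + 1)) : MDiff (resA L f g i) t := by
  intro m n
  simp only [resA, Matrix.of_apply]
  split_ifs
  · exact (differentiableAt_vEntry h hT ht i m n).fun_neg
  · exact ((((differentiableAt_coord i t).fun_pow L).fun_inv (pow_ne_zero L (hT0 t ht i))).fun_mul
      (differentiableAt_vEntry h hT ht i m n)).fun_neg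

theorem mdiff_residues (h : IsAdmissible L d θ T f g) (hT : IsOpen T)
    (hT0 : ∀ t ∈ T, ∀ i, t i ≠ 0) {t : Fin (N + 1) → ℂ} (ht : t ∈ T) (i : Fin (N + 2)) :
    MDiff (residues L d f g i) t := by
  induction i using Fin.lastCases with
  | cast i =>
    have := mdiff_resA h hT hT0 ht i
    intro m n
    simpa using this m n
  | last =>
    intro m n
    simp only [residues_last, resZero, Matrix.of_apply]
    split_ifs
    · exact differentiableAt_const _
    · exact DifferentiableAt.fun_sum fun i _ => differentiableAt_vEntry h hT ht i m n
    · exact differentiableAt_const _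

/-- From z/(z - u) = 1 + u/(z - u): the deformation matrix has a single simple pole, whose residue
is -A_i as in the Schlesinger setting, plus a triangular value at infinity. -/
theorem coeffB_eq (θ : Fin (N + 1) → ℂ) (f g : Family N) (i : Fin (N + 1))
    {t : Fin (N + 1) → ℂ} {z : ℂ} (hz : z ≠ (t i ^ L)⁻¹) :
    coeffB L θ f g i t z =
      coeffBInfty L θ f g i t - (1 / (z - (t i ^ L)⁻¹)) • resA L f g i t := by
  have h1 : z - (t i ^ L)⁻¹ ≠ 0 := sub_ne_zero.mpr hz
  ext m n
  simp only [coeffB, coeffBInfty, resA, Matrix.add_apply, Matrix.sub_apply, Matrix.smul_apply,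
    Matrix.of_apply, smul_eq_mul]
  by_cases hmn : m < n
  · simp [hmn, hmn.not_ge]
  · have hz' : z / (z - (t i ^ L)⁻¹) = 1 + (t i ^ L)⁻¹ * (1 / (z - (t i ^ L)⁻¹)) := by
      rw [div_eq_iff h1]
      linear_combination (- (t i ^ L)⁻¹) * (one_div_mul_cancel h1)
    simp only [hmn, not_lt.mp hmn, if_true, if_false, hz']
    ring

theorem pdU_sing (hL : L ≠ 0) {t : Fin (N + 1) → ℂ} (h0 : ∀ i, t i ≠ 0) (i : Fin (N + 1))
    (l : Fin (N + 2)) :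
    pdU L i (fun s => sing L s l) t = if l = i.castSucc then 1 else 0 := by
  have hL' : (L : ℂ) ≠ 0 := by exact_mod_cast hL
  induction l using Fin.lastCases with
  | last => simp [pdU, (Fin.castSucc_lt_last i).ne']
  | cast l =>
    simp only [sing_castSucc, Fin.castSucc_inj]
    split_ifs with h
    · subst h
      have h1 : deriv (fun s : ℂ => (s ^ L)⁻¹) (t l) ≠ 0 := by
        rw [deriv_inv_pow L (h0 l)]; simp [hL', h0 l]
      simp only [pdU, pd, Function.update_self]
      exact div_self h1
    · rw [pdU, pd_comp_coord_of_ne h (fun x => (x ^ L)⁻¹), zero_div]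

theorem differentiableAt_sing {t : Fin (N + 1) → ℂ} (h0 : ∀ i, t i ≠ 0)
    (l : Fin (N + 2)) : DifferentiableAt ℂ (fun s => sing L s l) t := by
  induction l using Fin.lastCases with
  | last => simp
  | cast l =>
    simp only [sing_castSucc]
    exact ((differentiableAt_coord l t).fun_pow L).fun_inv (pow_ne_zero L (h0 l))

/-- Apart from the derivatives of the residues, the motion of the pole u_i itself produces a double
pole. It is the same double pole as in ∂B_i/∂z (`deriv_coeffB`), hence disappears from the
compatibility condition. -/
theorem mpdU_coeffA (hL : L ≠ 0) (h : IsAdmissible L d θ T f g) (hT : IsOpen T)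
    (hT0 : ∀ t ∈ T, ∀ i, t i ≠ 0) {t : Fin (N + 1) → ℂ} (ht : t ∈ T) {z : ℂ}
    (hz : ∀ l, z ≠ sing L t l) (i : Fin (N + 1)) :
    mpdU L i (fun s => coeffA L d f g s z) t =
      (1 / (z - sing L t i.castSucc)) ^ 2 • residues L d f g i.castSucc t +
      ∑ l, (1 / (z - sing L t l)) • mpdU L i (residues L d f g l) t := by
  have hz' : ∀ l, z - sing L t l ≠ 0 := fun l => sub_ne_zero.mpr (hz l)
  have hd1 : ∀ l, DifferentiableAt ℂ (fun s => z - sing L s l) t := fun l =>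
    (differentiableAt_const z).fun_sub (differentiableAt_sing (hT0 t ht) l)
  have hd : ∀ l, DifferentiableAt ℂ (fun s => 1 / (z - sing L s l)) t := fun l =>
    differentiableAt_div (differentiableAt_const 1) (hd1 l) (hz' l)
  unfold coeffA
  rw [mpdU_sum i fun l _ => MDiff.smul (hd l) (mdiff_residues h hT hT0 ht l)]
  have e : ∀ l, mpdU L i (fun s => (1 / (z - sing L s l)) • residues L d f g l s) t =
      (if l = i.castSucc then (1 / (z - sing L t l)) ^ 2 • residues L d f g l t else 0)
        + (1 / (z - sing L t l)) • mpdU L i (residues L d f g l) t := by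
    intro l
    rw [mpdU_smul i (hd l) (mdiff_residues h hT hT0 ht l)]
    have e1 : pdU L i (fun s => 1 / (z - sing L s l)) t =
        if l = i.castSucc then (1 / (z - sing L t l)) ^ 2 else 0 := by
      have e2 := pdU_sing hL (hT0 t ht) i l
      simp only [one_div]
      rw [pdU, pd_inv i (hd1 l) (hz' l), pd_sub i (differentiableAt_const z)
        (differentiableAt_sing (hT0 t ht) l), pd_const]
      rw [pdU] at e2
      have : -(0 - pd i (fun s => sing L s l) t) / (z - sing L t l) ^ 2 /
          deriv (fun s : ℂ => (s ^ L)⁻¹) (t i) = (pd i (fun s => sing L s l) t /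
          deriv (fun s : ℂ => (s ^ L)⁻¹) (t i)) * ((z - sing L t l)⁻¹) ^ 2 := by
        rw [inv_pow, zero_sub, neg_neg, div_right_comm, div_eq_mul_inv _ ((z - sing L t l) ^ 2)]
      rw [this, e2]
      split_ifs <;> simp
    rw [e1]
    split_ifs <;> simp
  simp only [e, Finset.sum_add_distrib, Finset.sum_ite_eq', Finset.mem_univ, if_true]

theorem deriv_coeffB {t : Fin (N + 1) → ℂ} {z : ℂ}
    (hz : ∀ l, z ≠ sing L t l) (i : Fin (N + 1)) :
    Matrix.of (fun m n => deriv (fun w => coeffB L θ f g i t w m n) z) =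
      (1 / (z - sing L t i.castSucc)) ^ 2 • residues L d f g i.castSucc t := by
  have hz1 : z ≠ (t i ^ L)⁻¹ := by simpa using hz i.castSucc
  ext m n
  simp only [Matrix.of_apply, Matrix.smul_apply, residues_castSucc, sing_castSucc, smul_eq_mul]
  have e : (fun w => coeffB L θ f g i t w m n) =ᶠ[nhds z] fun w =>
      coeffBInfty L θ f g i t m n - (w - (t i ^ L)⁻¹)⁻¹ * resA L f g i t m n := by
    filter_upwards [continuousAt_id.eventually_ne hz1] with w hw
    rw [coeffB_eq θ f g i (show w ≠ _ from hw)]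
    simp
  rw [e.deriv_eq]
  have h1 : z - (t i ^ L)⁻¹ ≠ 0 := sub_ne_zero.mpr hz1
  have h2 := ((((hasDerivAt_id z).sub_const ((t i ^ L)⁻¹)).inv h1).mul_const
    (resA L f g i t m n)).const_sub (coeffBInfty L θ f g i t m n)
  rw [show deriv (fun w => coeffBInfty L θ f g i t m n - (w - (t i ^ L)⁻¹)⁻¹ * resA L f g i t m n) z
    = _ from h2.deriv]
  simp only [id]
  field_simp

/-- Partial fractions distribute each product 1/((z - u_l)(z - u_k)) between the poles u_l and u_k,
and the term l = k drops out because R_k commutes with itself. What stands at each pole is the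
difference of the two sides of a residue equation. -/
theorem commutator_simple_poles {n : ℕ} (u : Fin n → ℂ) (hu : Function.Injective u) (z : ℂ)
    (hz : ∀ l, z ≠ u l) (R D : Fin n → Matrix (Fin L) (Fin L) ℂ) (B : Matrix (Fin L) (Fin L) ℂ)
    (k : Fin n) :
    ∑ l, (1 / (z - u l)) • D l +
      ((∑ l, (1 / (z - u l)) • R l) * (B - (1 / (z - u k)) • R k)
        - (B - (1 / (z - u k)) • R k) * (∑ l, (1 / (z - u l)) • R l)) =
    (1 / (z - u k)) • (D k - (B * R k - R k * B -
        ∑ l ∈ Finset.univ.erase k, (1 / (u k - u l)) • (R k * R l - R l * R k))) +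
      ∑ l ∈ Finset.univ.erase k, (1 / (z - u l)) • (D l - (B * R l - R l * B +
        (1 / (u l - u k)) • (R l * R k - R k * R l))) := by
  have e1 : (∑ l, (1 / (z - u l)) • R l) * (B - (1 / (z - u k)) • R k)
        - (B - (1 / (z - u k)) • R k) * (∑ l, (1 / (z - u l)) • R l) =
      ∑ l, ((1 / (z - u l)) • (R l * B - B * R l) -
        ((1 / (z - u l)) * (1 / (z - u k))) • (R l * R k - R k * R l)) := by
    rw [Finset.sum_mul, Finset.mul_sum, ← Finset.sum_sub_distrib]
    refine Finset.sum_congr rfl fun l _ => ?_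
    simp only [mul_sub, sub_mul, Matrix.smul_mul, Matrix.mul_smul, smul_sub, smul_smul]
    rw [mul_comm (1 / (z - u k))]
    abel
  rw [e1, ← Finset.sum_add_distrib, ← Finset.add_sum_erase _ _ (Finset.mem_univ k)]
  simp only [sub_self, smul_zero, sub_zero]
  have e2 : ∀ l ∈ Finset.univ.erase k, (1 / (z - u l)) • D l +
      ((1 / (z - u l)) • (R l * B - B * R l) -
        ((1 / (z - u l)) * (1 / (z - u k))) • (R l * R k - R k * R l)) =
      (1 / (z - u l)) • (D l - (B * R l - R l * B +
        (1 / (u l - u k)) • (R l * R k - R k * R l))) +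
      (1 / (z - u k)) • ((1 / (u k - u l)) • (R k * R l - R l * R k)) := by
    intro l hl
    have h1 : z - u l ≠ 0 := sub_ne_zero.mpr (hz l)
    have h2 : z - u k ≠ 0 := sub_ne_zero.mpr (hz k)
    have h3 : u l - u k ≠ 0 := sub_ne_zero.mpr fun h' => (Finset.ne_of_mem_erase hl) (hu h')
    have h4 : u k - u l ≠ 0 := sub_ne_zero.mpr fun h' => (Finset.ne_of_mem_erase hl) (hu h'.symm)
    have h5 : (1 / (z - u l)) * (1 / (z - u k)) =
        (1 / (z - u l)) * (1 / (u l - u k)) + (1 / (z - u k)) * (1 / (u k - u l)) := by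
      rw [← neg_sub (u l) (u k)]
      field_simp
      ring
    rw [h5]
    ext a b
    simp only [Matrix.add_apply, Matrix.sub_apply, Matrix.smul_apply, smul_eq_mul]
    ring
  rw [Finset.sum_congr rfl e2, Finset.sum_add_distrib, ← Finset.smul_sum]
  simp only [smul_sub]
  abel

/-- The residue at `u_l` of the left-hand side of the compatibility condition. -/
def residueDefect (L : ℕ) (d : ℤ → ℤ → ℂ) (θ : Fin (N + 1) → ℂ) (f g : Family N)
    (t : Fin (N + 1) → ℂ) (j : Fin (N + 1)) (l : Fin (N + 2)) : Matrix (Fin L) (Fin L) ℂ :=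
  if l = j.castSucc then
    mpdU L j (residues L d f g j.castSucc) t -
      (coeffBInfty L θ f g j t * residues L d f g j.castSucc t
        - residues L d f g j.castSucc t * coeffBInfty L θ f g j t
        - ∑ l ∈ Finset.univ.erase j.castSucc, (1 / (sing L t j.castSucc - sing L t l)) •
          (residues L d f g j.castSucc t * residues L d f g l t
            - residues L d f g l t * residues L d f g j.castSucc t))
  else
    mpdU L j (residues L d f g l) t -
      (coeffBInfty L θ f g j t * residues L d f g l t
        - residues L d f g l t * coeffBInfty L θ f g j t
        + (1 / (sing L t l - sing L t j.castSucc)) •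
          (residues L d f g l t * residues L d f g j.castSucc t
            - residues L d f g j.castSucc t * residues L d f g l t))

theorem solvesResidue_iff_defect :
    SolvesResidue L d θ T f g ↔ ∀ t ∈ T, ∀ j l, residueDefect L d θ f g t j l = 0 := by
  refine forall₂_congr fun t ht => forall_congr' fun j => ⟨fun h l => ?_, fun h => ⟨fun i hi => ?_, ?_⟩⟩
  · unfold residueDefect
    split_ifs with hl
    · exact sub_eq_zero.mpr h.2
    · exact sub_eq_zero.mpr (h.1 l hl)
  · have := h i
    rw [residueDefect, if_neg hi] at this
    exact sub_eq_zero.mp this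
  · have := h j.castSucc
    rw [residueDefect, if_pos rfl] at this
    exact sub_eq_zero.mp this

/-- Once the double poles have cancelled, the condition is a combination of the functions 1/(z -
u_l) with coefficients `residueDefect`, and these functions are linearly independent because the
singular points are distinct. -/
theorem isCompatible_iff (hL : L ≠ 0) (h : IsAdmissible L d θ T f g) (hT : IsOpen T)
    (hT0 : ∀ t ∈ T, ∀ i, t i ≠ 0) (hTd : ∀ t ∈ T, ∀ i j, i ≠ j → t i ^ L ≠ t j ^ L) :
    IsCompatible L d θ T f g ↔ SolvesResidue L d θ T f g := by
  have key : ∀ t ∈ T, ∀ z : ℂ, (∀ l, z ≠ sing L t l) → ∀ i : Fin (N + 1),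
      Matrix.of (fun m n => pdU L i (fun s => coeffA L d f g s z m n) t)
      - Matrix.of (fun m n => deriv (fun w => coeffB L θ f g i t w m n) z)
      + (coeffA L d f g t z * coeffB L θ f g i t z
          - coeffB L θ f g i t z * coeffA L d f g t z) =
      ∑ l, (1 / (z - sing L t l)) • residueDefect L d θ f g t i l := by
    intro t ht z hz i
    have e1 := mpdU_coeffA hL h hT hT0 ht hz i
    unfold mpdU at e1
    rw [e1, deriv_coeffB (d := d) hz i, add_sub_cancel_left,
      coeffB_eq θ f g i (by simpa using hz i.castSucc)]
    have e2 := commutator_simple_poles (sing L t) (sing_injective (hT0 t ht) (hTd t ht)) z hz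
      (fun l => residues L d f g l t) (fun l => mpdU L i (residues L d f g l) t)
      (coeffBInfty L θ f g i t) i.castSucc
    have e3 : ∀ l ∈ Finset.univ.erase i.castSucc,
        (1 / (z - sing L t l)) • residueDefect L d θ f g t i l = _ := fun l hl => by
      rw [residueDefect, if_neg (Finset.ne_of_mem_erase hl)]
    have e4 := (Finset.add_sum_erase Finset.univ
      (fun l => (1 / (z - sing L t l)) • residueDefect L d θ f g t i l)
      (Finset.mem_univ i.castSucc)).symm
    rw [Finset.sum_congr rfl e3] at e4
    rw [residueDefect, if_pos rfl] at e4
    rw [e4, ← e2, residues_castSucc, sing_castSucc]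
    rfl
  rw [solvesResidue_iff_defect]
  constructor
  · intro hcomp t ht j l
    ext m n
    refine eq_zero_of_sum_simple_poles (e := fun l => residueDefect L d θ f g t j l m n)
      (sing_injective (hT0 t ht) (hTd t ht)) (fun z hz => ?_) l
    have h1 := (key t ht z hz j).symm.trans (hcomp t ht z hz j)
    have h2 := congrFun (congrFun h1 m) n
    simpa only [Matrix.sum_apply, Matrix.smul_apply, smul_eq_mul, Matrix.zero_apply] using h2
  · intro hres t ht z hz i
    rw [key t ht z hz i]
    exact Finset.sum_eq_zero fun l _ => by rw [hres t ht, smul_zero]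

end

end

section

variable {N : ℕ}
variable {L : ℕ} {d : ℤ → ℤ → ℂ} {θ : Fin (N + 1) → ℂ} {T : Set (Fin (N + 1) → ℂ)} {f g : Family N}

/-! ### The Schlesinger system up to gauge -/

theorem conj_mul_conj {Q X Y : Matrix (Fin L) (Fin L) ℂ} (hQ : IsUnit Q.det) :
    (Q⁻¹ * X * Q) * (Q⁻¹ * Y * Q) = Q⁻¹ * (X * Y) * Q := by
  calc (Q⁻¹ * X * Q) * (Q⁻¹ * Y * Q) = Q⁻¹ * X * (Q * Q⁻¹) * Y * Q := by noncomm_ring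
    _ = Q⁻¹ * (X * Y) * Q := by rw [Matrix.mul_nonsing_inv _ hQ]; noncomm_ring

theorem conj_eq_zero_iff {Q X : Matrix (Fin L) (Fin L) ℂ} (hQ : IsUnit Q.det) :
    Q⁻¹ * X * Q = 0 ↔ X = 0 := by
  refine ⟨fun h => ?_, fun h => by simp [h]⟩
  calc X = (Q * Q⁻¹) * X * (Q * Q⁻¹) := by rw [Matrix.mul_nonsing_inv _ hQ]; simp
    _ = Q * (Q⁻¹ * X * Q) * Q⁻¹ := by noncomm_ring
    _ = 0 := by rw [h]; simp

/-- The equation for Q subtracts the commutator with B_j(∞) from the derivative of Q⁻¹ A_i Q. Each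
Schlesinger equation is thus the conjugate by Q of one residue equation. -/
theorem solvesSchlesinger_gauge_iff (h : IsAdmissible L d θ T f g) (hT : IsOpen T)
    (hT0 : ∀ t ∈ T, ∀ i, t i ≠ 0) {V : Set (Fin (N + 1) → ℂ)} (hV : IsOpen V) (hVT : V ⊆ T)
    {Q : (Fin (N + 1) → ℂ) → Matrix (Fin L) (Fin L) ℂ}
    (hQd : ∀ m n, DifferentiableOn ℂ (fun t => Q t m n) V)
    (hQ : ∀ t ∈ V, IsUnit (Q t).det)
    (hQB : ∀ t ∈ V, ∀ i, mpdU L i Q t = coeffBInfty L θ f g i t * Q t) :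
    SolvesSchlesinger L V (fun i t => (Q t)⁻¹ * residues L d f g i t * Q t) ↔
      ∀ t ∈ V, ∀ j l, residueDefect L d θ f g t j l = 0 := by
  refine forall₂_congr fun t ht => forall_congr' fun j => ?_
  have hQt := hQ t ht
  have hMQ : MDiff Q t := fun m n => (hQd m n).differentiableAt (hV.mem_nhds ht)
  have e := fun l => mpdU_gauge (L := L) j (mdiff_residues h hT hT0 (hVT ht) l) hMQ hQt (hQB t ht j)
  have e1 : ∀ i : Fin (N + 2), i ≠ j.castSucc →
      (Matrix.of (fun m n => pdU L j (fun s => ((Q s)⁻¹ * residues L d f g i s * Q s) m n) t) =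
        (1 / (sing L t i - sing L t j.castSucc)) •
          ((Q t)⁻¹ * residues L d f g i t * Q t * ((Q t)⁻¹ * residues L d f g j.castSucc t * Q t)
            - (Q t)⁻¹ * residues L d f g j.castSucc t * Q t *
              ((Q t)⁻¹ * residues L d f g i t * Q t)) ↔ residueDefect L d θ f g t j i = 0) := by
    intro i hi
    rw [← conj_eq_zero_iff hQt, ← sub_eq_zero]
    refine Eq.congr ?_ rfl
    refine (congrArg₂ (· - ·) (e i) rfl).trans ?_
    rw [conj_mul_conj hQt, conj_mul_conj hQt, residueDefect, if_neg hi]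
    simp only [mul_sub, sub_mul, mul_add, add_mul, Matrix.mul_smul, Matrix.smul_mul, smul_sub]
    abel
  have e2 : (Matrix.of (fun m n => pdU L j
        (fun s => ((Q s)⁻¹ * residues L d f g j.castSucc s * Q s) m n) t) =
        - ∑ l ∈ Finset.univ.erase j.castSucc, (1 / (sing L t j.castSucc - sing L t l)) •
          ((Q t)⁻¹ * residues L d f g j.castSucc t * Q t * ((Q t)⁻¹ * residues L d f g l t * Q t)
            - (Q t)⁻¹ * residues L d f g l t * Q t *
              ((Q t)⁻¹ * residues L d f g j.castSucc t * Q t)) ↔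
        residueDefect L d θ f g t j j.castSucc = 0) := by
    rw [← conj_eq_zero_iff hQt, ← sub_eq_zero]
    refine Eq.congr ?_ rfl
    refine (congrArg₂ (· - ·) (e j.castSucc) rfl).trans ?_
    simp only [conj_mul_conj hQt]
    rw [residueDefect, if_pos rfl]
    have : ∑ l ∈ Finset.univ.erase j.castSucc, (1 / (sing L t j.castSucc - sing L t l)) •
          ((Q t)⁻¹ * (residues L d f g j.castSucc t * residues L d f g l t) * Q t
            - (Q t)⁻¹ * (residues L d f g l t * residues L d f g j.castSucc t) * Q t) =
        (Q t)⁻¹ * (∑ l ∈ Finset.univ.erase j.castSucc,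
          (1 / (sing L t j.castSucc - sing L t l)) •
          (residues L d f g j.castSucc t * residues L d f g l t
            - residues L d f g l t * residues L d f g j.castSucc t)) * Q t := by
      rw [Finset.mul_sum, Finset.sum_mul]
      refine Finset.sum_congr rfl fun l _ => ?_
      simp only [Matrix.mul_smul, Matrix.smul_mul, mul_sub, sub_mul]
    rw [this]
    noncomm_ring
  constructor
  · rintro ⟨h1, h2⟩ l
    rcases eq_or_ne l j.castSucc with rfl | hl
    · exact e2.mp h2
    · exact (e1 l hl).mp (h1 l hl)
  · intro h1
    exact ⟨fun i hi => (e1 i hi).mpr (h1 i), e2.mpr (h1 _)⟩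

theorem solvesResidue_of_schlesinger (h : IsAdmissible L d θ T f g) (hT : IsOpen T)
    (hT0 : ∀ t ∈ T, ∀ i, t i ≠ 0) (hs : IsSchlesingerUpToGauge L d θ T f g) :
    SolvesResidue L d θ T f g := by
  rw [solvesResidue_iff_defect]
  intro t ht
  obtain ⟨V, hV, htV, hVT, Q, hQd, hQ, -, hQB, hS⟩ := hs t ht
  exact (solvesSchlesinger_gauge_iff h hT hT0 hV hVT hQd hQ hQB).mp hS t htV

/-! ### Flatness of the connection at infinity -/

/-- The strictly lower triangular part of a matrix. -/
def strictLower (M : Matrix (Fin L) (Fin L) ℂ) : Matrix (Fin L) (Fin L) ℂ :=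
  Matrix.of fun m n => if n < m then M m n else 0

theorem strictLower_apply (M : Matrix (Fin L) (Fin L) ℂ) (m n : Fin L) :
    strictLower M m n = if n < m then M m n else 0 := rfl

/-- Products of upper triangular matrices have no strictly lower entries. -/
theorem mul_apply_eq_zero_of_upper {X Y : Matrix (Fin L) (Fin L) ℂ}
    (hX : ∀ m n, n < m → X m n = 0) (hY : ∀ m n, n < m → Y m n = 0) {m n : Fin L} (h : n < m) :
    (X * Y) m n = 0 := by
  rw [Matrix.mul_apply]
  refine Finset.sum_eq_zero fun p _ => ?_
  rcases lt_or_ge p m with hp | hp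
  · rw [hX m p hp, zero_mul]
  · rw [hY p n (lt_of_lt_of_le h hp), mul_zero]

theorem sub_strictLower_apply (M : Matrix (Fin L) (Fin L) ℂ) {m n : Fin L} (h : n < m) :
    (M - strictLower M) m n = 0 := by
  simp [strictLower_apply, h]

/-- On the diagonal the two terms v_{n,n} cancel. Only a scalar, invisible in commutators, and a
multiple of the strictly lower part of A_i remain. -/
theorem coeffBInfty_eq (θ : Fin (N + 1) → ℂ) (f g : Family N) (i : Fin (N + 1))
    {t : Fin (N + 1) → ℂ} (h0 : t i ≠ 0) :
    coeffBInfty L θ f g i t = (θ i / (L * (t i ^ L)⁻¹)) • (1 : Matrix (Fin L) (Fin L) ℂ) +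
      - ((t i ^ L) • strictLower (resA L f g i t)) := by
  have h1 : t i ^ L ≠ 0 := pow_ne_zero L h0
  ext m n
  simp only [coeffBInfty, Matrix.add_apply, Matrix.neg_apply, Matrix.smul_apply, Matrix.of_apply,
    strictLower_apply, resA, smul_eq_mul, Matrix.diagonal_apply, Matrix.one_apply]
  rcases lt_trichotomy m n with hmn | rfl | hmn
  · simp [hmn.ne, hmn.not_ge, hmn.not_gt]
  · simp
  · simp only [hmn.ne', hmn.le, hmn, hmn.not_gt, if_true, if_false]
    field_simp
    ring

/-- Let X₊ and Y₊ be what remains after removing the strictly lower parts. Upper triangular matrices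
form an algebra, so [X₊, Y₊] has no strictly lower entry; expanding it gives the identity below the
diagonal. On and above the diagonal every term vanishes, products of strictly lower matrices being
strictly lower. -/
theorem strictLower_commutator {X Y : Matrix (Fin L) (Fin L) ℂ} :
    strictLower (X * Y - Y * X) - strictLower (X * strictLower Y - strictLower Y * X)
      - strictLower (strictLower X * Y - Y * strictLower X)
      + (strictLower X * strictLower Y - strictLower Y * strictLower X) = 0 := by
  have hlow : ∀ X Y : Matrix (Fin L) (Fin L) ℂ, ∀ m n, ¬ n < m →
      (strictLower X * strictLower Y) m n = 0 := by
    intro X Y m n hmn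
    rw [Matrix.mul_apply]
    refine Finset.sum_eq_zero fun p _ => ?_
    by_cases hp : p < m
    · have : ¬ n < p := fun h' => hmn (h'.trans hp)
      simp [strictLower_apply, this]
    · simp [strictLower_apply, hp]
  ext m n
  by_cases hmn : n < m
  · have e1 := mul_apply_eq_zero_of_upper (X := X - strictLower X) (Y := Y - strictLower Y)
      (fun _ _ => sub_strictLower_apply X) (fun _ _ => sub_strictLower_apply Y) hmn
    have e2 := mul_apply_eq_zero_of_upper (X := Y - strictLower Y) (Y := X - strictLower X)
      (fun _ _ => sub_strictLower_apply Y) (fun _ _ => sub_strictLower_apply X) hmn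
    simp only [mul_sub, sub_mul, Matrix.sub_apply] at e1 e2
    have e3 : ∀ Z : Matrix (Fin L) (Fin L) ℂ, strictLower Z m n = Z m n := fun Z => if_pos hmn
    simp only [Matrix.add_apply, Matrix.sub_apply, e3, Matrix.zero_apply]
    linear_combination e1 - e2
  · simp [strictLower_apply, hmn, hlow _ _ m n hmn]

theorem strictLower_add (X Y : Matrix (Fin L) (Fin L) ℂ) :
    strictLower (X + Y) = strictLower X + strictLower Y := by
  ext m n; simp only [strictLower_apply, Matrix.add_apply]; split_ifs <;> simp

theorem strictLower_smul (c : ℂ) (X : Matrix (Fin L) (Fin L) ℂ) :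
    strictLower (c • X) = c • strictLower X := by
  ext m n; simp only [strictLower_apply, Matrix.smul_apply]; split_ifs <;> simp

theorem mpdU_strictLower (i : Fin (N + 1)) (M : (Fin (N + 1) → ℂ) → Matrix (Fin L) (Fin L) ℂ)
    (t : Fin (N + 1) → ℂ) :
    mpdU L i (fun s => strictLower (M s)) t = strictLower (mpdU L i M t) := by
  ext m n
  simp only [mpdU, Matrix.of_apply, strictLower_apply]
  split_ifs
  · rfl
  · simp [pdU]

/-- The connection `Bᵢ` at `z = ∞` is flat if the residues are compatible. -/
theorem flat_of_solvesResidue (h : IsAdmissible L d θ T f g) (hT : IsOpen T)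
    (hT0 : ∀ t ∈ T, ∀ i, t i ≠ 0) (hTd : ∀ t ∈ T, ∀ i j, i ≠ j → t i ^ L ≠ t j ^ L)
    (hres : SolvesResidue L d θ T f g) {t : Fin (N + 1) → ℂ} (ht : t ∈ T) {i j : Fin (N + 1)}
    (hij : i ≠ j) :
    mpdU L j (fun s => - ((s i ^ L) • strictLower (resA L f g i s))) t
      + (- ((t i ^ L) • strictLower (resA L f g i t))) *
        (- ((t j ^ L) • strictLower (resA L f g j t))) =
    mpdU L i (fun s => - ((s j ^ L) • strictLower (resA L f g j s))) t
      + (- ((t j ^ L) • strictLower (resA L f g j t))) *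
        (- ((t i ^ L) • strictLower (resA L f g i t))) := by
  have hM : ∀ i, MDiff (fun s => strictLower (resA L f g i s)) t := by
    intro i m n
    simp only [strictLower_apply]
    split_ifs
    · exact mdiff_resA h hT hT0 ht i m n
    · exact differentiableAt_const _
  -- This is the residue equation for ∂A_i/∂u_j, projected to strictly lower matrices; the scalar
  -- part of B_j(∞) has dropped out of the commutator.
  have key : ∀ i j, i ≠ j → mpdU L j (fun s => - ((s i ^ L) • strictLower (resA L f g i s))) t =
      (t i ^ L * t j ^ L) • strictLower
        (strictLower (resA L f g j t) * resA L f g i t -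
          resA L f g i t * strictLower (resA L f g j t))
      - (t i ^ L * (1 / ((t i ^ L)⁻¹ - (t j ^ L)⁻¹))) • strictLower
        (resA L f g i t * resA L f g j t - resA L f g j t * resA L f g i t) := by
    intro i j hij
    have hp : pdU L j (fun s => s i ^ L) t = 0 := by
      rw [pdU, pd_comp_coord_of_ne hij (fun x => x ^ L), zero_div]
    rw [mpdU_neg, mpdU_smul j ((differentiableAt_coord i t).fun_pow L) (hM i), hp, zero_smul,
      zero_add, mpdU_strictLower]
    have e := (hres t ht j).1 i.castSucc (by simpa using hij)
    simp only [residues_castSucc, sing_castSucc] at e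
    have e' : mpdU L j (resA L f g i) t = mpdU L j (residues L d f g i.castSucc) t := by
      congr 1; ext s; simp
    rw [e', e, coeffBInfty_eq θ f g j (hT0 t ht j)]
    have e2 : ∀ (c : ℂ) (X : Matrix (Fin L) (Fin L) ℂ),
        (c • (1 : Matrix (Fin L) (Fin L) ℂ) + -((t j ^ L) • strictLower (resA L f g j t))) * X
        - X * (c • (1 : Matrix (Fin L) (Fin L) ℂ) + -((t j ^ L) • strictLower (resA L f g j t)))
        = (- (t j ^ L)) • (strictLower (resA L f g j t) * X
          - X * strictLower (resA L f g j t)) := by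
      intro c X
      simp only [add_mul, mul_add, Matrix.smul_mul, Matrix.mul_smul, one_mul, mul_one, neg_mul,
        mul_neg, smul_sub, neg_smul]
      abel
    rw [e2, strictLower_add, strictLower_smul, strictLower_smul]
    ext a b
    simp only [Matrix.sub_apply, Matrix.add_apply, Matrix.neg_apply, Matrix.smul_apply, smul_eq_mul]
    ring
  rw [key i j hij, key j i hij.symm]
  have h1 : t i ^ L ≠ 0 := pow_ne_zero L (hT0 t ht i)
  have h2 : t j ^ L ≠ 0 := pow_ne_zero L (hT0 t ht j)
  have h3 : t j ^ L - t i ^ L ≠ 0 := sub_ne_zero.mpr (hTd t ht j i hij.symm)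
  have h4 : t i ^ L - t j ^ L ≠ 0 := sub_ne_zero.mpr (hTd t ht i j hij)
  -- In units of t_i^L t_j^L the two pole coefficients combine to a constant (`c3`), independent of
  -- t_i and t_j. The projected commutator of A_i and A_j then enters with exactly the coefficient
  -- it has in `strictLower_commutator`.
  have c1 : t i ^ L * (1 / ((t i ^ L)⁻¹ - (t j ^ L)⁻¹)) =
      t i ^ L * t j ^ L * (t i ^ L / (t j ^ L - t i ^ L)) := by
    rw [inv_sub_inv h1 h2]; field_simp
  have c2 : t j ^ L * (1 / ((t j ^ L)⁻¹ - (t i ^ L)⁻¹)) =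
      t i ^ L * t j ^ L * (- (t j ^ L / (t j ^ L - t i ^ L))) := by
    rw [inv_sub_inv h2 h1, ← neg_sub (t j ^ L)]; field_simp
  have c3 : t i ^ L / (t j ^ L - t i ^ L) - t j ^ L / (t j ^ L - t i ^ L) = -1 := by
    rw [← sub_div, ← neg_sub, neg_div, div_self h3]
  rw [c1, c2]
  have e3 := strictLower_commutator (X := resA L f g i t) (Y := resA L f g j t)
  ext a b
  have e4 := congrFun (congrFun e3 a) b
  have e5 : ∀ X Y : Matrix (Fin L) (Fin L) ℂ,
      strictLower (X * Y - Y * X) a b = strictLower (X * Y) a b - strictLower (Y * X) a b := by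
    intro X Y
    simp only [strictLower_apply, Matrix.sub_apply]; split_ifs <;> simp
  simp only [Matrix.sub_apply, Matrix.add_apply, Matrix.smul_apply, Matrix.zero_apply,
    smul_eq_mul, neg_mul_neg, Matrix.smul_mul, Matrix.mul_smul, e5] at e4 ⊢
  linear_combination (t i ^ L * t j ^ L) * e4 - (t i ^ L * t j ^ L) *
    (strictLower (resA L f g i t * resA L f g j t) a b
      - strictLower (resA L f g j t * resA L f g i t) a b) * c3

theorem schlesinger_of_solvesResidue (hL : L ≠ 0) (h : IsAdmissible L d θ T f g) (hT : IsOpen T)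
    (hT0 : ∀ t ∈ T, ∀ i, t i ≠ 0) (hTd : ∀ t ∈ T, ∀ i j, i ≠ j → t i ^ L ≠ t j ^ L)
    (hres : SolvesResidue L d θ T f g) : IsSchlesingerUpToGauge L d θ T f g := by
  intro t₀ ht₀
  -- A ball is taken because integrating the connection requires a convex domain.
  obtain ⟨ε, hε, hball⟩ := Metric.isOpen_iff.mp hT t₀ ht₀
  have hV : IsOpen (Metric.ball t₀ ε) := Metric.isOpen_ball
  obtain ⟨Q, hQd, hQ, hQ0, hQB⟩ := exists_gauge hL hV (convex_ball t₀ ε)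
    (fun t ht => hT0 t (hball ht)) θ (fun i s => - ((s i ^ L) • strictLower (resA L f g i s)))
    (fun t ht i => by
      refine MDiff.neg (MDiff.smul ((differentiableAt_coord i t).fun_pow L) fun m n => ?_)
      simp only [strictLower_apply]
      split_ifs
      · exact mdiff_resA h hT hT0 (hball ht) i m n
      · exact differentiableAt_const _)
    (fun t i m n hmn => by simp [strictLower_apply, hmn.not_gt])
    (fun t ht i j hij => flat_of_solvesResidue h hT hT0 hTd hres (hball ht) hij)
  have hQB' : ∀ t ∈ Metric.ball t₀ ε, ∀ i, mpdU L i Q t = coeffBInfty L θ f g i t * Q t := by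
    intro t ht i
    rw [hQB t ht i, coeffBInfty_eq θ f g i (hT0 t (hball ht) i)]
  refine ⟨Metric.ball t₀ ε, hV, Metric.mem_ball_self hε, hball, Q, hQd, hQ, hQ0, hQB', ?_⟩
  rw [solvesSchlesinger_gauge_iff h hT hT0 hV hball hQd hQ hQB']
  exact fun t ht => (solvesResidue_iff_defect.mp hres) t (hball ht)

end

section

variable {N : ℕ}
variable {L : ℕ} {d : ℤ → ℤ → ℂ} {θ : Fin (N + 1) → ℂ} {T : Set (Fin (N + 1) → ℂ)} {f g : Family N}

/-! ### Factorization of the residue matrices and exponents -/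

/-- The components `c^{(i)}_n = tᵢⁿ ∏_{m=1}^n f^{(i)}_m`, for all natural numbers `n`. -/
def cNat (f : Family N) (i : Fin (N + 1)) (t : Fin (N + 1) → ℂ) (n : ℕ) : ℂ :=
  t i ^ n * ∏ m ∈ Finset.Icc 1 n, f i (m : ℤ) t

@[simp]
theorem cNat_zero (f : Family N) (i : Fin (N + 1)) (t : Fin (N + 1) → ℂ) : cNat f i t 0 = 1 := by
  simp [cNat]

theorem cNat_succ (f : Family N) (i : Fin (N + 1)) (t : Fin (N + 1) → ℂ) (n : ℕ) :
    cNat f i t (n + 1) = cNat f i t n * (t i * f i ((n : ℤ) + 1) t) := by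
  rw [cNat, cNat, Finset.prod_Icc_succ_top (by omega)]
  push_cast
  ring

theorem cNat_add (f : Family N) (i : Fin (N + 1)) (t : Fin (N + 1) → ℂ) (m b : ℕ) :
    cNat f i t (m + b) = cNat f i t m *
      ∏ a ∈ Finset.Icc 1 b, (t i * f i ((m : ℤ) + (a : ℤ)) t) := by
  induction b with
  | zero => simp
  | succ b ih =>
    rw [← add_assoc, cNat_succ, ih, Finset.prod_Icc_succ_top (by omega)]
    push_cast
    rw [add_assoc (m : ℤ)]
    ring

theorem cNat_ne_zero (h : IsAdmissible L d θ T f g) {t : Fin (N + 1) → ℂ} (ht : t ∈ T)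
    {i : Fin (N + 1)} (h0 : t i ≠ 0) (n : ℕ) : cNat f i t n ≠ 0 :=
  mul_ne_zero (pow_ne_zero n h0) (Finset.prod_ne_zero_iff.mpr fun _ _ => h.f_ne_zero _ _ t ht)

theorem prod_Icc_mul_eq_prod_range (F : ℤ → ℂ) (n : ℕ) :
    (∏ m ∈ Finset.Icc 1 n, F (m : ℤ)) * F 0 = ∏ m ∈ Finset.range (n + 1), F (m : ℤ) := by
  induction n with
  | zero => simp
  | succ n ih =>
    rw [Finset.prod_Icc_succ_top (by omega), Finset.prod_range_succ, ← ih]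
    ring

/-- The factors f_1, …, f_L differ from a full period f_0, …, f_{L-1} only by f_L = f_0, so their
product is 1 and only the powers of t_i survive. -/
theorem cNat_period (h : IsAdmissible L d θ T f g) {t : Fin (N + 1) → ℂ} (ht : t ∈ T)
    (i : Fin (N + 1)) : cNat f i t L = t i ^ L := by
  have e := prod_Icc_mul_eq_prod_range (fun m => f i m t) L
  rw [Finset.prod_range_succ, h.prod_f i t ht, one_mul] at e
  have e1 : f i (L : ℤ) t = f i 0 t := by simpa using h.periodic_f i 0 t ht
  rw [e1] at e
  rw [cNat, mul_right_cancel₀ (h.f_ne_zero i 0 t ht) (e.trans (one_mul _).symm), mul_one]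

theorem cNat_add_period (h : IsAdmissible L d θ T f g) {t : Fin (N + 1) → ℂ} (ht : t ∈ T)
    (i : Fin (N + 1)) (n : ℕ) : cNat f i t (n + L) = t i ^ L * cNat f i t n := by
  rw [add_comm, cNat_add, cNat_period h ht]
  congr 1
  have := cNat_add f i t 0 n
  rw [zero_add, cNat_zero, one_mul] at this
  rw [this]
  refine Finset.prod_congr rfl fun a _ => ?_
  rw [add_comm (L : ℤ), h.periodic_f i a t ht]
  simp

theorem vEntry_eq_of_lt (h : IsAdmissible L d θ T f g) {t : Fin (N + 1) → ℂ} (ht : t ∈ T)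
    {i : Fin (N + 1)} (h0 : t i ≠ 0) {m n : Fin L} (hmn : m < n) :
    vEntry L f g i t m n = g i (m : ℤ) t / L * (cNat f i t n / cNat f i t m) := by
  have hm := cNat_ne_zero h ht h0 m
  have e := cNat_add f i t m (n - m)
  rw [Nat.add_sub_cancel' hmn.le] at e
  rw [vEntry, if_pos hmn, e, mul_div_cancel_left₀ _ hm]

/-- Wrapping once around the cycle costs the multiplier t_i^L = 1/u_i of `cNat`. The factor u_i in
the definition of A_i removes it again, so that all entries of A_i obey the same formula. -/
theorem vEntry_eq_of_le (h : IsAdmissible L d θ T f g) {t : Fin (N + 1) → ℂ} (ht : t ∈ T)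
    {i : Fin (N + 1)} (h0 : t i ≠ 0) {m n : Fin L} (hmn : n ≤ m) :
    vEntry L f g i t m n =
      t i ^ L * (g i (m : ℤ) t / L * (cNat f i t n / cNat f i t m)) := by
  have hm := cNat_ne_zero h ht h0 m
  have e := cNat_add f i t m (n + L - m)
  rw [Nat.add_sub_cancel' (by omega), cNat_add_period h ht] at e
  rw [vEntry, if_neg hmn.not_gt, eq_div_of_mul_eq hm (mul_comm _ _ |>.trans e.symm)]
  ring

theorem bVec_eq (f g : Family N) (i : Fin (N + 1)) (t : Fin (N + 1) → ℂ) (n : Fin L) :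
    bVec L f g i t n = - g i (n : ℤ) t / (L * cNat f i t n) := by
  rw [bVec, cNat, mul_assoc]

theorem resA_apply (h : IsAdmissible L d θ T f g) {t : Fin (N + 1) → ℂ} (ht : t ∈ T)
    {i : Fin (N + 1)} (h0 : t i ≠ 0) (m n : Fin L) :
    resA L f g i t m n = - (g i (m : ℤ) t / L * (cNat f i t n / cNat f i t m)) := by
  rw [resA, Matrix.of_apply]
  split_ifs with hmn
  · rw [vEntry_eq_of_lt h ht h0 hmn]
  · rw [vEntry_eq_of_le h ht h0 (not_lt.mp hmn), ← mul_assoc,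
      inv_mul_cancel₀ (pow_ne_zero L h0), one_mul]

theorem resA_eq_vecMulVec (h : IsAdmissible L d θ T f g) {t : Fin (N + 1) → ℂ} (ht : t ∈ T)
    {i : Fin (N + 1)} (h0 : t i ≠ 0) :
    resA L f g i t = Matrix.vecMulVec (bVec L f g i t) (cVec L f i t) := by
  ext m n
  rw [resA_apply h ht h0, Matrix.vecMulVec_apply, bVec_eq]
  change _ = _ * cNat f i t n
  ring

theorem cVec_dotProduct_bVec (hL : L ≠ 0) (h : IsAdmissible L d θ T f g) {t : Fin (N + 1) → ℂ}
    (ht : t ∈ T) {i : Fin (N + 1)} (h0 : t i ≠ 0) :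
    dotProduct (cVec L f i t) (bVec L f g i t) = - θ i := by
  have hL' : (L : ℂ) ≠ 0 := by exact_mod_cast hL
  have e : ∀ n : Fin L, cVec L f i t n * bVec L f g i t n = - (g i (n : ℤ) t / L) := by
    intro n
    rw [bVec_eq]
    change cNat f i t n * _ = _
    have := cNat_ne_zero h ht h0 n
    field_simp
  have e2 := h.sum_g i t ht
  rw [Finset.sum_range] at e2
  rw [dotProduct, Finset.sum_congr rfl fun n _ => e n, Finset.sum_neg_distrib, ← Finset.sum_div,
    e2, mul_div_cancel_left₀ _ hL']

theorem charpoly_resA (hL : 2 ≤ L) (h : IsAdmissible L d θ T f g) {t : Fin (N + 1) → ℂ}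
    (ht : t ∈ T) {i : Fin (N + 1)} (h0 : t i ≠ 0) :
    (resA L f g i t).charpoly =
      Polynomial.X ^ (L - 1) * (Polynomial.X - Polynomial.C (- θ i)) := by
  rw [resA_eq_vecMulVec h ht h0, Matrix.charpoly_vecMulVec, dotProduct_comm,
    cVec_dotProduct_bVec (by omega) h ht h0, Fintype.card_fin, mul_sub, ← pow_succ,
    Nat.sub_add_cancel (by omega), Polynomial.smul_eq_C_mul, mul_comm (Polynomial.C _)]

theorem multiplicities_resA (hL : 2 ≤ L) (h : IsAdmissible L d θ T f g) {t : Fin (N + 1) → ℂ}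
    (ht : t ∈ T) {i : Fin (N + 1)} (h0 : t i ≠ 0) (hθ : θ i ≠ 0) :
    multiplicities (resA L f g i t) = {L - 1, 1} := by
  have hr : (resA L f g i t).charpoly.roots = Multiset.replicate (L - 1) 0 + {- θ i} := by
    rw [charpoly_resA hL h ht h0, Polynomial.roots_mul, Polynomial.roots_X_pow,
      Polynomial.roots_X_sub_C, Multiset.nsmul_singleton]
    exact mul_ne_zero (pow_ne_zero _ Polynomial.X_ne_zero) (Polynomial.X_sub_C_ne_zero _)
  have h1 : - θ i ≠ 0 := neg_ne_zero.mpr hθ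
  have hd : (Multiset.replicate (L - 1) (0 : ℂ) + {- θ i}).dedup = {0, - θ i} := by
    refine Multiset.Nodup.ext (Multiset.nodup_dedup _) (by simp [h1.symm]) |>.mpr fun a => ?_
    simp only [Multiset.mem_dedup, Multiset.mem_add, Multiset.mem_replicate,
      Multiset.mem_singleton, Multiset.insert_eq_cons, Multiset.mem_cons]
    -- L ≥ 2 is what makes 0 an eigenvalue at all, so that two distinct multiplicities are listed.
    have : L - 1 ≠ 0 := by omega
    simp [this]
  rw [multiplicities, hr, hd]
  simp [Multiset.count_replicate, Multiset.count_singleton, h1.symm]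

theorem rank_resA (hL : L ≠ 0) (h : IsAdmissible L d θ T f g) {t : Fin (N + 1) → ℂ}
    (ht : t ∈ T) {i : Fin (N + 1)} (h0 : t i ≠ 0) (hθ : θ i ≠ 0) :
    (resA L f g i t).rank = 1 := by
  refine le_antisymm ?_ (Nat.one_le_iff_ne_zero.mpr fun hr => ?_)
  · rw [resA_eq_vecMulVec h ht h0]
    exact Matrix.rank_vecMulVec_le _ _
  -- Rank zero would give A_i b = 0, whereas A_i b = (c b) b = -θ_i b. Then b = 0, against c b =
  -- -θ_i ≠ 0.
  · have hz : Matrix.mulVec (resA L f g i t) (bVec L f g i t) = 0 :=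
      LinearMap.congr_fun (LinearMap.range_eq_bot.mp (Submodule.finrank_eq_zero.mp hr))
        (bVec L f g i t)
    have e := cVec_dotProduct_bVec hL h ht h0
    have e1 : Matrix.mulVec (resA L f g i t) (bVec L f g i t) = - θ i • bVec L f g i t := by
      rw [resA_eq_vecMulVec h ht h0, Matrix.vecMulVec_mulVec, e]
      ext; simp [mul_comm]
    rw [hz] at e1
    have e2 : bVec L f g i t = 0 := by
      rcases smul_eq_zero.mp e1.symm with h' | h'
      · exact absurd (neg_eq_zero.mp h') hθ
      · exact h'
    rw [e2, dotProduct_zero] at e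
    exact hθ (neg_eq_zero.mp e.symm)

theorem multiplicities_of_charpoly_eq_prod {M : Matrix (Fin L) (Fin L) ℂ} {e : Fin L → ℂ}
    (hM : M.charpoly = ∏ n : Fin L, (Polynomial.X - Polynomial.C (e n)))
    (he : Function.Injective e) : multiplicities M = Multiset.replicate L 1 := by
  have hr : M.charpoly.roots = Finset.univ.val.map e := by
    have := Polynomial.roots_multiset_prod_X_sub_C (Finset.univ.val.map e)
    rw [Multiset.map_map] at this
    rw [hM]
    exact this
  have hn : (Finset.univ.val.map e).Nodup := Finset.univ.nodup.map he
  rw [multiplicities, hr, Multiset.dedup_eq_self.mpr hn]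
  rw [Multiset.eq_replicate]
  refine ⟨by simp, fun b hb => ?_⟩
  obtain ⟨a, ha, rfl⟩ := Multiset.mem_map.mp hb
  exact Multiset.count_eq_one_of_mem hn ha

/-! ### Exponents at z = 0 and z = ∞ -/

theorem charpoly_resZero (t : Fin (N + 1) → ℂ) :
    (resZero L d f g t).charpoly =
      ∏ n : Fin L, (Polynomial.X - Polynomial.C (expZero L d n)) := by
  rw [Matrix.charpoly_of_isUpperTriangular]
  · simp [resZero]
  · intro m n hmn
    have hmn' : n < m := hmn
    simp [resZero, hmn'.ne', hmn'.not_gt]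

theorem resInfty_eq (t : Fin (N + 1) → ℂ) :
    resInfty L d f g t = - (∑ i, resA L f g i t + resZero L d f g t) := by
  simp [resInfty, Fin.sum_univ_castSucc (n := N + 1)]

theorem resInfty_apply (t : Fin (N + 1) → ℂ) (m n : Fin L) :
    resInfty L d f g t m n = - (∑ i, resA L f g i t m n + resZero L d f g t m n) := by
  rw [resInfty_eq, Matrix.neg_apply, Matrix.add_apply, Matrix.sum_apply]

/-- The upper entries of A_{N+1} are chosen to cancel those of A_0 + ⋯ + A_N. Infinity therefore
carries a lower triangular residue, while the origin carries an upper triangular one. -/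
theorem resInfty_apply_of_lt (t : Fin (N + 1) → ℂ) {m n : Fin L} (hmn : m < n) :
    resInfty L d f g t m n = 0 := by
  rw [resInfty_apply]
  simp [resA, resZero, hmn, hmn.ne]

theorem resInfty_apply_self (h : IsAdmissible L d θ T f g) {t : Fin (N + 1) → ℂ} (ht : t ∈ T)
    (h0 : ∀ i, t i ≠ 0) (n : Fin L) :
    resInfty L d f g t n n = kappaBar L d θ n - expZero L d n := by
  have e : ∀ i, resA L f g i t n n = - (g i (n : ℤ) t / L) := by
    intro i
    rw [resA_apply h ht (h0 i), div_self (cNat_ne_zero h ht (h0 i) n), mul_one]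
  rw [resInfty_apply, Finset.sum_congr rfl fun i _ => e i, Finset.sum_neg_distrib,
    ← Finset.sum_div, h.sum_g_kappa n t ht]
  simp [resZero, kappaBar, sub_eq_add_neg, add_comm]

theorem charpoly_resInfty (h : IsAdmissible L d θ T f g) {t : Fin (N + 1) → ℂ} (ht : t ∈ T)
    (h0 : ∀ i, t i ≠ 0) :
    (resInfty L d f g t).charpoly = ∏ n : Fin L, (Polynomial.X -
      Polynomial.C (kappaBar L d θ n - expZero L d n)) := by
  rw [← Matrix.charpoly_transpose, Matrix.charpoly_of_isUpperTriangular]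
  · simp [resInfty_apply_self h ht h0]
  · intro m n hmn
    have hmn' : n < m := hmn
    exact resInfty_apply_of_lt t hmn'

theorem sum_expZero (hL : L ≠ 0) (hd : IsDegreeArray L d) :
    ∑ n : Fin L, expZero L d n = ((L : ℂ) - 1) / 2 := by
  have hL' : (L : ℂ) ≠ 0 := by exact_mod_cast hL
  -- By the balancing condition, d_{m,n} - d_{m-1,n} does not depend on n. With n fixed the sum
  -- telescopes, periodicity removes the boundary terms, and 0 + 1 + ⋯ + (L-1) is left.
  have hb : ∀ m n n', d m n - d (m - 1) n = d m n' - d (m - 1) n' := by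
    intro m
    have hs : ∀ n, d m (n + 1) - d (m - 1) (n + 1) = d m n - d (m - 1) n := by
      intro n
      have := hd.balanced (m - 1) n
      rw [sub_add_cancel] at this
      linear_combination this
    have h0 : ∀ n, d m n - d (m - 1) n = d m 0 - d (m - 1) 0 := by
      intro n
      induction n using Int.induction_on with
      | zero => rfl
      | succ n ih => rw [hs, ih]
      | pred n ih => rw [← ih, ← hs, sub_add_cancel]
    intro n n'
    rw [h0, h0 n']
  have e : ∀ n : Fin L, expZero L d n =
      ((d ((n : ℕ) : ℤ) 0 - d (((n : ℕ) : ℤ) - 1) 0) + ((n : ℕ) : ℂ)) / L := by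
    intro n
    rw [expZero, hb _ _ 0]
  have tel : ∀ k : ℕ, ∑ n ∈ Finset.range k, (d (n : ℤ) 0 - d ((n : ℤ) - 1) 0) =
      d ((k : ℤ) - 1) 0 - d (-1) 0 := by
    intro k
    induction k with
    | zero => simp
    | succ k ih => rw [Finset.sum_range_succ, ih]; push_cast; rw [add_sub_cancel_right]; ring
  have h1 : d ((L : ℤ) - 1) 0 = d (-1) 0 := by
    have := hd.periodic_left (-1) 0
    rwa [neg_add_eq_sub] at this
  have gauss : ∀ k : ℕ, ∑ n ∈ Finset.range k, (n : ℂ) = k * (k - 1) / 2 := by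
    intro k
    induction k with
    | zero => simp
    | succ k ih => rw [Finset.sum_range_succ, ih]; push_cast; ring
  rw [Finset.sum_congr rfl fun n _ => e n, ← Finset.sum_div, Finset.sum_add_distrib,
    ← Finset.sum_range (fun n => d (n : ℤ) 0 - d ((n : ℤ) - 1) 0),
    ← Finset.sum_range (fun n => (n : ℂ)), tel, h1, gauss]
  field_simp
  ring

/-- The differences d_{n,-n-1} - d_{n-1,-n} telescope along the antidiagonal, where d has period L.
-/
theorem sum_kappaBar (hL : L ≠ 0) (hd : IsDegreeArray L d) :
    ∑ n : Fin L, kappaBar L d θ n = ∑ i, θ i := by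
  have hL' : (L : ℂ) ≠ 0 := by exact_mod_cast hL
  have tel : ∀ k : ℕ, ∑ n ∈ Finset.range k,
      (kappa d θ (n : ℤ) (-(n : ℤ))) = d ((k : ℤ) - 1) (-(k : ℤ)) - d (-1) 0 + k * ∑ i, θ i := by
    intro k
    induction k with
    | zero => simp
    | succ k ih =>
      rw [Finset.sum_range_succ, ih, kappa]
      push_cast
      rw [add_sub_cancel_right, neg_add, ← sub_eq_add_neg]
      ring
  have h1 : d ((L : ℤ) - 1) (-(L : ℤ)) = d (-1) 0 := by
    have h2 := hd.periodic_left (-1) (-(L : ℤ))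
    have h3 := hd.periodic_right (-1) (-(L : ℤ))
    rw [neg_add_cancel] at h3
    rw [neg_add_eq_sub] at h2
    rw [h2, ← h3]
  simp only [kappaBar]
  rw [← Finset.sum_div, ← Finset.sum_range (fun n => kappa d θ (n : ℤ) (-(n : ℤ))), tel, h1,
    sub_self, zero_add, mul_div_cancel_left₀ _ hL']

end

section

variable {N : ℕ}
variable {L : ℕ} {d : ℤ → ℤ → ℂ} {θ : Fin (N + 1) → ℂ} {T : Set (Fin (N + 1) → ℂ)} {f g : Family N}

/-! ### The coefficients of the nonlinear system -/

/-- A statement about the integers that is invariant under translation by `L` needs only to be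
checked on one period. -/
theorem forall_int_of_period {L : ℕ} (hL : L ≠ 0) {P : ℤ → Prop} (hP : ∀ n, P (n + L) ↔ P n)
    (h : ∀ k : ℕ, k < L → P ((k : ℤ) + 1)) (n : ℤ) : P n := by
  have hmul : ∀ (q : ℤ) (n : ℤ), P (n + q * L) ↔ P n := by
    intro q
    induction q using Int.induction_on with
    | zero => simp
    | succ q ih =>
      intro n
      rw [add_mul, one_mul, ← add_assoc, hP, ih]
    | pred q ih =>
      intro n
      rw [← hP, sub_mul, one_mul, ← add_sub_assoc, sub_add_cancel, ih]
  have hL' : (0 : ℤ) < L := by omega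
  have h1 := Int.emod_add_mul_ediv (n - 1) L
  have h2 := Int.emod_nonneg (n - 1) hL'.ne'
  have h3 := Int.emod_lt_of_pos (n - 1) hL'
  have h4 := h ((n - 1) % L).toNat (by omega)
  rw [Int.toNat_of_nonneg h2, ← hmul ((n - 1) / L)] at h4
  convert h4 using 1
  linarith

theorem eq_of_period_shift {F : ℤ → ℂ} (h : ∀ n, F (n + 1) = F n) (m n : ℤ) : F m = F n := by
  have h0 : ∀ n, F n = F 0 := by
    intro n
    induction n using Int.induction_on with
    | zero => rfl
    | succ n ih => rw [h, ih]
    | pred n ih => rw [← ih, ← h (-(n : ℤ) - 1), sub_add_cancel]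
  rw [h0 m, h0 n]

theorem prod_range_sub_of_periodic {L : ℕ} {F : ℤ → ℂ} (hF : ∀ n, F (n + L) = F n)
    (h0 : ∀ n, F n ≠ 0) (j : ℤ) :
    ∏ a ∈ Finset.range L, F (j - a) = ∏ a ∈ Finset.range L, F a := by
  have h1 : ∀ j : ℤ, ∏ a ∈ Finset.range L, F (j + 1 - a) = ∏ a ∈ Finset.range L, F (j - a) := by
    intro j
    have e1 := Finset.prod_range_succ (fun a : ℕ => F (j + 1 - a)) L
    have e2 := Finset.prod_range_succ' (fun a : ℕ => F (j + 1 - a)) L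
    rw [e1] at e2
    have e3 : F (j + 1 - (L : ℕ)) = F (j + 1 - ((0 : ℕ) : ℤ)) := by
      rw [← hF]; congr 1; simp
    have e4 : ∀ a : ℕ, F (j + 1 - ((a + 1 : ℕ) : ℤ)) = F (j - a) := fun a => by
      congr 1; push_cast; ring
    rw [e3] at e2
    simp only [e4] at e2
    exact mul_right_cancel₀ (h0 _) e2
  rw [eq_of_period_shift (F := fun j => ∏ a ∈ Finset.range L, F (j - a)) h1 j ((L : ℤ) - 1), ← Finset.prod_range_reflect]
  refine Finset.prod_congr rfl fun a ha => ?_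
  have := Finset.mem_range.mp ha
  congr 1
  omega

/-- In every summand of V_j the factor with a = 0 splits off; the rest is the corresponding summand
of U_{j-1}. -/
theorem auxV_eq (L : ℕ) (f g : Family N) (i l : Fin (N + 1)) (j : ℤ) (t : Fin (N + 1) → ℂ) :
    auxV L f g i l j t = (t i * f i j t) / (t l * f l j t) * auxU L f g i l (j - 1) t := by
  rw [auxV, auxU, mul_left_comm]
  congr 1
  rw [Finset.mul_sum]
  refine Finset.sum_congr rfl fun b hb => ?_
  have hb1 : 0 < b := (Finset.mem_Icc.mp hb).1
  have e1 : j - 1 - (b : ℤ) + 1 = j - b := by ring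
  have e2 : ∀ a : ℕ, j - 1 - (a : ℤ) + 1 = j - a := fun a => by ring
  rw [Finset.range_eq_Ico, Finset.prod_eq_prod_Ico_succ_bot hb1, e1]
  simp only [e2]
  push_cast
  rw [sub_zero]
  ring

/-- The numerators of V and U sum the same sequence G over 1, …, L and over 0, …, L-1. They differ
by G(L) - G(0) = ((t_i/t_l)^L - 1) g_j, and the prefactor cancels. Combined with `auxV_eq` this is
the first-order recursion that characterizes U. -/
theorem auxV_eq_auxU_add (h : IsAdmissible L d θ T f g) {t : Fin (N + 1) → ℂ} (ht : t ∈ T)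
    {i l : Fin (N + 1)} (hi : t i ≠ 0) (hl : t l ≠ 0) (hil : t i ^ L ≠ t l ^ L) (j : ℤ) :
    auxV L f g i l j t = auxU L f g i l j t + g i j t := by
  set r : ℤ → ℂ := fun a => (t i * f i a t) / (t l * f l a t) with hr
  have hr0 : ∀ a, r a ≠ 0 := fun a =>
    div_ne_zero (mul_ne_zero hi (h.f_ne_zero i a t ht)) (mul_ne_zero hl (h.f_ne_zero l a t ht))
  have hrp : ∀ a, r (a + L) = r a := fun a => by
    simp only [hr, h.periodic_f i a t ht, h.periodic_f l a t ht]
  set G : ℕ → ℂ := fun b => g i (j - b) t * ∏ a ∈ Finset.range b, r (j - a) with hG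
  have eV : ∑ b ∈ Finset.Icc 1 L, g i (j - b) t *
      ∏ a ∈ Finset.range b, (t i * f i (j - a) t) / (t l * f l (j - a) t) =
      ∑ b ∈ Finset.range L, G (b + 1) := by
    have e := Finset.sum_Ico_add' G 0 L 1
    rw [zero_add, ← Finset.range_eq_Ico] at e
    exact (e.trans rfl).symm
  have eU : ∑ b ∈ Finset.Icc 1 L, g i (j - b + 1) t *
      ∏ a ∈ Finset.Ico 1 b, (t i * f i (j - a + 1) t) / (t l * f l (j - a + 1) t) =
      ∑ b ∈ Finset.range L, G b := by
    have e := Finset.sum_Ico_add' (fun b : ℕ => g i (j - b + 1) t *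
      ∏ a ∈ Finset.Ico 1 b, (t i * f i (j - a + 1) t) / (t l * f l (j - a + 1) t)) 0 L 1
    rw [zero_add, ← Finset.range_eq_Ico] at e
    refine (e.trans rfl).symm.trans (Finset.sum_congr rfl fun b _ => ?_)
    have e2 := Finset.prod_Ico_add' (fun a : ℕ => r (j - a + 1)) 0 b 1
    rw [zero_add, ← Finset.range_eq_Ico] at e2
    have e3 : ∀ a : ℕ, j - ((a + 1 : ℕ) : ℤ) + 1 = j - a := fun a => by push_cast; ring
    simp only [e3] at e2
    rw [hG]
    simp only [e3]
    rw [e2]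
  have hq : (t i / t l) ^ L - 1 ≠ 0 := by
    rw [sub_ne_zero, div_pow]
    exact fun h' => hil (by rwa [div_eq_one_iff_eq (pow_ne_zero L hl)] at h')
  have hprod : ∏ a ∈ Finset.range L, r (j - a) = (t i / t l) ^ L := by
    rw [prod_range_sub_of_periodic hrp hr0]
    simp only [hr, Finset.prod_div_distrib, Finset.prod_mul_distrib, h.prod_f i t ht,
      h.prod_f l t ht, Finset.prod_const, Finset.card_range, mul_one, div_pow]
  have e1 := Finset.sum_range_succ G L
  rw [Finset.sum_range_succ'] at e1
  have e2 : G L = (t i / t l) ^ L * g i j t := by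
    simp only [hG, hprod]
    rw [← h.periodic_g i _ t ht, sub_add_cancel, mul_comm]
  have e3 : G 0 = g i j t := by simp [hG]
  rw [e2, e3] at e1
  rw [auxV, auxU, eV, eU]
  field_simp
  linear_combination e1

theorem auxU_succ (h : IsAdmissible L d θ T f g) {t : Fin (N + 1) → ℂ} (ht : t ∈ T)
    {i l : Fin (N + 1)} (hi : t i ≠ 0) (hl : t l ≠ 0) (hil : t i ^ L ≠ t l ^ L) (j : ℤ) :
    auxU L f g i l (j + 1) t =
      (t i * f i (j + 1) t) / (t l * f l (j + 1) t) * auxU L f g i l j t - g i (j + 1) t := by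
  have := auxV_eq L f g i l (j + 1) t
  rw [auxV_eq_auxU_add h ht hi hl hil, add_sub_cancel_right] at this
  linear_combination this

theorem auxU_period (h : IsAdmissible L d θ T f g) {t : Fin (N + 1) → ℂ} (ht : t ∈ T)
    (i l : Fin (N + 1)) (j : ℤ) : auxU L f g i l (j + L) t = auxU L f g i l j t := by
  unfold auxU
  congr 1
  refine Finset.sum_congr rfl fun b _ => ?_
  have e : ∀ a : ℤ, j + L - a + 1 = (j - a + 1) + L := fun a => by ring
  simp only [e, h.periodic_f _ _ t ht, h.periodic_g _ _ t ht]

/-- Solution of a first-order quasi-periodic recursion. -/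
theorem quasiperiodic_recursion {L : ℕ} {X y : ℕ → ℂ} {q : ℂ}
    (hX : ∀ n, X (n + 1) = X n - y (n + 1)) (hXL : X L * q = X 0) (hyL : y L * q = y 0)
    {n : ℕ} (hn : n < L) :
    X n * (q - 1) = ∑ m ∈ Finset.range L, (if m ≤ n then 1 else q) * y m := by
  -- Iteration gives X_n up to the initial value; comparing n = L with n = 0 through the multiplier
  -- q then determines X_0.
  have h1 : ∀ n, X n = X 0 + y 0 - ∑ k ∈ Finset.range (n + 1), y k := by
    intro n
    induction n with
    | zero => simp
    | succ n ih => rw [hX, ih, Finset.sum_range_succ _ (n + 1)]; ring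
  have h2 : ∑ m ∈ Finset.range L, (if m ≤ n then 1 else q) * y m =
      q * ∑ m ∈ Finset.range L, y m - (q - 1) * ∑ k ∈ Finset.range (n + 1), y k := by
    have e : Finset.range (n + 1) = (Finset.range L).filter (· ≤ n) := by
      ext m; simp only [Finset.mem_range, Finset.mem_filter]; omega
    rw [e, Finset.sum_filter, Finset.mul_sum, Finset.mul_sum, ← Finset.sum_sub_distrib]
    refine Finset.sum_congr rfl fun m _ => ?_
    split_ifs <;> ring
  have h3 := h1 L
  rw [Finset.sum_range_succ] at h3
  rw [h2, h1 n]
  linear_combination hXL + hyL - q * h3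

/-- The integrating factor c^{(l)}_n / c^{(i)}_n turns `auxU_succ` into a plain summation. Its
multiplier (t_i/t_l)^L over a period comes from `cNat_period`, so the solution of the recursion has
two constant weights, split at n. -/
theorem auxU_eq_sum (h : IsAdmissible L d θ T f g) {t : Fin (N + 1) → ℂ} (ht : t ∈ T)
    {i l : Fin (N + 1)} (hi : t i ≠ 0) (hl : t l ≠ 0) (hil : t i ^ L ≠ t l ^ L) (n : Fin L) :
    auxU L f g i l (n : ℤ) t * (cNat f l t n / cNat f i t n) * ((t i / t l) ^ L - 1) =
      ∑ m : Fin L, (if m ≤ n then 1 else (t i / t l) ^ L) *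
        (g i (m : ℤ) t * (cNat f l t m / cNat f i t m)) := by
  have hci := fun n => cNat_ne_zero h ht hi n
  have hcl := fun n => cNat_ne_zero h ht hl n
  have key := quasiperiodic_recursion (L := L)
    (X := fun n => auxU L f g i l (n : ℤ) t * (cNat f l t n / cNat f i t n))
    (y := fun m => g i (m : ℤ) t * (cNat f l t m / cNat f i t m)) (q := (t i / t l) ^ L)
    (fun n => by
      have h1 := h.f_ne_zero i ((n : ℤ) + 1) t ht
      have h2 := h.f_ne_zero l ((n : ℤ) + 1) t ht
      have h3 := hci n
      have h4 := hcl n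
      push_cast
      rw [auxU_succ h ht hi hl hil, cNat_succ, cNat_succ]
      field_simp)
    (by
      have e := auxU_period h ht i l 0
      rw [zero_add] at e
      rw [e, cNat_period h ht, cNat_period h ht, div_pow]
      have h1 := pow_ne_zero L hi
      have h2 := pow_ne_zero L hl
      simp only [Nat.cast_zero, cNat_zero]
      field_simp)
    (by
      have e := h.periodic_g i 0 t ht
      rw [zero_add] at e
      rw [e, cNat_period h ht, cNat_period h ht, div_pow]
      have h1 := pow_ne_zero L hi
      have h2 := pow_ne_zero L hl
      simp only [Nat.cast_zero, cNat_zero]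
      field_simp) n.2
  rw [Finset.sum_range] at key
  exact key

/-- The entries of the commutators that occur in the residues of the compatibility condition. -/
theorem residue_rhs_apply (hL : L ≠ 0) (h : IsAdmissible L d θ T f g) {t : Fin (N + 1) → ℂ}
    (ht : t ∈ T) (h0 : ∀ i, t i ≠ 0) {i j : Fin (N + 1)} (hij : t i ^ L ≠ t j ^ L) (m n : Fin L) :
    (coeffBInfty L θ f g j t * resA L f g i t - resA L f g i t * coeffBInfty L θ f g j t
      + (1 / ((t i ^ L)⁻¹ - (t j ^ L)⁻¹)) •
        (resA L f g i t * resA L f g j t - resA L f g j t * resA L f g i t)) m n =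
    t j ^ L / L ^ 2 * ((cNat f i t n / cNat f i t m) *
      (g i (m : ℤ) t * auxU L f g j i (n : ℤ) t +
        g j (m : ℤ) t * (auxU L f g i j (m : ℤ) t + g i (m : ℤ) t))) := by
  have hL' : (L : ℂ) ≠ 0 := by exact_mod_cast hL
  have hti := pow_ne_zero L (h0 i)
  have htj := pow_ne_zero L (h0 j)
  have hci := fun n => cNat_ne_zero h ht (h0 i) n
  have hcj := fun n => cNat_ne_zero h ht (h0 j) n
  have hsub : t j ^ L - t i ^ L ≠ 0 := sub_ne_zero.mpr hij.symm
  set κ : ℂ := 1 / ((t i ^ L)⁻¹ - (t j ^ L)⁻¹) with hκ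
  set Q : ℂ := (t j / t i) ^ L with hQ
  have hκQ : t j ^ L + κ = κ * Q := by
    rw [hκ, hQ, inv_sub_inv hti htj, div_pow]
    field_simp
    ring
  have hκQ1 : κ * (Q - 1) = t j ^ L := by rw [mul_sub, ← hκQ]; ring
  have hQ0 : Q ≠ 0 := pow_ne_zero L (div_ne_zero (h0 j) (h0 i))
  -- The pole term κ A_j and the gauge term t_j^L · (strictly lower part of A_j) merge: since t_j^L
  -- + κ = κ Q, the strictly lower entries of A_j merely acquire the extra weight Q. The right-hand
  -- side is then one commutator with M, and its weights match those of `auxU_eq_sum`.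
  set M : Matrix (Fin L) (Fin L) ℂ := Matrix.of fun p q =>
    κ * ((if q < p then Q else 1) * resA L f g j t p q) with hM
  have hMeq : M = (t j ^ L) • strictLower (resA L f g j t) + κ • resA L f g j t := by
    ext p q
    simp only [hM, Matrix.of_apply, Matrix.add_apply, Matrix.smul_apply, strictLower_apply,
      smul_eq_mul]
    split_ifs
    · rw [← add_mul, hκQ]; ring
    · ring
  have e0 : coeffBInfty L θ f g j t * resA L f g i t - resA L f g i t * coeffBInfty L θ f g j t
      + κ • (resA L f g i t * resA L f g j t - resA L f g j t * resA L f g i t) =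
      resA L f g i t * M - M * resA L f g i t := by
    rw [hMeq, coeffBInfty_eq θ f g j (h0 j)]
    simp only [add_mul, mul_add, Matrix.smul_mul, Matrix.mul_smul, one_mul, mul_one, neg_mul,
      mul_neg, smul_sub]
    abel
  have s1 := auxU_eq_sum h ht (h0 j) (h0 i) hij.symm n
  have s2 := auxU_eq_sum h ht (h0 i) (h0 j) hij m
  have hQi : (t i / t j) ^ L = Q⁻¹ := by rw [hQ, ← inv_pow, inv_div]
  rw [← hQ] at s1
  rw [hQi] at s2
  have e1 : (resA L f g i t * M) m n = κ * (g i (m : ℤ) t * cNat f j t n / (L ^ 2 * cNat f i t m)) *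
      ∑ p : Fin L, (if p ≤ n then 1 else Q) * (g j (p : ℤ) t * (cNat f i t p / cNat f j t p)) := by
    rw [Matrix.mul_apply, Finset.mul_sum]
    refine Finset.sum_congr rfl fun p _ => ?_
    have h1 := hci m
    have h2 := hcj p
    rw [hM, Matrix.of_apply, resA_apply h ht (h0 i), resA_apply h ht (h0 j)]
    by_cases hp : p ≤ n
    · simp only [hp, hp.not_gt, if_true, if_false]; field_simp
    · simp only [hp, not_le.mp hp, if_true, if_false]; field_simp
  -- The weights of M switch at p < m, those of `auxU_eq_sum` at p ≤ m. The term p = m therefore has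
  -- to be corrected by Q - 1.
  have e2 : (M * resA L f g i t) m n = κ * (g j (m : ℤ) t * cNat f i t n / (L ^ 2 * cNat f j t m)) *
      (Q * ∑ p : Fin L, (if p ≤ m then 1 else Q⁻¹) *
        (g i (p : ℤ) t * (cNat f j t p / cNat f i t p)) -
        (Q - 1) * (g i (m : ℤ) t * (cNat f j t m / cNat f i t m))) := by
    have e3 : (Q - 1) * (g i (m : ℤ) t * (cNat f j t m / cNat f i t m)) =
        ∑ p : Fin L, if p = m then (Q - 1) * (g i (p : ℤ) t * (cNat f j t p / cNat f i t p))
          else 0 := by simp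
    rw [e3, Finset.mul_sum Finset.univ _ Q, ← Finset.sum_sub_distrib, Matrix.mul_apply,
      Finset.mul_sum]
    refine Finset.sum_congr rfl fun p _ => ?_
    have h1 := hci p
    have h2 := hcj m
    rw [hM, Matrix.of_apply, resA_apply h ht (h0 i), resA_apply h ht (h0 j)]
    rcases lt_trichotomy p m with hp | rfl | hp
    · simp only [hp, hp.le, hp.ne, if_true, if_false]; field_simp; ring
    · simp only [lt_irrefl, le_refl, if_true, if_false]; field_simp; ring
    · simp only [hp.not_gt, hp.not_ge, hp.ne', if_false]; field_simp; ring
  rw [e0, Matrix.sub_apply, e1, e2, ← s1, ← s2, ← hκQ1]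
  have h1 := hci m
  have h2 := hcj m
  have h3 := hci n
  have h4 := hcj n
  field_simp
  ring

end

section

variable {N : ℕ}
variable {L : ℕ} {d : ℤ → ℤ → ℂ} {θ : Fin (N + 1) → ℂ} {T : Set (Fin (N + 1) → ℂ)} {f g : Family N}

/-! ### The nonlinear system as a commuting flow -/

/-- The system `G_{L,N}` with the equations for `∂ / ∂tᵢ` replaced by homogeneity. -/
structure SolvesFlow (L : ℕ) (d : ℤ → ℤ → ℂ) (θ : Fin (N + 1) → ℂ)
    (T : Set (Fin (N + 1) → ℂ)) (f g : Family N) : Prop where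
  f_other : ∀ t ∈ T, ∀ i j, i ≠ j → ∀ n, t j * pd j (f i n) t =
    (auxU L f g j i n t - auxU L f g j i (n - 1) t) * f i n t
  g_other : ∀ t ∈ T, ∀ i j, i ≠ j → ∀ n, t j * pd j (g i n) t =
    auxU L f g i j n t * g j n t + auxU L f g j i n t * g i n t + g i n t * g j n t
  f_sum : ∀ t ∈ T, ∀ i n, ∑ j, t j * pd j (f i n) t =
    (kappa d θ n (1 - n) - kappa d θ n (-n)) * f i n t
  g_sum : ∀ t ∈ T, ∀ i n, ∑ j, t j * pd j (g i n) t = 0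

/-- With V = U + g and ∑_l g^{(l)} = κ, the equations for the t_i-derivatives of f^{(i)} and g^{(i)}
are the homogeneity relations minus the equations for all l ≠ i. Given the latter, either set
implies the other. -/
theorem solvesG_iff_flow (h : IsAdmissible L d θ T f g)
    (hT0 : ∀ t ∈ T, ∀ i, t i ≠ 0) (hTd : ∀ t ∈ T, ∀ i j, i ≠ j → t i ^ L ≠ t j ^ L) :
    SolvesG L d θ T f g ↔ SolvesFlow L d θ T f g := by
  have hV : ∀ t ∈ T, ∀ i l, l ≠ i → ∀ n,
      auxV L f g l i n t = auxU L f g l i n t + g l n t := fun t ht i l hl n =>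
    auxV_eq_auxU_add h ht (hT0 t ht l) (hT0 t ht i) (hTd t ht l i hl) n
  have hκ : ∀ t ∈ T, ∀ i n, ∑ l ∈ Finset.univ.erase i, g l n t = kappa d θ n (-n) - g i n t := by
    intro t ht i n
    rw [← h.sum_g_kappa n t ht, ← Finset.add_sum_erase _ _ (Finset.mem_univ i),
      add_sub_cancel_left]
  have hUV : ∀ t ∈ T, ∀ i n,
      ∑ l ∈ Finset.univ.erase i, (auxU L f g l i (n - 1) t - auxV L f g l i n t) =
      - (∑ l ∈ Finset.univ.erase i, (auxU L f g l i n t - auxU L f g l i (n - 1) t))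
        - (kappa d θ n (-n) - g i n t) := by
    intro t ht i n
    rw [← hκ t ht, ← Finset.sum_neg_distrib, ← Finset.sum_sub_distrib]
    refine Finset.sum_congr rfl fun l hl => ?_
    rw [hV t ht i l (Finset.ne_of_mem_erase hl)]
    ring
  constructor
  · intro hG
    have hfo : ∀ t ∈ T, ∀ i j, i ≠ j → ∀ n, t j * pd j (f i n) t =
        (auxU L f g j i n t - auxU L f g j i (n - 1) t) * f i n t := by
      intro t ht i j hij n
      rw [hG.f_other i j n hij.symm t ht, hV t ht i j hij.symm]
      ring
    refine ⟨hfo, fun t ht i j hij n => ?_, fun t ht i n => ?_, fun t ht i n => ?_⟩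
    · rw [hG.g_other i j n hij.symm t ht, hV t ht i j hij.symm]
      ring
    · rw [← Finset.add_sum_erase _ _ (Finset.mem_univ i), hG.f_same i n t ht,
        Finset.sum_congr rfl fun j hj => hfo t ht i j (Finset.ne_of_mem_erase hj).symm n,
        ← Finset.sum_mul, hUV t ht]
      ring
    · rw [← Finset.add_sum_erase _ _ (Finset.mem_univ i), hG.g_same i n t ht,
        Finset.sum_congr rfl fun j hj => hG.g_other i j n (Finset.ne_of_mem_erase hj) t ht]
      ring
  · intro hF
    have hgo : ∀ i l n, l ≠ i → ∀ t ∈ T, t l * pd l (g i n) t =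
        auxU L f g i l n t * g l n t + auxV L f g l i n t * g i n t := by
      intro i l n hl t ht
      rw [hF.g_other t ht i l hl.symm n, hV t ht i l hl]
      ring
    refine ⟨fun i n t ht => ?_, fun i l n hl t ht => ?_, fun i n t ht => ?_, hgo⟩
    · have e := hF.f_sum t ht i n
      rw [← Finset.add_sum_erase _ _ (Finset.mem_univ i),
        Finset.sum_congr rfl fun j hj => hF.f_other t ht i j (Finset.ne_of_mem_erase hj).symm n,
        ← Finset.sum_mul] at e
      rw [hUV t ht]
      linear_combination e
    · rw [hF.f_other t ht i l hl.symm n, hV t ht i l hl]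
      ring
    · have e := hF.g_sum t ht i n
      rw [← Finset.add_sum_erase _ _ (Finset.mem_univ i),
        Finset.sum_congr rfl fun j hj => hgo i j n (Finset.ne_of_mem_erase hj) t ht] at e
      exact eq_neg_of_add_eq_zero_left e

/-! ### Derivatives of the factors of the residue matrices -/

section
variable {F G : (Fin (N + 1) → ℂ) → ℂ} {t : Fin (N + 1) → ℂ} (v : Fin (N + 1) → ℂ)

theorem fderiv_mul_apply (hF : DifferentiableAt ℂ F t) (hG : DifferentiableAt ℂ G t) :
    fderiv ℂ (fun s => F s * G s) t v = fderiv ℂ F t v * G t + F t * fderiv ℂ G t v := by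
  rw [fderiv_fun_mul hF hG]
  simp only [add_apply, smul_apply, smul_eq_mul]
  ring

theorem fderiv_div_apply (hF : DifferentiableAt ℂ F t) (hG : DifferentiableAt ℂ G t)
    (h0 : G t ≠ 0) :
    fderiv ℂ (fun s => F s / G s) t v =
      (fderiv ℂ F t v * G t - F t * fderiv ℂ G t v) / G t ^ 2 := by
  have h1 := differentiableAt_div hF hG h0
  have h2 := fderiv_mul_apply v h1 hG
  have h3 : fderiv ℂ (fun s => F s / G s * G s) t = fderiv ℂ F t := by
    refine Filter.EventuallyEq.fderiv_eq ?_
    filter_upwards [hG.continuousAt.eventually_ne h0] with s hs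
    exact div_mul_cancel₀ _ hs
  rw [h3] at h2
  rw [h2]
  field_simp
  ring

theorem mul_pd_eq_fderiv (j : Fin (N + 1)) (hF : DifferentiableAt ℂ F t) :
    t j * pd j F t = fderiv ℂ F t (Pi.single j (t j)) := by
  rw [fderiv_apply_eq_sum_pd hF, Finset.sum_eq_single j]
  · simp
  · intro i _ hi; simp [hi]
  · simp

theorem sum_mul_pd_eq_fderiv (hF : DifferentiableAt ℂ F t) :
    ∑ j, t j * pd j F t = fderiv ℂ F t t := (fderiv_apply_eq_sum_pd hF t).symm

theorem fderiv_coord_apply (i : Fin (N + 1)) :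
    fderiv ℂ (fun s : Fin (N + 1) → ℂ => s i) t v = v i := by
  have : HasFDerivAt (fun s : Fin (N + 1) → ℂ => s i)
      (ContinuousLinearMap.proj (R := ℂ) (φ := fun _ : Fin (N + 1) => ℂ) i) t :=
    hasFDerivAt_apply i t
  rw [this.fderiv]
  rfl

theorem fderiv_congr_of_eqOn {T : Set (Fin (N + 1) → ℂ)} (hT : IsOpen T) (ht : t ∈ T)
    (h : ∀ s ∈ T, F s = G s) : fderiv ℂ F t v = fderiv ℂ G t v := by
  rw [Filter.EventuallyEq.fderiv_eq (Filter.eventually_of_mem (hT.mem_nhds ht) h)]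

end

theorem differentiableAt_cNat (h : IsAdmissible L d θ T f g) (hT : IsOpen T)
    {t : Fin (N + 1) → ℂ} (ht : t ∈ T) (i : Fin (N + 1)) (n : ℕ) :
    DifferentiableAt ℂ (fun s => cNat f i s n) t :=
  ((differentiableAt_coord i t).fun_pow n).fun_mul
    (differentiableAt_prod fun _ _ => h.differentiableAt_f hT ht i _)

/-- The entries of the residue matrices, up to a factor `- 1 / L`. -/
def resEntry (f g : Family N) (i : Fin (N + 1)) (m n : ℕ) (s : Fin (N + 1) → ℂ) : ℂ :=
  g i (m : ℤ) s * (cNat f i s n / cNat f i s m)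

theorem differentiableAt_resEntry (h : IsAdmissible L d θ T f g) (hT : IsOpen T)
    (hT0 : ∀ t ∈ T, ∀ i, t i ≠ 0) {t : Fin (N + 1) → ℂ} (ht : t ∈ T) (i : Fin (N + 1)) (m n : ℕ) :
    DifferentiableAt ℂ (resEntry f g i m n) t :=
  (h.differentiableAt_g hT ht i m).fun_mul (differentiableAt_div
    (differentiableAt_cNat h hT ht i n) (differentiableAt_cNat h hT ht i m)
    (cNat_ne_zero h ht (hT0 t ht i) m))

/-- `cNat` is a product of the factors t_i f_a, whose logarithmic derivatives W_a - W_{a-1}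
telescope. -/
theorem fderiv_cNat_of_fderiv_f (h : IsAdmissible L d θ T f g) (hT : IsOpen T)
    {t : Fin (N + 1) → ℂ} (ht : t ∈ T) (i : Fin (N + 1)) (v : Fin (N + 1) → ℂ) (W : ℤ → ℂ)
    (hf : ∀ n, fderiv ℂ (fun s => s i * f i n s) t v = (W n - W (n - 1)) * (t i * f i n t)) (n : ℕ) :
    fderiv ℂ (fun s => cNat f i s n) t v = (W n - W 0) * cNat f i t n := by
  induction n with
  | zero => simp
  | succ n ih =>
    simp only [cNat_succ]
    rw [fderiv_mul_apply v (differentiableAt_cNat h hT ht i n)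
      ((differentiableAt_coord i t).fun_mul (h.differentiableAt_f hT ht i _)), ih, hf,
      add_sub_cancel_right]
    push_cast
    ring

theorem fderiv_resEntry_of_fderiv_cNat (h : IsAdmissible L d θ T f g) (hT : IsOpen T)
    (hT0 : ∀ t ∈ T, ∀ i, t i ≠ 0) {t : Fin (N + 1) → ℂ} (ht : t ∈ T) (i : Fin (N + 1))
    (v : Fin (N + 1) → ℂ) (W : ℤ → ℂ) {m n : ℕ}
    (hm : fderiv ℂ (fun s => cNat f i s m) t v = (W m - W 0) * cNat f i t m)
    (hn : fderiv ℂ (fun s => cNat f i s n) t v = (W n - W 0) * cNat f i t n) :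
    fderiv ℂ (resEntry f g i m n) t v =
      (fderiv ℂ (g i (m : ℤ)) t v + g i (m : ℤ) t * (W n - W m)) *
        (cNat f i t n / cNat f i t m) := by
  have hc := fun k => differentiableAt_cNat h hT ht i k
  have h0 := cNat_ne_zero h ht (hT0 t ht i) m
  unfold resEntry
  rw [fderiv_mul_apply v (h.differentiableAt_g hT ht i m) (differentiableAt_div (hc n) (hc m) h0),
    fderiv_div_apply v (hc n) (hc m) h0, hm, hn]
  field_simp
  ring

/-- The derivatives of `f` and `g` can be recovered from those of a residue matrix. -/
theorem fderiv_of_fderiv_resEntry (h : IsAdmissible L d θ T f g) (hT : IsOpen T)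
    (hT0 : ∀ t ∈ T, ∀ i, t i ≠ 0) {t : Fin (N + 1) → ℂ} (ht : t ∈ T) {i : Fin (N + 1)}
    (hθ : θ i ≠ 0) (hL : L ≠ 0) (v : Fin (N + 1) → ℂ) (W X : ℤ → ℂ)
    (hWL : L * v i = (W L - W 0) * t i)
    (hres : ∀ m n : ℕ, m < L → n < L → fderiv ℂ (resEntry f g i m n) t v =
      (X m + g i (m : ℤ) t * W n) * (cNat f i t n / cNat f i t m)) :
    (∀ m : ℕ, m < L → fderiv ℂ (g i (m : ℤ)) t v = X m + g i (m : ℤ) t * W m) ∧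
    (∀ n : ℕ, n < L → fderiv ℂ (fun s => s i * f i ((n : ℤ) + 1) s) t v =
      (W ((n : ℤ) + 1) - W n) * (t i * f i ((n : ℤ) + 1) t)) := by
  have hL' : (L : ℂ) ≠ 0 := by exact_mod_cast hL
  have hc := fun k => differentiableAt_cNat h hT ht i k
  have h0 := cNat_ne_zero h ht (hT0 t ht i)
  have hg : ∀ m : ℕ, m < L → fderiv ℂ (g i (m : ℤ)) t v = X m + g i (m : ℤ) t * W m := by
    intro m hm
    have e := hres m m hm hm
    rw [div_self (h0 m), mul_one] at e
    rw [← e]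
    refine fderiv_congr_of_eqOn v hT ht fun s hs => ?_
    rw [resEntry, div_self (cNat_ne_zero h hs (hT0 s hs i) m), mul_one]
  -- This is where θ_i ≠ 0 enters: the g^{(i)}_m add up to L θ_i, so one of them is nonzero at t.
  -- Its row of A_i then reveals the ratios of the c_n.
  obtain ⟨m₀, hm₀, hgm⟩ : ∃ m : ℕ, m < L ∧ g i (m : ℤ) t ≠ 0 := by
    by_contra! hcon
    have e := h.sum_g i t ht
    rw [Finset.sum_eq_zero fun m hm => hcon m (Finset.mem_range.mp hm)] at e
    exact mul_ne_zero hL' hθ e.symm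
  have hratio : ∀ n : ℕ, n < L →
      fderiv ℂ (fun s => cNat f i s n) t v * cNat f i t m₀
        - cNat f i t n * fderiv ℂ (fun s => cNat f i s m₀) t v =
      (W n - W m₀) * (cNat f i t n * cNat f i t m₀) := by
    intro n hn
    have e := hres m₀ n hm₀ hn
    unfold resEntry at e
    rw [fderiv_mul_apply v (h.differentiableAt_g hT ht i m₀)
      (differentiableAt_div (hc n) (hc m₀) (h0 m₀)), hg m₀ hm₀,
      fderiv_div_apply v (hc n) (hc m₀) (h0 m₀)] at e
    have h1 := h0 m₀
    field_simp at e
    refine mul_left_cancel₀ hgm ?_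
    linear_combination e
  have hLpos : 0 < L := Nat.pos_of_ne_zero hL
  -- For n < L the ratio to c_{m₀} is normalized by c_0 = 1. The value n = L is not an index of the
  -- matrix, but there c_L = t_i^L is explicit and `hWL` is the required consistency. It is needed
  -- to reach f_L, that is, f_0.
  have hcN : ∀ n : ℕ, n ≤ L → fderiv ℂ (fun s => cNat f i s n) t v =
      (W n - W 0) * cNat f i t n := by
    intro n hn
    rcases hn.lt_or_eq with hn | rfl
    · have e1 := hratio n hn
      have e2 := hratio 0 hLpos
      simp only [cNat_zero, fderiv_fun_const, Pi.zero_apply, zero_apply, zero_mul,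
        one_mul, zero_sub, Nat.cast_zero] at e2
      refine mul_right_cancel₀ (h0 m₀) ?_
      linear_combination e1 - cNat f i t n * e2
    · have hti := hT0 t ht i
      rw [cNat_period h ht, fderiv_congr_of_eqOn v hT ht fun s hs => cNat_period h hs i,
        fderiv_apply_eq_sum_pd ((differentiableAt_coord i t).fun_pow n), Finset.sum_eq_single i]
      · rw [pd_pow i n (differentiableAt_coord i t), pd_coord, if_pos rfl]
        obtain ⟨k, rfl⟩ : ∃ k, n = k + 1 := ⟨n - 1, by omega⟩
        rw [Nat.add_sub_cancel, pow_succ]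
        linear_combination t i ^ k * hWL
      · intro j _ hj
        rw [pd_comp_coord_of_ne hj.symm (fun x => x ^ n), mul_zero]
      · simp
  refine ⟨hg, fun n hn => ?_⟩
  have e : fderiv ℂ (fun s => s i * f i ((n : ℤ) + 1) s) t v =
      fderiv ℂ (fun s => cNat f i s (n + 1) / cNat f i s n) t v := by
    refine fderiv_congr_of_eqOn v hT ht fun s hs => ?_
    rw [cNat_succ, mul_div_cancel_left₀ _ (cNat_ne_zero h hs (hT0 s hs i) n)]
  rw [e, fderiv_div_apply v (hc _) (hc _) (h0 n), hcN _ hn, hcN _ hn.le, cNat_succ]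
  have h1 := h0 n
  push_cast
  field_simp
  ring

end

section

variable {N : ℕ}
variable {L : ℕ} {d : ℤ → ℤ → ℂ} {θ : Fin (N + 1) → ℂ} {T : Set (Fin (N + 1) → ℂ)} {f g : Family N}

/-! ### The nonlinear system is the compatibility condition -/

/-- The weights `n + d_{n-1,-n} - d_{n-1,-n-1}` of the gauge components under dilation. -/
def weight (d : ℤ → ℤ → ℂ) (n : ℤ) : ℂ := n + d (n - 1) (-n) - d (n - 1) (-n - 1)

/-- Two instances of the balancing condition. The increment is the degree of t_n-type factors in
`cNat`, namely of t_i f_n: the coordinate t_i contributes 1 and f_n the difference of the two κ. -/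
theorem weight_sub (hd : IsDegreeArray L d) (θ : Fin (N + 1) → ℂ) (n : ℤ) :
    weight d n - weight d (n - 1) = 1 + kappa d θ n (1 - n) - kappa d θ n (-n) := by
  have h1 := hd.balanced (n - 1) (-n - 1)
  have h2 := hd.balanced (n - 1 - 1) (-n)
  simp only [sub_add_cancel] at h1 h2
  have e1 : -n + 1 = 1 - n := by ring
  rw [e1] at h2
  simp only [weight, kappa]
  have e2 : (1 - n - 1 : ℤ) = -n := by ring
  have e3 : -(n - 1) = 1 - n := by ring
  rw [e3, e2]
  push_cast
  linear_combination h2 - h1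

/-- The weights are only quasi-periodic: over a period they grow by L, the degree of c_L = t_i^L. -/
theorem weight_period (hd : IsDegreeArray L d) (n : ℤ) : weight d (n + L) = weight d n + L := by
  have h1 : ∀ m k, d (m + L - 1) (-(k + L)) = d (m - 1) (-k) := fun m k => by
    have e1 := hd.periodic_left (m - 1) (-(k + L))
    have e2 := hd.periodic_right (m - 1) (-(k + L))
    rw [show m + (L : ℤ) - 1 = m - 1 + L by ring, e1, ← e2]
    congr 1
    ring
  have h2 := h1 n n
  have h3 := h1 n (n + 1)
  rw [show -(n + 1 + (L : ℤ)) = -(n + L) - 1 by ring, show -(n + 1) = -n - 1 by ring] at h3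
  simp only [weight, h2, h3]
  push_cast
  ring

theorem kappaBar_sub_expZero (d : ℤ → ℤ → ℂ) (θ : Fin (N + 1) → ℂ) (n : Fin L) :
    kappaBar L d θ n - expZero L d n = (∑ i, θ i - weight d (n : ℤ)) / L := by
  simp only [kappaBar, expZero, kappa, weight, ← sub_div]
  congr 1
  push_cast
  ring

/-! ### Entries of the residue equations -/

theorem mpdU_resA_apply (hL : L ≠ 0) (h : IsAdmissible L d θ T f g) (hT : IsOpen T)
    (hT0 : ∀ t ∈ T, ∀ i, t i ≠ 0) {t : Fin (N + 1) → ℂ} (ht : t ∈ T) (i j : Fin (N + 1))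
    (m n : Fin L) :
    mpdU L j (residues L d f g i.castSucc) t m n =
      t j ^ L / L ^ 2 * (t j * pd j (resEntry f g i m n) t) := by
  have hL' : (L : ℂ) ≠ 0 := by exact_mod_cast hL
  have e : pd j (fun s => residues L d f g i.castSucc s m n) t =
      pd j (fun s => - (1 / L) * resEntry f g i m n s) t := by
    refine pd_congr_of_eqOn hT ht j fun s hs => ?_
    rw [residues_castSucc, resA_apply h hs (hT0 s hs i), resEntry]
    ring
  rw [mpdU, Matrix.of_apply, pdU_eq j hL (hT0 t ht j), e, pd_const_mul]
  field_simp

theorem residueDefect_of_ne_apply (hL : L ≠ 0) (h : IsAdmissible L d θ T f g) (hT : IsOpen T)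
    (hT0 : ∀ t ∈ T, ∀ i, t i ≠ 0) (hTd : ∀ t ∈ T, ∀ i j, i ≠ j → t i ^ L ≠ t j ^ L)
    {t : Fin (N + 1) → ℂ} (ht : t ∈ T) {i j : Fin (N + 1)} (hij : i ≠ j) (m n : Fin L) :
    residueDefect L d θ f g t j i.castSucc m n =
      t j ^ L / L ^ 2 * (t j * pd j (resEntry f g i m n) t -
        (cNat f i t n / cNat f i t m) *
          (g i (m : ℤ) t * auxU L f g j i (n : ℤ) t +
            g j (m : ℤ) t * (auxU L f g i j (m : ℤ) t + g i (m : ℤ) t))) := by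
  have hne : i.castSucc ≠ j.castSucc := fun h' => hij (Fin.castSucc_injective _ h')
  rw [residueDefect, if_neg hne, Matrix.sub_apply, mpdU_resA_apply hL h hT hT0 ht]
  simp only [residues_castSucc, sing_castSucc]
  rw [residue_rhs_apply hL h ht (hT0 t ht) (hTd t ht i j hij)]
  ring

theorem smul_coeffBInfty_commutator (θ : Fin (N + 1) → ℂ) (f g : Family N)
    {t : Fin (N + 1) → ℂ} (j : Fin (N + 1)) (h0 : t j ≠ 0) (X : Matrix (Fin L) (Fin L) ℂ) :
    (t j ^ L)⁻¹ • (coeffBInfty L θ f g j t * X - X * coeffBInfty L θ f g j t) =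
      ⁅X, strictLower (resA L f g j t)⁆ := by
  have h1 : (t j ^ L)⁻¹ * t j ^ L = 1 := inv_mul_cancel₀ (pow_ne_zero L h0)
  rw [coeffBInfty_eq θ f g j h0, Ring.lie_def]
  simp only [add_mul, mul_add, Matrix.smul_mul, Matrix.mul_smul, one_mul, mul_one, neg_mul,
    mul_neg, smul_sub, smul_add, smul_neg, smul_smul, h1, one_smul]
  abel

theorem sum_erase_castSucc {M : Type*} [AddCommGroup M] (F : Fin (N + 2) → M) (i : Fin (N + 1)) :
    ∑ l ∈ Finset.univ.erase i.castSucc, F l =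
      ∑ l ∈ Finset.univ.erase i, F l.castSucc + F (Fin.last (N + 1)) := by
  rw [Finset.sum_erase_eq_sub (Finset.mem_univ _), Finset.sum_erase_eq_sub (Finset.mem_univ _),
    Fin.sum_univ_castSucc]
  abel

/-- Below the diagonal A_{N+2} is minus the sum of the A_j, and above it both summands vanish. Only
the exponents at infinity remain; written through the weights they form the constant grading matrix
of the dilation. -/
theorem sum_strictLower_add_resInfty (h : IsAdmissible L d θ T f g) {t : Fin (N + 1) → ℂ}
    (ht : t ∈ T) (h0 : ∀ i, t i ≠ 0) :
    ∑ j, strictLower (resA L f g j t) + resInfty L d f g t =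
      Matrix.diagonal fun n : Fin L => (∑ i, θ i - weight d (n : ℤ)) / L := by
  ext m n
  rw [Matrix.add_apply, Matrix.sum_apply]
  simp only [strictLower_apply]
  rcases lt_trichotomy m n with hmn | rfl | hmn
  · simp [hmn.not_gt, resInfty_apply_of_lt t hmn, hmn.ne]
  · simp [resInfty_apply_self h ht h0, kappaBar_sub_expZero]
  · simp [hmn, resInfty_apply, resZero, hmn.ne', hmn.not_gt]

/-- The weights u_j assemble the derivatives into the Euler field ∑ u_j ∂/∂u_j. By u_i/(u_i - u_l) =
1 + u_l/(u_i - u_l) the pole terms of the equation j = i cancel those of the equations j = l. The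
commutators of A_i left over add up, by A_{N+2} = -∑ A_l, to one with the matrix of
`sum_strictLower_add_resInfty`. -/
theorem sum_smul_residueDefect (h : IsAdmissible L d θ T f g)
    (hT0 : ∀ t ∈ T, ∀ i, t i ≠ 0) (hTd : ∀ t ∈ T, ∀ i j, i ≠ j → t i ^ L ≠ t j ^ L)
    {t : Fin (N + 1) → ℂ} (ht : t ∈ T) (i : Fin (N + 1)) :
    ∑ j, (t j ^ L)⁻¹ • residueDefect L d θ f g t j i.castSucc =
      ∑ j, (t j ^ L)⁻¹ • mpdU L j (residues L d f g i.castSucc) t -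
        ⁅resA L f g i t, Matrix.diagonal fun n : Fin L => (∑ i, θ i - weight d (n : ℤ)) / L⁆ := by
  have hu : ∀ j, (t j ^ L)⁻¹ ≠ 0 := fun j => inv_ne_zero (pow_ne_zero L (hT0 t ht j))
  have e1 : ∀ j ∈ Finset.univ.erase i,
      (t j ^ L)⁻¹ • residueDefect L d θ f g t j i.castSucc =
      (t j ^ L)⁻¹ • mpdU L j (residues L d f g i.castSucc) t
        - ⁅resA L f g i t, strictLower (resA L f g j t)⁆
        - ((t j ^ L)⁻¹ * (1 / ((t i ^ L)⁻¹ - (t j ^ L)⁻¹))) •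
          ⁅resA L f g i t, resA L f g j t⁆ := by
    intro j hj
    have hne : i.castSucc ≠ j.castSucc := fun h' =>
      (Finset.ne_of_mem_erase hj) (Fin.castSucc_injective _ h').symm
    rw [residueDefect, if_neg hne, smul_sub, smul_add]
    simp only [residues_castSucc, sing_castSucc]
    rw [smul_coeffBInfty_commutator θ f g j (hT0 t ht j), smul_smul, ← Ring.lie_def]
    abel
  have e2 : (t i ^ L)⁻¹ • residueDefect L d θ f g t i i.castSucc =
      (t i ^ L)⁻¹ • mpdU L i (residues L d f g i.castSucc) t
        - ⁅resA L f g i t, strictLower (resA L f g i t)⁆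
        + ∑ l ∈ Finset.univ.erase i, ((t i ^ L)⁻¹ * (1 / ((t i ^ L)⁻¹ - (t l ^ L)⁻¹))) •
          ⁅resA L f g i t, resA L f g l t⁆
        + ⁅resA L f g i t, resZero L d f g t⁆ := by
    rw [residueDefect, if_pos rfl, smul_sub, smul_sub, sum_erase_castSucc]
    simp only [residues_castSucc, sing_castSucc, residues_last, sing_last, sub_zero]
    rw [smul_coeffBInfty_commutator θ f g i (hT0 t ht i), smul_add, smul_smul, Finset.smul_sum,
      mul_one_div_cancel (hu i), one_smul]
    simp only [smul_smul, ← Ring.lie_def]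
    abel
  have e3 : ∀ l ∈ Finset.univ.erase i,
      ((t i ^ L)⁻¹ * (1 / ((t i ^ L)⁻¹ - (t l ^ L)⁻¹))) • ⁅resA L f g i t, resA L f g l t⁆ =
      ⁅resA L f g i t, resA L f g l t⁆ +
      ((t l ^ L)⁻¹ * (1 / ((t i ^ L)⁻¹ - (t l ^ L)⁻¹))) • ⁅resA L f g i t, resA L f g l t⁆ := by
    intro l hl
    have h1 : (t i ^ L)⁻¹ - (t l ^ L)⁻¹ ≠ 0 := sub_ne_zero.mpr fun h' =>
      hTd t ht i l (Finset.ne_of_mem_erase hl).symm (inv_injective h')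
    have h2 : (t i ^ L)⁻¹ * (1 / ((t i ^ L)⁻¹ - (t l ^ L)⁻¹)) =
        1 + (t l ^ L)⁻¹ * (1 / ((t i ^ L)⁻¹ - (t l ^ L)⁻¹)) := by
      linear_combination mul_one_div_cancel h1
    rw [h2, add_smul, one_smul]
  rw [← Finset.add_sum_erase _ _ (Finset.mem_univ i), Finset.sum_congr rfl e1, e2,
    Finset.sum_congr rfl e3, ← sum_strictLower_add_resInfty h ht (hT0 t ht),
    ← Finset.add_sum_erase Finset.univ
      (fun j => (t j ^ L)⁻¹ • mpdU L j (residues L d f g i.castSucc) t) (Finset.mem_univ i),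
    resInfty_eq, ← Finset.add_sum_erase Finset.univ (fun j => resA L f g j t) (Finset.mem_univ i),
    ← Finset.add_sum_erase Finset.univ (fun j => strictLower (resA L f g j t)) (Finset.mem_univ i)]
  simp only [Finset.sum_sub_distrib, Finset.sum_add_distrib, Ring.lie_def, mul_add, add_mul,
    mul_neg, neg_mul, Finset.mul_sum, Finset.sum_mul]
  abel

theorem sum_smul_residueDefect_apply (hL : L ≠ 0) (h : IsAdmissible L d θ T f g) (hT : IsOpen T)
    (hT0 : ∀ t ∈ T, ∀ i, t i ≠ 0) (hTd : ∀ t ∈ T, ∀ i j, i ≠ j → t i ^ L ≠ t j ^ L)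
    {t : Fin (N + 1) → ℂ} (ht : t ∈ T) (i : Fin (N + 1)) (m n : Fin L) :
    (∑ j, (t j ^ L)⁻¹ • residueDefect L d θ f g t j i.castSucc) m n =
      1 / L ^ 2 * (∑ j, t j * pd j (resEntry f g i m n) t -
        (weight d (n : ℤ) - weight d (m : ℤ)) * resEntry f g i m n t) := by
  have hL' : (L : ℂ) ≠ 0 := by exact_mod_cast hL
  rw [sum_smul_residueDefect h hT0 hTd ht, Matrix.sub_apply, Matrix.sum_apply, Ring.lie_def,
    Matrix.sub_apply, Matrix.mul_diagonal, Matrix.diagonal_mul, resA_apply h ht (hT0 t ht i)]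
  have e : ∀ j, ((t j ^ L)⁻¹ • mpdU L j (residues L d f g i.castSucc) t) m n =
      1 / L ^ 2 * (t j * pd j (resEntry f g i m n) t) := by
    intro j
    rw [Matrix.smul_apply, mpdU_resA_apply hL h hT hT0 ht, smul_eq_mul]
    have := pow_ne_zero L (hT0 t ht j)
    field_simp
  rw [Finset.sum_congr rfl fun j _ => e j, ← Finset.mul_sum, resEntry]
  field_simp
  ring

theorem pd_coord_mul_of_ne (h : IsAdmissible L d θ T f g) (hT : IsOpen T)
    {t : Fin (N + 1) → ℂ} (ht : t ∈ T) (i : Fin (N + 1)) (n : ℤ) (v : Fin (N + 1) → ℂ) :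
    fderiv ℂ (fun s => s i * f i n s) t v = v i * f i n t + t i * fderiv ℂ (f i n) t v := by
  rw [fderiv_mul_apply v (differentiableAt_coord i t) (h.differentiableAt_f hT ht i n),
    fderiv_coord_apply]

theorem residueDefect_castSucc_eq_zero (hL : L ≠ 0) (hd : IsDegreeArray L d)
    (h : IsAdmissible L d θ T f g) (hT : IsOpen T)
    (hT0 : ∀ t ∈ T, ∀ i, t i ≠ 0) (hTd : ∀ t ∈ T, ∀ i j, i ≠ j → t i ^ L ≠ t j ^ L)
    (hF : SolvesFlow L d θ T f g) {t : Fin (N + 1) → ℂ} (ht : t ∈ T) (i j : Fin (N + 1)) :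
    residueDefect L d θ f g t j i.castSucc = 0 := by
  have hne : ∀ j, i ≠ j → residueDefect L d θ f g t j i.castSucc = 0 := by
    intro j hij
    ext m n
    have hf : ∀ n, fderiv ℂ (fun s => s i * f i n s) t (Pi.single j (t j)) =
        (auxU L f g j i n t - auxU L f g j i (n - 1) t) * (t i * f i n t) := by
      intro n
      rw [pd_coord_mul_of_ne h hT ht, ← mul_pd_eq_fderiv j (h.differentiableAt_f hT ht i n),
        hF.f_other t ht i j hij n, Pi.single_eq_of_ne hij]
      ring
    have hc := fderiv_cNat_of_fderiv_f h hT ht i (Pi.single j (t j))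
      (fun n => auxU L f g j i n t) hf
    rw [residueDefect_of_ne_apply hL h hT hT0 hTd ht hij,
      mul_pd_eq_fderiv j (differentiableAt_resEntry h hT hT0 ht i m n),
      fderiv_resEntry_of_fderiv_cNat h hT hT0 ht i _ (fun n => auxU L f g j i n t) (hc m) (hc n),
      ← mul_pd_eq_fderiv j (h.differentiableAt_g hT ht i m), hF.g_other t ht i j hij]
    simp only [Matrix.zero_apply]
    ring
  rcases eq_or_ne i j with rfl | hij
  swap
  · exact hne j hij
  have hf : ∀ n, fderiv ℂ (fun s => s i * f i n s) t t =
      (weight d n - weight d (n - 1)) * (t i * f i n t) := by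
    intro n
    rw [pd_coord_mul_of_ne h hT ht, ← sum_mul_pd_eq_fderiv (h.differentiableAt_f hT ht i n),
      hF.f_sum t ht i n, weight_sub hd θ]
    ring
  have hc := fderiv_cNat_of_fderiv_f h hT ht i t (weight d) hf
  -- The equation for ∂A_i/∂u_i is not checked directly. Homogeneity makes the weighted sum over j
  -- vanish, the terms j ≠ i are already known to be zero, and u_i ≠ 0.
  have hs : ∑ j, (t j ^ L)⁻¹ • residueDefect L d θ f g t j i.castSucc = 0 := by
    ext m n
    rw [sum_smul_residueDefect_apply hL h hT hT0 hTd ht,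
      sum_mul_pd_eq_fderiv (differentiableAt_resEntry h hT hT0 ht i m n),
      fderiv_resEntry_of_fderiv_cNat h hT hT0 ht i _ (weight d) (hc m) (hc n),
      ← sum_mul_pd_eq_fderiv (h.differentiableAt_g hT ht i m), hF.g_sum t ht i, resEntry]
    simp only [Matrix.zero_apply]
    ring
  rw [Finset.sum_eq_single i (fun j _ hj => by rw [hne j hj.symm, smul_zero]) (by simp)] at hs
  exact (smul_eq_zero.mp hs).resolve_left (inv_ne_zero (pow_ne_zero L (hT0 t ht i)))

/-! ### The residue at the origin -/

theorem mul_apply_eq_zero_of_strictLower {X Y : Matrix (Fin L) (Fin L) ℂ}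
    (hY : ∀ m n, m < n → Y m n = 0) {m n : Fin L} (h : m ≤ n) :
    (strictLower X * Y) m n = 0 ∧ (Y * strictLower X) m n = 0 := by
  constructor
  · rw [Matrix.mul_apply]
    refine Finset.sum_eq_zero fun p _ => ?_
    rcases lt_or_ge p m with hp | hp
    · rw [hY p n (lt_of_lt_of_le hp h), mul_zero]
    · rw [strictLower_apply, if_neg hp.not_gt, zero_mul]
  · rw [Matrix.mul_apply]
    refine Finset.sum_eq_zero fun p _ => ?_
    rcases lt_or_ge m p with hp | hp
    · rw [hY m p hp, zero_mul]
    · rw [strictLower_apply, if_neg (hp.trans h).not_gt, mul_zero]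

/-- Each pole term occurs once in the equation for A_l and once, with opposite sign, in that for
A_j. In the sum they cancel, leaving the equation of Lax type for A_{N+2} and B_j(∞). -/
theorem sum_residueDefect (h : IsAdmissible L d θ T f g) (hT : IsOpen T)
    (hT0 : ∀ t ∈ T, ∀ i, t i ≠ 0) {t : Fin (N + 1) → ℂ} (ht : t ∈ T) (j : Fin (N + 1)) :
    ∑ l, residueDefect L d θ f g t j l = - (mpdU L j (resInfty L d f g) t -
      (coeffBInfty L θ f g j t * resInfty L d f g t
        - resInfty L d f g t * coeffBInfty L θ f g j t)) := by
  have e1 : ∀ l ∈ Finset.univ.erase j.castSucc, residueDefect L d θ f g t j l =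
      (mpdU L j (residues L d f g l) t -
        (coeffBInfty L θ f g j t * residues L d f g l t
          - residues L d f g l t * coeffBInfty L θ f g j t)) -
      (1 / (sing L t j.castSucc - sing L t l)) •
        (residues L d f g j.castSucc t * residues L d f g l t
          - residues L d f g l t * residues L d f g j.castSucc t) := by
    intro l hl
    rw [residueDefect, if_neg (Finset.ne_of_mem_erase hl), ← neg_sub (sing L t j.castSucc),
      one_div_neg_eq_neg_one_div, neg_smul, ← smul_neg, neg_sub]
    abel
  have e2 : mpdU L j (resInfty L d f g) t = - ∑ l, mpdU L j (residues L d f g l) t := by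
    rw [show resInfty L d f g = fun s => - ∑ l, residues L d f g l s from rfl, mpdU_neg,
      mpdU_sum j fun l _ => mdiff_residues h hT hT0 ht l]
  rw [← Finset.add_sum_erase _ _ (Finset.mem_univ j.castSucc), Finset.sum_congr rfl e1,
    Finset.sum_sub_distrib, residueDefect, if_pos rfl, e2]
  have e3 : (mpdU L j (residues L d f g j.castSucc) t -
        (coeffBInfty L θ f g j t * residues L d f g j.castSucc t
          - residues L d f g j.castSucc t * coeffBInfty L θ f g j t)) +
      ∑ l ∈ Finset.univ.erase j.castSucc, (mpdU L j (residues L d f g l) t -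
        (coeffBInfty L θ f g j t * residues L d f g l t
          - residues L d f g l t * coeffBInfty L θ f g j t)) =
      ∑ l, mpdU L j (residues L d f g l) t -
        (coeffBInfty L θ f g j t * ∑ l, residues L d f g l t
          - (∑ l, residues L d f g l t) * coeffBInfty L θ f g j t) := by
    rw [Finset.add_sum_erase Finset.univ (fun l => mpdU L j (residues L d f g l) t -
        (coeffBInfty L θ f g j t * residues L d f g l t
          - residues L d f g l t * coeffBInfty L θ f g j t)) (Finset.mem_univ j.castSucc),
      Finset.sum_sub_distrib, Finset.sum_sub_distrib, Finset.mul_sum, Finset.sum_mul]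
  have e4 : resInfty L d f g t = - ∑ l, residues L d f g l t := rfl
  rw [e4, mul_neg, neg_mul]
  have e5 : - (-∑ l, mpdU L j (residues L d f g l) t -
      (-(coeffBInfty L θ f g j t * ∑ l, residues L d f g l t) -
        -((∑ l, residues L d f g l t) * coeffBInfty L θ f g j t))) =
      ∑ l, mpdU L j (residues L d f g l) t -
        (coeffBInfty L θ f g j t * ∑ l, residues L d f g l t
          - (∑ l, residues L d f g l t) * coeffBInfty L θ f g j t) := by abel
  rw [e5, ← e3]
  abel

/-- The residue at `z = 0` is compatible as soon as the others are. -/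
theorem residueDefect_last_eq_zero (h : IsAdmissible L d θ T f g) (hT : IsOpen T)
    (hT0 : ∀ t ∈ T, ∀ i, t i ≠ 0) {t : Fin (N + 1) → ℂ} (ht : t ∈ T) (j : Fin (N + 1))
    (hdef : ∀ i : Fin (N + 1), residueDefect L d θ f g t j i.castSucc = 0) :
    residueDefect L d θ f g t j (Fin.last (N + 1)) = 0 := by
  have hu : t j ^ L ≠ 0 := pow_ne_zero L (hT0 t ht j)
  have hsum := sum_residueDefect h hT hT0 (d := d) (θ := θ) ht j
  rw [Fin.sum_univ_castSucc, Finset.sum_eq_zero fun i _ => hdef i, zero_add] at hsum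
  ext m n
  -- Strictly below the diagonal, 1/(0 - u_j) = -t_j^L turns the gauge term and the pole term into
  -- commutators of upper triangular matrices. On and above it the summed identity applies: A_{N+2}
  -- is lower triangular with constant diagonal, and B_j(∞) is scalar plus strictly lower.
  rcases lt_or_ge n m with hmn | hmn
  · have e : residueDefect L d θ f g t j (Fin.last (N + 1)) =
        mpdU L j (residues L d f g (Fin.last (N + 1))) t +
          (t j ^ L) • (resZero L d f g t * (resA L f g j t - strictLower (resA L f g j t))
            - (resA L f g j t - strictLower (resA L f g j t)) * resZero L d f g t) := by
      rw [residueDefect, if_neg (Fin.castSucc_lt_last j).ne']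
      simp only [residues_last, residues_castSucc, sing_last, sing_castSucc]
      rw [coeffBInfty_eq θ f g j (hT0 t ht j), zero_sub, one_div, inv_neg, inv_inv]
      simp only [add_mul, mul_add, Matrix.smul_mul, Matrix.mul_smul, one_mul, mul_one, neg_mul,
        mul_neg, smul_sub, neg_smul, mul_sub, sub_mul]
      abel
    have hZ : ∀ m n : Fin L, n < m → resZero L d f g t m n = 0 := fun m n hmn => by
      simp [resZero, hmn.ne', hmn.not_gt]
    have hA := fun m n => sub_strictLower_apply (L := L) (resA L f g j t) (m := m) (n := n)
    rw [e, Matrix.add_apply, Matrix.smul_apply, Matrix.sub_apply,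
      mul_apply_eq_zero_of_upper hZ hA hmn, mul_apply_eq_zero_of_upper hA hZ hmn, mpdU,
      Matrix.of_apply]
    have : (fun s => residues L d f g (Fin.last (N + 1)) s m n) = fun _ => 0 := by
      funext s
      simp [resZero, hmn.ne', hmn.not_gt]
    rw [this]
    simp [pdU]
  · rw [hsum, coeffBInfty_eq θ f g j (hT0 t ht j)]
    have hI := mul_apply_eq_zero_of_strictLower (X := resA L f g j t)
      (fun m n hmn => resInfty_apply_of_lt (d := d) (f := f) (g := g) t hmn) hmn
    have e : mpdU L j (resInfty L d f g) t m n = 0 := by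
      rw [mpdU, Matrix.of_apply, pdU]
      rcases hmn.lt_or_eq with hmn | rfl
      · rw [pd_congr_of_eqOn (G := fun _ => 0) hT ht j
          fun s _ => resInfty_apply_of_lt (d := d) (f := f) (g := g) s hmn, pd_const, zero_div]
      · rw [pd_congr_of_eqOn (G := fun _ => kappaBar L d θ m - expZero L d m) hT ht j
          fun s hs => resInfty_apply_self h hs (hT0 s hs) m, pd_const, zero_div]
    simp only [add_mul, mul_add, Matrix.smul_mul, Matrix.mul_smul, one_mul, mul_one, neg_mul,
      mul_neg, Matrix.neg_apply, Matrix.sub_apply, Matrix.add_apply, Matrix.smul_apply, e, hI.1,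
      hI.2, Matrix.zero_apply]
    simp

/-! ### Equivalence of the flow and the residue equations -/

theorem solvesResidue_of_flow (hL : L ≠ 0) (hd : IsDegreeArray L d)
    (h : IsAdmissible L d θ T f g) (hT : IsOpen T)
    (hT0 : ∀ t ∈ T, ∀ i, t i ≠ 0) (hTd : ∀ t ∈ T, ∀ i j, i ≠ j → t i ^ L ≠ t j ^ L)
    (hF : SolvesFlow L d θ T f g) : SolvesResidue L d θ T f g := by
  rw [solvesResidue_iff_defect]
  intro t ht j l
  have hc := fun i => residueDefect_castSucc_eq_zero hL hd h hT hT0 hTd hF ht i j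
  induction l using Fin.lastCases with
  | cast i => exact hc i
  | last => exact residueDefect_last_eq_zero h hT hT0 ht j hc

/-- Vanishing residues prescribe the derivative of each entry g_m c_n / c_m along t_j ∂/∂t_j for j ≠
i and along the Euler field; from these f and g are recovered. If all g^{(i)}_m were zero, A_i would
vanish and say nothing about f^{(i)}, hence the condition on θ. -/
theorem flow_of_solvesResidue (hL : L ≠ 0) (hd : IsDegreeArray L d)
    (h : IsAdmissible L d θ T f g) (hT : IsOpen T)
    (hT0 : ∀ t ∈ T, ∀ i, t i ≠ 0) (hTd : ∀ t ∈ T, ∀ i j, i ≠ j → t i ^ L ≠ t j ^ L)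
    (hθ : ∀ i, θ i ≠ 0) (hres : SolvesResidue L d θ T f g) : SolvesFlow L d θ T f g := by
  rw [solvesResidue_iff_defect] at hres
  have hL' : (L : ℂ) ≠ 0 := by exact_mod_cast hL
  have hfp : ∀ t ∈ T, ∀ i n v, fderiv ℂ (f i (n + L)) t v = fderiv ℂ (f i n) t v :=
    fun t ht i n v => fderiv_congr_of_eqOn v hT ht fun s hs => h.periodic_f i n s hs
  have hgp : ∀ t ∈ T, ∀ i n v, fderiv ℂ (g i (n + L)) t v = fderiv ℂ (g i n) t v :=
    fun t ht i n v => fderiv_congr_of_eqOn v hT ht fun s hs => h.periodic_g i n s hs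
  -- The matrix entries give g at the indices 0, …, L-1 but f at 1, …, L, so the two need different
  -- forms of the periodic extension.
  have extend_g : ∀ {P : ℤ → Prop}, (∀ n, P (n + L) ↔ P n) → (∀ m : ℕ, m < L → P m) → ∀ n, P n := by
    intro P hP h1
    refine forall_int_of_period hL hP fun k hk => ?_
    rcases Nat.lt_or_ge (k + 1) L with hk1 | hk1
    · exact_mod_cast h1 (k + 1) hk1
    · have : (k : ℤ) + 1 = 0 + L := by omega
      rw [this, hP]
      exact_mod_cast h1 0 (by omega)
  have key1 : ∀ t ∈ T, ∀ i j, i ≠ j →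
      (∀ m : ℕ, m < L → fderiv ℂ (g i (m : ℤ)) t (Pi.single j (t j)) =
        g j m t * (auxU L f g i j m t + g i m t) + g i (m : ℤ) t * auxU L f g j i m t) ∧
      (∀ n : ℕ, n < L → fderiv ℂ (fun s => s i * f i ((n : ℤ) + 1) s) t (Pi.single j (t j)) =
        (auxU L f g j i ((n : ℤ) + 1) t - auxU L f g j i n t) * (t i * f i ((n : ℤ) + 1) t)) := by
    intro t ht i j hij
    refine fderiv_of_fderiv_resEntry h hT hT0 ht (hθ i) hL _ (fun n => auxU L f g j i n t)
      (fun m => g j m t * (auxU L f g i j m t + g i m t)) ?_ ?_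
    · have := auxU_period h ht j i 0
      rw [zero_add] at this
      rw [this, Pi.single_eq_of_ne hij]
      ring
    · intro m n hm hn
      have e := residueDefect_of_ne_apply hL h hT hT0 hTd ht hij ⟨m, hm⟩ ⟨n, hn⟩
      rw [hres t ht j i.castSucc, Matrix.zero_apply,
        mul_pd_eq_fderiv j (differentiableAt_resEntry h hT hT0 ht i m n)] at e
      have e2 := (mul_eq_zero.mp e.symm).resolve_left
        (div_ne_zero (pow_ne_zero L (hT0 t ht j)) (pow_ne_zero 2 hL'))
      linear_combination e2
  have key2 : ∀ t ∈ T, ∀ i,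
      (∀ m : ℕ, m < L → fderiv ℂ (g i (m : ℤ)) t t =
        - (g i m t * weight d m) + g i (m : ℤ) t * weight d m) ∧
      (∀ n : ℕ, n < L → fderiv ℂ (fun s => s i * f i ((n : ℤ) + 1) s) t t =
        (weight d ((n : ℤ) + 1) - weight d n) * (t i * f i ((n : ℤ) + 1) t)) := by
    intro t ht i
    refine fderiv_of_fderiv_resEntry h hT hT0 ht (hθ i) hL _ (weight d)
      (fun m => - (g i m t * weight d m)) ?_ ?_
    · have := weight_period hd 0
      rw [zero_add] at this
      rw [this]
      ring
    · intro m n hm hn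
      have e := sum_smul_residueDefect_apply hL h hT hT0 hTd ht i ⟨m, hm⟩ ⟨n, hn⟩
      rw [Finset.sum_eq_zero fun j _ => by rw [hres t ht j i.castSucc, smul_zero],
        Matrix.zero_apply, sum_mul_pd_eq_fderiv (differentiableAt_resEntry h hT hT0 ht i m n)] at e
      have e2 := (mul_eq_zero.mp e.symm).resolve_left
        (one_div_ne_zero (pow_ne_zero 2 hL'))
      rw [sub_eq_zero.mp e2, resEntry]
      ring
  refine ⟨fun t ht i j hij => ?_, fun t ht i j hij => ?_, fun t ht i => ?_, fun t ht i => ?_⟩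
  · simp only [mul_pd_eq_fderiv j (h.differentiableAt_f hT ht i _)]
    refine forall_int_of_period hL (fun n => ?_) fun k hk => ?_
    · rw [hfp t ht, show n + (L : ℤ) - 1 = n - 1 + L by ring, auxU_period h ht, auxU_period h ht,
        h.periodic_f i n t ht]
    · have e := (key1 t ht i j hij).2 k hk
      rw [pd_coord_mul_of_ne h hT ht, Pi.single_eq_of_ne hij] at e
      refine mul_left_cancel₀ (hT0 t ht i) ?_
      rw [add_sub_cancel_right]
      linear_combination e
  · simp only [mul_pd_eq_fderiv j (h.differentiableAt_g hT ht i _)]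
    refine extend_g (fun n => ?_) fun m hm => ?_
    · rw [hgp t ht, auxU_period h ht, auxU_period h ht, h.periodic_g i n t ht,
        h.periodic_g j n t ht]
    · rw [(key1 t ht i j hij).1 m hm]
      ring
  · simp only [sum_mul_pd_eq_fderiv (h.differentiableAt_f hT ht i _)]
    have hw : ∀ n, kappa d θ n (1 - n) - kappa d θ n (-n) = weight d n - weight d (n - 1) - 1 :=
      fun n => by rw [weight_sub hd θ]; ring
    simp only [hw]
    refine forall_int_of_period hL (fun n => ?_) fun k hk => ?_
    · rw [hfp t ht, show n + (L : ℤ) - 1 = n - 1 + L by ring, weight_period hd, weight_period hd,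
        h.periodic_f i n t ht, add_sub_add_right_eq_sub]
    · have e := (key2 t ht i).2 k hk
      rw [pd_coord_mul_of_ne h hT ht] at e
      refine mul_left_cancel₀ (hT0 t ht i) ?_
      rw [add_sub_cancel_right]
      linear_combination e
  · simp only [sum_mul_pd_eq_fderiv (h.differentiableAt_g hT ht i _)]
    refine extend_g (fun n => ?_) fun m hm => ?_
    · rw [hgp t ht]
    · rw [(key2 t ht i).1 m hm]
      ring

end

section

variable {N : ℕ}

/-! ### The substitution of power sums -/

/-- The space of absolutely summable sequences. -/
abbrev Seq1 : Type := lp (fun _ : ℕ+ => ℂ) 1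

/-- The unit vectors of `Seq1`. -/
def unitSeq (n : ℕ+) : Seq1 := lp.single 1 n (1 : ℂ)

theorem norm_unitSeq (n : ℕ+) : ‖unitSeq n‖ = 1 := by
  rw [unitSeq, lp.norm_single one_pos]; simp

theorem unitSeq_apply (n m : ℕ+) : (unitSeq n : ℕ+ → ℂ) m = if m = n then 1 else 0 := by
  rw [unitSeq, lp.coeFn_single, Pi.single_apply]

/-- Coordinates as continuous linear forms. -/
def coordSeq (m : ℕ+) : Seq1 →L[ℂ] ℂ :=
  LinearMap.mkContinuous
    { toFun := fun a => a m
      map_add' := fun a b => by simp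
      map_smul' := fun c a => by simp } 1 fun a => by
    rw [one_mul]
    exact lp.norm_apply_le_norm one_ne_zero a m

@[simp]
theorem coordSeq_apply (m : ℕ+) (a : Seq1) : coordSeq m a = a m := rfl

theorem summable_pnat_geometric {r : ℝ} (h0 : 0 ≤ r) (h1 : r < 1) :
    Summable fun n : ℕ+ => r ^ ((n : ℕ) - 1) := by
  have h : Summable fun n : ℕ => r ^ n := summable_geometric_of_lt_one h0 h1
  have := Equiv.pnatEquivNat.summable_iff.mpr h
  exact this

/-- The sequence `(qⁿ / n)`. -/
def logSeq (q : ℂ) : Seq1 := ∑' n : ℕ+, (q ^ (n : ℕ) / ((n : ℕ) : ℂ)) • unitSeq n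

/-- The sequence `(qⁿ)`. -/
def geomSeq (q : ℂ) : Seq1 := ∑' n : ℕ+, q ^ (n : ℕ) • unitSeq n

theorem norm_pow_le_pow_pred {q : ℂ} {r : ℝ} (hq : ‖q‖ ≤ r) (h1 : r ≤ 1) (n : ℕ+) :
    ‖q‖ ^ (n : ℕ) ≤ r ^ ((n : ℕ) - 1) := by
  have h0 : 0 ≤ r := (norm_nonneg q).trans hq
  refine (pow_le_pow_left₀ (norm_nonneg q) hq _).trans (pow_le_pow_of_le_one h0 h1 (Nat.sub_le _ _))

theorem hasSum_geomSeq {q : ℂ} (hq : ‖q‖ < 1) :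
    HasSum (fun n : ℕ+ => q ^ (n : ℕ) • unitSeq n) (geomSeq q) := by
  refine (Summable.of_norm_bounded (summable_pnat_geometric (norm_nonneg q) hq) fun n => ?_).hasSum
  rw [norm_smul, norm_unitSeq, mul_one, norm_pow]
  exact norm_pow_le_pow_pred le_rfl hq.le n

theorem hasSum_logSeq {q : ℂ} (hq : ‖q‖ < 1) :
    HasSum (fun n : ℕ+ => (q ^ (n : ℕ) / ((n : ℕ) : ℂ)) • unitSeq n) (logSeq q) := by
  refine (Summable.of_norm_bounded (summable_pnat_geometric (norm_nonneg q) hq) fun n => ?_).hasSum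
  rw [norm_smul, norm_unitSeq, mul_one, norm_div, norm_pow, Complex.norm_natCast]
  refine (div_le_self (by positivity) ?_).trans (norm_pow_le_pow_pred le_rfl hq.le n)
  exact_mod_cast n.2

theorem logSeq_apply {q : ℂ} (hq : ‖q‖ < 1) (m : ℕ+) :
    (logSeq q : ℕ+ → ℂ) m = q ^ (m : ℕ) / ((m : ℕ) : ℂ) := by
  have h := (coordSeq m).hasSum (hasSum_logSeq hq)
  refine h.unique ?_
  convert hasSum_single m fun n hn => ?_ using 1
  · simp [unitSeq_apply]
  · simp [unitSeq_apply, hn.symm]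

/-- Termwise differentiation on a disc of radius r with |q| < r < 1, where the derived series is
dominated by ∑ r^{n-1}. -/
theorem hasDerivAt_logSeq {q : ℂ} (hq : ‖q‖ < 1) :
    HasDerivAt logSeq (∑' n : ℕ+, q ^ ((n : ℕ) - 1) • unitSeq n) q := by
  obtain ⟨r, hqr, hr⟩ := exists_between hq
  have hr0 : 0 < r := (norm_nonneg q).trans_lt hqr
  refine hasDerivAt_tsum_of_isPreconnected (t := Metric.ball (0 : ℂ) r) (y₀ := 0)
    (g := fun (n : ℕ+) q => (q ^ (n : ℕ) / ((n : ℕ) : ℂ)) • unitSeq n)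
    (g' := fun (n : ℕ+) q => q ^ ((n : ℕ) - 1) • unitSeq n)
    (summable_pnat_geometric hr0.le hr) Metric.isOpen_ball
    (convex_ball (0 : ℂ) r).isPreconnected ?_ ?_ (by simpa using hr0) ?_ (by simpa using hqr)
  · intro n y _
    have hn : (((n : ℕ) : ℂ)) ≠ 0 := by exact_mod_cast n.ne_zero
    have h := ((hasDerivAt_pow (n : ℕ) y).div_const ((n : ℕ) : ℂ)).smul_const (unitSeq n)
    rwa [mul_div_cancel_left₀ _ hn] at h
  · intro n y hy
    rw [norm_smul, norm_unitSeq, mul_one, norm_pow]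
    exact pow_le_pow_left₀ (norm_nonneg y) (mem_ball_zero_iff.mp hy).le _
  · exact (hasSum_logSeq (by simp)).summable

theorem smul_tsum_pow_pred {q : ℂ} (hq : ‖q‖ < 1) :
    q • ∑' n : ℕ+, q ^ ((n : ℕ) - 1) • unitSeq n = geomSeq q := by
  have hs : Summable fun n : ℕ+ => q ^ ((n : ℕ) - 1) • unitSeq n := by
    refine Summable.of_norm_bounded (summable_pnat_geometric (norm_nonneg q) hq) fun n => ?_
    rw [norm_smul, norm_unitSeq, mul_one, norm_pow]
  rw [← hs.tsum_const_smul, geomSeq]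
  refine tsum_congr fun n => ?_
  rw [smul_smul, ← pow_succ', Nat.sub_add_cancel (show 1 ≤ (n : ℕ) from n.pos)]

/-- A lift of `powerSum` to the Banach space of pairs of summable sequences. -/
def liftPowerSum (R : ℝ) (θ t : Fin (N + 1) → ℂ) : Seq1 × Seq1 :=
  (∑ i, θ i • logSeq (t i / R), ∑ i, θ i • logSeq ((t i)⁻¹ / R))

/-- A radius that dominates all `tᵢ` and `tᵢ⁻¹`. -/
structure IsRadius (R : ℝ) (t : Fin (N + 1) → ℂ) : Prop where
  pos : 0 < R
  left : ∀ i, ‖t i / R‖ < 1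
  right : ∀ i, ‖(t i)⁻¹ / R‖ < 1

theorem exists_isRadius (t : Fin (N + 1) → ℂ) : ∃ R : ℝ, IsRadius R t := by
  set R : ℝ := 1 + ∑ i, (‖t i‖ + ‖(t i)⁻¹‖) with hR
  have hi : ∀ i, ‖t i‖ + ‖(t i)⁻¹‖ < R := fun i => by
    have := Finset.single_le_sum (f := fun i => ‖t i‖ + ‖(t i)⁻¹‖) (s := Finset.univ)
      (fun i _ => by positivity) (Finset.mem_univ i)
    rw [hR]; linarith
  have hpos : 0 < R := by
    have := hi 0
    have := norm_nonneg (t 0)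
    have := norm_nonneg (t 0)⁻¹
    linarith
  refine ⟨R, hpos, fun i => ?_, fun i => ?_⟩
  · rw [norm_div, Complex.norm_real, Real.norm_of_nonneg hpos.le, div_lt_one hpos]
    linarith [hi i, norm_nonneg (t i)⁻¹]
  · rw [norm_div, Complex.norm_real, Real.norm_of_nonneg hpos.le, div_lt_one hpos]
    linarith [hi i, norm_nonneg (t i)]

theorem IsRadius.ne_zero {R : ℝ} {t : Fin (N + 1) → ℂ} (h : IsRadius R t) : (R : ℂ) ≠ 0 := by
  exact_mod_cast h.pos.ne'

theorem IsRadius.eventually {R : ℝ} {t : Fin (N + 1) → ℂ} (h : IsRadius R t)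
    (h0 : ∀ i, t i ≠ 0) : ∀ᶠ s in nhds t, IsRadius R s := by
  have h1 : ∀ i, ∀ᶠ s : Fin (N + 1) → ℂ in nhds t, ‖s i / R‖ < 1 := fun i => by
    have hc : ContinuousAt (fun s : Fin (N + 1) → ℂ => ‖s i / R‖) t :=
      ((continuous_apply i).continuousAt.div_const _).norm
    exact hc.eventually_lt continuousAt_const (h.left i)
  have h2 : ∀ i, ∀ᶠ s : Fin (N + 1) → ℂ in nhds t, ‖(s i)⁻¹ / R‖ < 1 := fun i => by
    have hc : ContinuousAt (fun s : Fin (N + 1) → ℂ => ‖(s i)⁻¹ / R‖) t :=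
      (((continuous_apply i).continuousAt.inv₀ (h0 i)).div_const _).norm
    exact hc.eventually_lt continuousAt_const (h.right i)
  filter_upwards [Filter.eventually_all.mpr h1, Filter.eventually_all.mpr h2] with s a b
  exact ⟨h.pos, a, b⟩

/-- The weights R^n undo the division of t_i and t_i⁻¹ by R. The substitution thus factors through a
Banach space on which holomorphy on Ω is ordinary differentiability. -/
theorem weighted_liftPowerSum {R : ℝ} {t : Fin (N + 1) → ℂ} (h : IsRadius R t)
    (θ : Fin (N + 1) → ℂ) : weighted R (liftPowerSum R θ t) = powerSum θ t := by
  have hR := h.ne_zero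
  have key : ∀ (s : Fin (N + 1) → ℂ), (∀ i, ‖s i / R‖ < 1) → ∀ n : ℕ+,
      (R : ℂ) ^ (n : ℕ) * ((∑ i, θ i • logSeq (s i / R) : Seq1) : ℕ+ → ℂ) n =
        (1 / ((n : ℕ) : ℂ)) * ∑ i, θ i * s i ^ (n : ℕ) := by
    intro s hs n
    rw [← coordSeq_apply, map_sum, Finset.mul_sum, Finset.mul_sum]
    refine Finset.sum_congr rfl fun i _ => ?_
    rw [map_smul, coordSeq_apply, logSeq_apply (hs i), div_pow, smul_eq_mul]
    field_simp
  refine Prod.ext (funext fun n => key t h.left n) (funext fun n => ?_)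
  exact key (fun i => (t i)⁻¹) h.right n

theorem differentiableAt_liftPowerSum {R : ℝ} {t : Fin (N + 1) → ℂ} (h : IsRadius R t)
    (h0 : ∀ i, t i ≠ 0) (θ : Fin (N + 1) → ℂ) : DifferentiableAt ℂ (liftPowerSum R θ) t := by
  have h1 : ∀ i, DifferentiableAt ℂ (fun s : Fin (N + 1) → ℂ => s i / (R : ℂ)) t := fun i => by
    simp only [div_eq_mul_inv]
    exact (differentiableAt_coord i t).mul_const _
  have h2 : ∀ i, DifferentiableAt ℂ (fun s : Fin (N + 1) → ℂ => (s i)⁻¹ / (R : ℂ)) t :=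
    fun i => by
      simp only [div_eq_mul_inv]
      exact ((differentiableAt_coord i t).fun_inv (h0 i)).mul_const _
  refine DifferentiableAt.prodMk ?_ ?_ <;>
    refine DifferentiableAt.fun_sum fun i _ => DifferentiableAt.const_smul ?_ (θ i)
  · exact (hasDerivAt_logSeq (h.left i)).differentiableAt.comp t (h1 i)
  · exact (hasDerivAt_logSeq (h.right i)).differentiableAt.comp t (h2 i)

/-- The operator t ∂/∂t maps t^n/n to t^n and t^{-n}/n to -t^{-n}. The resulting vector is δ_{t_i}
in the rescaled coordinates. -/
theorem mul_fderiv_liftPowerSum {R : ℝ} {t : Fin (N + 1) → ℂ} (h : IsRadius R t)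
    (h0 : ∀ i, t i ≠ 0) (θ : Fin (N + 1) → ℂ) (i : Fin (N + 1)) :
    t i • fderiv ℂ (liftPowerSum R θ) t (Pi.single i 1) =
      θ i • (geomSeq (t i / R), - geomSeq ((t i)⁻¹ / R)) := by
  have hR := h.ne_zero
  have hc : HasDerivAt (fun s => liftPowerSum R θ (Function.update t i s))
      (fderiv ℂ (liftPowerSum R θ) t (Pi.single i 1)) (t i) := by
    have h2 : HasFDerivAt (liftPowerSum R θ) (fderiv ℂ (liftPowerSum R θ) t)
        (Function.update t i (t i)) := by
      simpa using (differentiableAt_liftPowerSum h h0 θ).hasFDerivAt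
    exact h2.comp_hasDerivAt (t i) (hasDerivAt_update t i (t i))
  have e : ∀ (w : ℂ → ℂ), (fun s => ∑ j, θ j • logSeq (w (Function.update t i s j))) =
      fun s => θ i • logSeq (w s) +
        ∑ j ∈ Finset.univ.erase i, θ j • logSeq (w (t j)) := by
    intro w
    funext s
    rw [← Finset.add_sum_erase _ _ (Finset.mem_univ i), Function.update_self]
    congr 1
    refine Finset.sum_congr rfl fun j hj => ?_
    rw [Function.update_of_ne (Finset.ne_of_mem_erase hj)]
  have d1 : HasDerivAt (fun s => ∑ j, θ j • logSeq (Function.update t i s j / R))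
      (θ i • (1 / (R : ℂ)) • ∑' n : ℕ+, (t i / R) ^ ((n : ℕ) - 1) • unitSeq n) (t i) := by
    rw [e fun s => s / R]
    refine HasDerivAt.add_const _ (HasDerivAt.const_smul (θ i) ?_)
    have hw : HasDerivAt (fun s : ℂ => s / R) (1 / (R : ℂ)) (t i) := (hasDerivAt_id _).div_const _
    exact (hasDerivAt_logSeq (h.left i)).scomp (t i) hw
  have d2 : HasDerivAt (fun s => ∑ j, θ j • logSeq ((Function.update t i s j)⁻¹ / R))
      (θ i • (- (t i ^ 2)⁻¹ / (R : ℂ)) •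
        ∑' n : ℕ+, ((t i)⁻¹ / R) ^ ((n : ℕ) - 1) • unitSeq n) (t i) := by
    rw [e fun s => s⁻¹ / R]
    refine HasDerivAt.add_const _ (HasDerivAt.const_smul (θ i) ?_)
    have hw : HasDerivAt (fun s : ℂ => s⁻¹ / R) (- (t i ^ 2)⁻¹ / (R : ℂ)) (t i) :=
      (hasDerivAt_inv (h0 i)).div_const _
    exact (hasDerivAt_logSeq (h.right i)).scomp (t i) hw
  rw [hc.unique (d1.prodMk d2), Prod.smul_mk, Prod.smul_mk, ← smul_tsum_pow_pred (h.left i),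
    ← smul_tsum_pow_pred (h.right i)]
  have hi := h0 i
  refine Prod.ext ?_ ?_
  · simp only [smul_smul]; congr 1; ring
  · simp only [smul_smul, ← neg_smul]; congr 1; field_simp

section
variable {Ω : Set Pt} {F : Pt → ℂ}

/-! ### Derivatives in the infinitely many variables -/

theorem add_smul_unitSeq_apply (a : Seq1) (c : ℂ) (n m : ℕ+) :
    ((a + c • unitSeq n : Seq1) : ℕ+ → ℂ) m = a m + if m = n then c else 0 := by
  rw [← coordSeq_apply, map_add, map_smul, coordSeq_apply, coordSeq_apply, unitSeq_apply]
  simp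

theorem pow_mul_add_smul_unitSeq {R : ℝ} (hR : (R : ℂ) ≠ 0) (a : Seq1) (n : ℕ+) (s : ℂ) :
    (fun m : ℕ+ => (R : ℂ) ^ (m : ℕ) * ((a + ((s - (R : ℂ) ^ (n : ℕ) * a n) / (R : ℂ) ^ (n : ℕ)) •
      unitSeq n : Seq1) : ℕ+ → ℂ) m) =
      Function.update (fun m : ℕ+ => (R : ℂ) ^ (m : ℕ) * a m) n s := by
  funext m
  rw [add_smul_unitSeq_apply]
  by_cases hm : m = n
  · subst hm
    rw [if_pos rfl, Function.update_self, mul_add, mul_div_cancel₀ _ (pow_ne_zero _ hR)]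
    ring
  · rw [if_neg hm, Function.update_of_ne hm, add_zero]

/-- Changing one coordinate of `weighted R a` amounts to moving a along a unit vector. Coordinate
derivatives thereby become values of the Fréchet derivative. -/
theorem weighted_add_smul_left {R : ℝ} (hR : (R : ℂ) ≠ 0) (a : Seq1 × Seq1) (n : ℕ+) (s : ℂ) :
    weighted R (a + ((s - (weighted R a).1 n) / (R : ℂ) ^ (n : ℕ)) • (unitSeq n, 0)) =
      (Function.update (weighted R a).1 n s, (weighted R a).2) := by
  refine Prod.ext (pow_mul_add_smul_unitSeq hR a.1 n s) ?_
  simp [weighted]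

theorem weighted_add_smul_right {R : ℝ} (hR : (R : ℂ) ≠ 0) (a : Seq1 × Seq1) (n : ℕ+) (s : ℂ) :
    weighted R (a + ((s - (weighted R a).2 n) / (R : ℂ) ^ (n : ℕ)) • (0, unitSeq n)) =
      ((weighted R a).1, Function.update (weighted R a).2 n s) := by
  refine Prod.ext ?_ (pow_mul_add_smul_unitSeq hR a.2 n s)
  simp [weighted]

theorem hasDerivAt_comp_line {E : Type*} [NormedAddCommGroup E] [NormedSpace ℂ E] {G : E → ℂ}
    {a : E} (hG : DifferentiableAt ℂ G a) (v : E) (c b : ℂ) :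
    HasDerivAt (fun s => G (a + ((s - c) / b) • v)) (b⁻¹ * fderiv ℂ G a v) c := by
  have h1 : HasDerivAt (fun s : ℂ => a + ((s - c) / b) • v) (b⁻¹ • v) c := by
    have := ((((hasDerivAt_id c).sub_const c).div_const b).smul_const v).const_add a
    simpa using this
  have h2 : HasFDerivAt G (fderiv ℂ G a) (a + ((c - c) / b) • v) := by
    simpa using hG.hasFDerivAt
  have := h2.comp_hasDerivAt c h1
  rwa [map_smul, smul_eq_mul] at this

theorem partialX_weighted {R : ℝ} (hR : (R : ℂ) ≠ 0) {a : Seq1 × Seq1}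
    (hF : DifferentiableAt ℂ (fun a => F (weighted R a)) a) (n : ℕ+) :
    partialX n F (weighted R a) =
      ((R : ℂ) ^ (n : ℕ))⁻¹ * fderiv ℂ (fun a => F (weighted R a)) a (unitSeq n, 0) := by
  have h := hasDerivAt_comp_line hF (unitSeq n, 0) ((weighted R a).1 n) ((R : ℂ) ^ (n : ℕ))
  simp only [weighted_add_smul_left hR] at h
  exact h.deriv

theorem partialY_weighted {R : ℝ} (hR : (R : ℂ) ≠ 0) {a : Seq1 × Seq1}
    (hF : DifferentiableAt ℂ (fun a => F (weighted R a)) a) (n : ℕ+) :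
    partialY n F (weighted R a) =
      ((R : ℂ) ^ (n : ℕ))⁻¹ * fderiv ℂ (fun a => F (weighted R a)) a (0, unitSeq n) := by
  have h := hasDerivAt_comp_line hF (0, unitSeq n) ((weighted R a).2 n) ((R : ℂ) ^ (n : ℕ))
  simp only [weighted_add_smul_right hR] at h
  exact h.deriv

/-- The Fréchet derivative is continuous, so it may be applied term by term to the convergent series
`geomSeq`; the powers of R cancel. In particular the series defining δ_q converges. -/
theorem hasSum_delta {R : ℝ} (hR : (R : ℂ) ≠ 0) {a : Seq1 × Seq1}
    (hF : DifferentiableAt ℂ (fun a => F (weighted R a)) a) {q : ℂ}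
    (h1 : ‖q / R‖ < 1) (h2 : ‖q⁻¹ / R‖ < 1) :
    HasSum (fun n : ℕ+ => q ^ (n : ℕ) * partialX n F (weighted R a) -
        q⁻¹ ^ (n : ℕ) * partialY n F (weighted R a))
      (fderiv ℂ (fun a => F (weighted R a)) a (geomSeq (q / R), - geomSeq (q⁻¹ / R))) := by
  set ℓ := fderiv ℂ (fun a => F (weighted R a)) a
  have s1 := (ℓ.comp (ContinuousLinearMap.inl ℂ Seq1 Seq1)).hasSum (hasSum_geomSeq h1)
  have s2 := (ℓ.comp (ContinuousLinearMap.inr ℂ Seq1 Seq1)).hasSum (hasSum_geomSeq h2)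
  have e : ℓ (geomSeq (q / R), - geomSeq (q⁻¹ / R)) =
      (ℓ.comp (ContinuousLinearMap.inl ℂ Seq1 Seq1)) (geomSeq (q / R)) -
      (ℓ.comp (ContinuousLinearMap.inr ℂ Seq1 Seq1)) (geomSeq (q⁻¹ / R)) := by
    simp only [ContinuousLinearMap.comp_apply, ContinuousLinearMap.inl_apply,
      ContinuousLinearMap.inr_apply, ← map_sub]
    simp
  rw [e]
  refine Eq.subst (motive := fun f => HasSum f _) (funext fun n => ?_) (s1.sub s2)
  simp only [map_smul, ContinuousLinearMap.comp_apply,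
    ContinuousLinearMap.inl_apply, ContinuousLinearMap.inr_apply, smul_eq_mul]
  rw [partialX_weighted hR hF, partialY_weighted hR hF, div_pow, div_pow]
  ring

theorem differentiableAt_comp_weighted (hΩ : IsDomainOfTimes Ω) (hF : IsHolomorphicOn Ω F)
    {R : ℝ} (hR : 0 < R) {a : Seq1 × Seq1} (ha : weighted R a ∈ Ω) :
    DifferentiableAt ℂ (fun a => F (weighted R a)) a :=
  (hF R hR).differentiableAt ((hΩ.isOpen R hR).mem_nhds ha)

variable {θ t : Fin (N + 1) → ℂ}

theorem eventually_powerSum_eq {R : ℝ} (hR : IsRadius R t) (h0 : ∀ i, t i ≠ 0) :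
    (fun s => F (powerSum θ s)) =ᶠ[nhds t] fun s => F (weighted R (liftPowerSum R θ s)) :=
  (hR.eventually h0).mono fun s hs => by simp only [weighted_liftPowerSum hs]

theorem differentiableAt_powerSum (hΩ : IsDomainOfTimes Ω) (hF : IsHolomorphicOn Ω F)
    (h0 : ∀ i, t i ≠ 0) (hp : powerSum θ t ∈ Ω) :
    DifferentiableAt ℂ (fun s => F (powerSum θ s)) t := by
  obtain ⟨R, hR⟩ := exists_isRadius t
  rw [← weighted_liftPowerSum hR] at hp
  refine DifferentiableAt.congr_of_eventuallyEq ?_ (eventually_powerSum_eq hR h0)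
  exact (differentiableAt_comp_weighted hΩ hF hR.pos hp).comp t
    (differentiableAt_liftPowerSum hR h0 θ)

theorem mul_pd_powerSum (hΩ : IsDomainOfTimes Ω) (hF : IsHolomorphicOn Ω F)
    (h0 : ∀ i, t i ≠ 0) (hp : powerSum θ t ∈ Ω) (i : Fin (N + 1)) :
    t i * pd i (fun s => F (powerSum θ s)) t = θ i * delta (t i) F (powerSum θ t) := by
  obtain ⟨R, hR⟩ := exists_isRadius t
  rw [← weighted_liftPowerSum hR] at hp
  have hd := differentiableAt_comp_weighted hΩ hF hR.pos hp
  have hl := differentiableAt_liftPowerSum hR h0 θ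
  rw [pd_congr i (eventually_powerSum_eq hR h0), show (fun s => F (weighted R (liftPowerSum R θ s))) =
      (fun a => F (weighted R a)) ∘ liftPowerSum R θ from rfl, pd_eq_fderiv i (hd.comp t hl),
    fderiv_comp t hd hl, ContinuousLinearMap.comp_apply, ← smul_eq_mul, ← map_smul,
    mul_fderiv_liftPowerSum hR h0, map_smul, smul_eq_mul, delta, ← weighted_liftPowerSum hR,
    (hasSum_delta hR.ne_zero hd (hR.left i) (hR.right i)).tsum_eq]

/-- On power sums n x_n = ∑ θ_i t_i^n and n y_n = ∑ θ_i t_i^{-n}, so the coefficients of E are those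
of ∑ θ_i δ_{t_i}. Summability of each δ_{t_i} series permits the exchange of sums. -/
theorem euler_powerSum (hΩ : IsDomainOfTimes Ω) (hF : IsHolomorphicOn Ω F)
    (hp : powerSum θ t ∈ Ω) :
    euler F (powerSum θ t) = ∑ i, θ i * delta (t i) F (powerSum θ t) := by
  obtain ⟨R, hR⟩ := exists_isRadius t
  have hp' := hp
  rw [← weighted_liftPowerSum hR] at hp'
  have hd := differentiableAt_comp_weighted hΩ hF hR.pos hp'
  have hs := fun i => (hasSum_delta hR.ne_zero hd (hR.left i) (hR.right i)).summable
  rw [weighted_liftPowerSum hR] at hs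
  rw [euler]
  simp only [delta, ← tsum_mul_left]
  rw [← Summable.tsum_finsetSum fun i _ => (hs i).mul_left (θ i)]
  refine tsum_congr fun n => ?_
  have hn : (((n : ℕ) : ℂ)) ≠ 0 := by exact_mod_cast n.ne_zero
  simp only [powerSum, ← mul_assoc, mul_one_div_cancel hn, one_mul, Finset.sum_mul]
  rw [← Finset.sum_sub_distrib]
  exact Finset.sum_congr rfl fun i _ => by ring

theorem sum_mul_pd_powerSum (hΩ : IsDomainOfTimes Ω) (hF : IsHolomorphicOn Ω F)
    (h0 : ∀ i, t i ≠ 0) (hp : powerSum θ t ∈ Ω) :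
    ∑ i, t i * pd i (fun s => F (powerSum θ s)) t = euler F (powerSum θ t) := by
  rw [euler_powerSum hΩ hF hp]
  exact Finset.sum_congr rfl fun i _ => mul_pd_powerSum hΩ hF h0 hp i

theorem delta_translate (q : ℂ) (F : Pt → ℂ) (c p : Pt) :
    delta q (fun x => F (x - c)) p = delta q F (p - c) := by
  have hX : ∀ n, partialX n (fun x => F (x - c)) p = partialX n F (p - c) := fun n => by
    rw [partialX, partialX]
    have e : (fun s => F ((Function.update p.1 n s, p.2) - c)) =
        fun s => (fun u => F (Function.update (p - c).1 n u, (p - c).2)) (s - c.1 n) := by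
      funext s
      congr 1
      refine Prod.ext (funext fun m => ?_) rfl
      by_cases hm : m = n
      · subst hm; simp
      · simp [Function.update_of_ne hm]
    rw [e]
    exact deriv_comp_sub_const (f := fun u => F (Function.update (p - c).1 n u, (p - c).2)) _ _
  have hY : ∀ n, partialY n (fun x => F (x - c)) p = partialY n F (p - c) := fun n => by
    rw [partialY, partialY]
    have e : (fun s => F ((p.1, Function.update p.2 n s) - c)) =
        fun s => (fun u => F ((p - c).1, Function.update (p - c).2 n u)) (s - c.2 n) := by
      funext s
      congr 1
      refine Prod.ext rfl (funext fun m => ?_)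
      by_cases hm : m = n
      · subst hm; simp
      · simp [Function.update_of_ne hm]
    rw [e]
    exact deriv_comp_sub_const (f := fun u => F ((p - c).1, Function.update (p - c).2 n u)) _ _
  simp only [delta, hX, hY]

theorem powerSum_add_single (θ t : Fin (N + 1) → ℂ) (i : Fin (N + 1)) (c : ℂ) :
    powerSum (θ + Pi.single i c) t = powerSum θ t + c • shiftBy (t i) := by
  have e : ∀ w : Fin (N + 1) → ℂ,
      ∑ j, (θ + Pi.single i c : Fin (N + 1) → ℂ) j * w j = ∑ j, θ j * w j + c * w i := fun w => by
    simp only [Pi.add_apply, add_mul, Finset.sum_add_distrib]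
    simp [Pi.single_apply]
  refine Prod.ext (funext fun n => ?_) (funext fun n => ?_)
  · refine (congrArg (1 / ((n : ℕ) : ℂ) * ·) (e fun j => t j ^ (n : ℕ))).trans ?_
    simp only [powerSum, shiftBy, bracket, Prod.fst_add, Pi.add_apply, Prod.smul_fst, Pi.smul_apply,
      smul_eq_mul]
    ring
  · refine (congrArg (1 / ((n : ℕ) : ℂ) * ·) (e fun j => (t j)⁻¹ ^ (n : ℕ))).trans ?_
    simp only [powerSum, shiftBy, bracket, Prod.snd_add, Pi.add_apply, Prod.smul_snd, Pi.smul_apply,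
      smul_eq_mul]
    ring

theorem powerSum_raise (θ t : Fin (N + 1) → ℂ) (i : Fin (N + 1)) :
    powerSum (raise θ i) t = powerSum θ t + shiftBy (t i) := by
  rw [raise, powerSum_add_single, one_smul]

/-- The shifted argument of a wave function is again a power sum, with one more variable q of
exponent -1. All differentiation rules for `sigma` thus apply to it. -/
theorem powerSum_snoc (θ t : Fin (N + 1) → ℂ) (q : ℂ) :
    powerSum (Fin.snoc (α := fun _ => ℂ) θ (-1)) (Fin.snoc (α := fun _ => ℂ) t q) =
      powerSum θ t - shiftBy q := by
  refine Prod.ext (funext fun n => ?_) (funext fun n => ?_)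
  · simp only [powerSum, Fin.sum_univ_castSucc, Fin.snoc_castSucc, Fin.snoc_last, shiftBy, bracket,
      Prod.fst_sub, Pi.sub_apply]
    ring
  · simp only [powerSum, Fin.sum_univ_castSucc, Fin.snoc_castSucc, Fin.snoc_last, shiftBy, bracket,
      Prod.snd_sub, Pi.sub_apply]
    ring

end

end

section

variable {N : ℕ}
variable {L : ℕ} {d : ℤ → ℤ → ℂ} {θ : Fin (N + 1) → ℂ} {T : Set (Fin (N + 1) → ℂ)} {f g : Family N}

/-! ### The dependent variables given by the tau functions -/

/-- Two periodic solutions of the recursion differ by a solution of the homogeneous one. Over a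
period that difference is multiplied by (t_i/t_l)^L ≠ 1, yet it is periodic, so it is zero. -/
theorem eq_auxU (h : IsAdmissible L d θ T f g) {t : Fin (N + 1) → ℂ} (ht : t ∈ T)
    {i l : Fin (N + 1)} (hi : t i ≠ 0) (hl : t l ≠ 0) (hil : t i ^ L ≠ t l ^ L) {Y : ℤ → ℂ}
    (hY : ∀ j, Y (j + L) = Y j)
    (hr : ∀ j, Y j + g i j t = (t i * f i j t) / (t l * f l j t) * Y (j - 1)) (j : ℤ) :
    auxU L f g i l j t = Y j := by
  set r : ℤ → ℂ := fun a => (t i * f i a t) / (t l * f l a t) with hrdef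
  have hr0 : ∀ a, r a ≠ 0 := fun a =>
    div_ne_zero (mul_ne_zero hi (h.f_ne_zero i a t ht)) (mul_ne_zero hl (h.f_ne_zero l a t ht))
  have hrp : ∀ a, r (a + L) = r a := fun a => by
    simp only [hrdef, h.periodic_f i a t ht, h.periodic_f l a t ht]
  have hprod : ∏ a ∈ Finset.range L, r (j - a) = (t i / t l) ^ L := by
    rw [prod_range_sub_of_periodic hrp hr0]
    simp only [hrdef, Finset.prod_div_distrib, Finset.prod_mul_distrib, h.prod_f i t ht,
      h.prod_f l t ht, Finset.prod_const, Finset.card_range, mul_one, div_pow]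
  have hD : ∀ j, auxU L f g i l j t - Y j = r j * (auxU L f g i l (j - 1) t - Y (j - 1)) := by
    intro j
    have h1 := auxV_eq L f g i l j t
    rw [auxV_eq_auxU_add h ht hi hl hil] at h1
    linear_combination h1 - hr j
  have hit : ∀ n : ℕ, auxU L f g i l j t - Y j =
      (∏ a ∈ Finset.range n, r (j - a)) * (auxU L f g i l (j - n) t - Y (j - n)) := by
    intro n
    induction n with
    | zero => simp
    | succ n ih =>
      rw [ih, hD, Finset.prod_range_succ]
      push_cast
      rw [sub_sub, mul_assoc]
  have hL := hit L
  have e1 : auxU L f g i l (j - L) t = auxU L f g i l j t := by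
    rw [← auxU_period h ht, sub_add_cancel]
  have e2 : Y (j - L) = Y j := by rw [← hY, sub_add_cancel]
  rw [e1, e2, hprod, div_pow] at hL
  have hq : t i ^ L / t l ^ L ≠ 1 := fun h' =>
    hil (by rwa [div_eq_one_iff_eq (pow_ne_zero L hl)] at h')
  have : (1 - t i ^ L / t l ^ L) * (auxU L f g i l j t - Y j) = 0 := by linear_combination hL
  rcases mul_eq_zero.mp this with h' | h'
  · exact absurd (sub_eq_zero.mp h').symm hq
  · exact sub_eq_zero.mp h'

theorem fderiv_crossRatio {A B C D : (Fin (N + 1) → ℂ) → ℂ} {t : Fin (N + 1) → ℂ}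
    (v : Fin (N + 1) → ℂ) (hA : DifferentiableAt ℂ A t) (hB : DifferentiableAt ℂ B t)
    (hC : DifferentiableAt ℂ C t) (hD : DifferentiableAt ℂ D t) (hC0 : C t ≠ 0) (hD0 : D t ≠ 0) :
    fderiv ℂ (fun s => A s * B s / (C s * D s)) t v =
      (fderiv ℂ A t v * B t + A t * fderiv ℂ B t v) / (C t * D t) -
        A t * B t * (fderiv ℂ C t v * D t + C t * fderiv ℂ D t v) / (C t * D t) ^ 2 := by
  rw [fderiv_div_apply v (hA.fun_mul hB) (hC.fun_mul hD) (mul_ne_zero hC0 hD0),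
    fderiv_mul_apply v hA hB, fderiv_mul_apply v hC hD]
  field_simp

section
variable {Ω : Set Pt} {τ : ℤ → ℤ → Pt → ℂ} {W : Set ((Fin (N + 1) → ℂ) × ℂ)}
  {t : Fin (N + 1) → ℂ}

/-! ### Tau functions at shifted power sums -/

theorem IsReductionDomain.shift_mem (hR : IsReductionDomain Ω τ θ T W) (ht : t ∈ T)
    (i l : Fin (N + 1)) (x y : ℤ) :
    powerSum θ t + (x : ℂ) • shiftBy (t i) + (y : ℂ) • shiftBy (t l) ∈ Ω := by
  have h := hR.mem_domain t ht (Pi.single i x + Pi.single l y)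
  rw [← powerSum_add_single, ← powerSum_add_single]
  convert h using 2
  funext k
  simp only [Pi.add_apply, Pi.single_apply]
  push_cast
  ring

theorem IsReductionDomain.mem (hR : IsReductionDomain Ω τ θ T W) (ht : t ∈ T) :
    powerSum θ t ∈ Ω := by
  simpa using hR.shift_mem ht 0 0 0 0

theorem IsReductionDomain.add_mem (hR : IsReductionDomain Ω τ θ T W) (ht : t ∈ T)
    (i : Fin (N + 1)) : powerSum θ t + shiftBy (t i) ∈ Ω := by
  simpa using hR.shift_mem ht i 0 1 0

theorem IsReductionDomain.sub_mem (hR : IsReductionDomain Ω τ θ T W) (ht : t ∈ T)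
    (i : Fin (N + 1)) : powerSum θ t - shiftBy (t i) ∈ Ω := by
  simpa [sub_eq_add_neg] using hR.shift_mem ht i 0 (-1) 0

theorem IsReductionDomain.add_add_mem (hR : IsReductionDomain Ω τ θ T W) (ht : t ∈ T)
    (i l : Fin (N + 1)) : powerSum θ t + shiftBy (t i) + shiftBy (t l) ∈ Ω := by
  simpa using hR.shift_mem ht i l 1 1

theorem IsReductionDomain.add_sub_mem (hR : IsReductionDomain Ω τ θ T W) (ht : t ∈ T)
    (i l : Fin (N + 1)) : powerSum θ t + shiftBy (t i) - shiftBy (t l) ∈ Ω := by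
  simpa [sub_eq_add_neg] using hR.shift_mem ht i l 1 (-1)

theorem sigma_raise (τ : ℤ → ℤ → Pt → ℂ) (θ t : Fin (N + 1) → ℂ) (m n : ℤ) (i : Fin (N + 1)) :
    sigma τ m n (raise θ i) t = τ m n (powerSum θ t + shiftBy (t i)) := by
  rw [sigma, powerSum_raise]

theorem IsReductionDomain.tau_ne_zero (hR : IsReductionDomain Ω τ θ T W) (ht : t ∈ T) (m n : ℤ) :
    τ m n (powerSum θ t) ≠ 0 := hR.sigma_ne_zero t ht m n

theorem IsReductionDomain.tau_add_ne_zero (hR : IsReductionDomain Ω τ θ T W) (ht : t ∈ T)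
    (m n : ℤ) (i : Fin (N + 1)) : τ m n (powerSum θ t + shiftBy (t i)) ≠ 0 := by
  have h := hR.sigma_raise_ne_zero t ht m n i
  rwa [sigma_raise] at h

theorem differentiableAt_sigma (hτ : IsTauSequence L d Ω τ) (m n : ℤ) (h0 : ∀ i, t i ≠ 0)
    (hp : powerSum θ t ∈ Ω) : DifferentiableAt ℂ (sigma τ m n θ) t :=
  differentiableAt_powerSum hτ.domain (hτ.holomorphic m n) h0 hp

theorem mul_pd_sigma (hτ : IsTauSequence L d Ω τ) (m n : ℤ) (h0 : ∀ i, t i ≠ 0)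
    (hp : powerSum θ t ∈ Ω) (i : Fin (N + 1)) :
    t i * pd i (sigma τ m n θ) t = θ i * delta (t i) (τ m n) (powerSum θ t) :=
  mul_pd_powerSum hτ.domain (hτ.holomorphic m n) h0 hp i

theorem sum_mul_pd_sigma (hτ : IsTauSequence L d Ω τ) (m n : ℤ) (h0 : ∀ i, t i ≠ 0)
    (hp : powerSum θ t ∈ Ω) :
    ∑ i, t i * pd i (sigma τ m n θ) t = d m n * sigma τ m n θ t :=
  (sum_mul_pd_powerSum hτ.domain (hτ.holomorphic m n) h0 hp).trans (hτ.homogeneous m n _ hp)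

theorem tau_difference (hτ : IsTauSequence L d Ω τ) (m n : ℤ) {p : Pt} {t s : ℂ} (ht : t ≠ 0)
    (hs : s ≠ 0) (h1 : p ∈ Ω) (h2 : p - shiftBy t ∈ Ω) (h3 : p - shiftBy s ∈ Ω)
    (h4 : p - shiftBy t - shiftBy s ∈ Ω) :
    (t - s) * τ (m - 1) (n - 1) (p - shiftBy t - shiftBy s) * τ m n p
      - t * τ (m - 1) n (p - shiftBy t) * τ m (n - 1) (p - shiftBy s)
      + s * τ (m - 1) n (p - shiftBy s) * τ m (n - 1) (p - shiftBy t) = 0 := by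
  simpa only [sub_add_cancel] using hτ.difference (m - 1) (n - 1) p t s ht hs h1 h2 h3 h4

/-- This is the second UC equation with t = t_i, multiplied by θ_i: the summand θ_i in the
definition of g absorbs its constant -1. The quotient form shows g to be holomorphic and is what the
mixed equation can act on. -/
theorem gVar_eq_of_ne_zero (hτ : IsTauSequence L d Ω τ) (h0 : ∀ i, t i ≠ 0) (m n : ℤ)
    (i : Fin (N + 1)) (h1 : powerSum θ t ∈ Ω) (h2 : powerSum θ t - shiftBy (t i) ∈ Ω)
    (h3 : powerSum θ t + shiftBy (t i) ∈ Ω) (h4 : τ m (n - 1) (powerSum θ t) ≠ 0)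
    (h5 : τ (m - 1) n (powerSum θ t) ≠ 0) :
    gVar τ θ i m n t = θ i * τ (m - 1) (n - 1) (powerSum θ t - shiftBy (t i)) *
      τ m n (powerSum θ t + shiftBy (t i)) /
        (τ m (n - 1) (powerSum θ t) * τ (m - 1) n (powerSum θ t)) := by
  have e := hτ.differential (m - 1) (n - 1) (powerSum θ t) (t i) (h0 i) h1 h2 h3
  simp only [sub_add_cancel, hirotaDelta] at e
  have e1 := mul_pd_sigma hτ m (n - 1) h0 h1 i
  have e2 := mul_pd_sigma hτ (m - 1) n h0 h1 i
  rw [gVar, div_add' _ _ _ (by exact mul_ne_zero h4 h5)]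
  simp only [sigma] at e1 e2 ⊢
  change _ / _ = _ / _
  congr 1
  linear_combination τ (m - 1) n (powerSum θ t) * e1 - τ m (n - 1) (powerSum θ t) * e2 - θ i * e

theorem gVar_eq_logDeriv {m n : ℤ} (i : Fin (N + 1)) (h1 : sigma τ m (n - 1) θ t ≠ 0)
    (h2 : sigma τ (m - 1) n θ t ≠ 0) : gVar τ θ i m n t =
      (t i * pd i (sigma τ m (n - 1) θ) t / sigma τ m (n - 1) θ t -
        t i * pd i (sigma τ (m - 1) n θ) t / sigma τ (m - 1) n θ t) + θ i := by
  rw [gVar]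
  field_simp

theorem fFamily_apply (τ : ℤ → ℤ → Pt → ℂ) (θ t : Fin (N + 1) → ℂ) (i : Fin (N + 1)) (j : ℤ) :
    fFamily τ θ i j t =
      sigma τ j (-j) (raise θ i) t * sigma τ (j - 1) (-j) θ t /
        (sigma τ (j - 1) (1 - j) (raise θ i) t * sigma τ j (-j - 1) θ t) := by
  have e1 : 1 - j - 1 = -j := by ring
  have e2 : 1 - j - 2 = -j - 1 := by ring
  rw [fFamily, fVar, e1, e2]

theorem gFamily_apply (hτ : IsTauSequence L d Ω τ) (hR : IsReductionDomain Ω τ θ T W)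
    (hT0 : ∀ t ∈ T, ∀ i, t i ≠ 0) (ht : t ∈ T) (i : Fin (N + 1)) (j : ℤ) :
    gFamily τ θ i j t = θ i * τ (j - 1) (-j - 1) (powerSum θ t - shiftBy (t i)) *
      τ j (-j) (powerSum θ t + shiftBy (t i)) /
        (τ j (-j - 1) (powerSum θ t) * τ (j - 1) (-j) (powerSum θ t)) :=
  gVar_eq_of_ne_zero hτ (hT0 t ht) j (-j) i (hR.mem ht) (hR.sub_mem ht i) (hR.add_mem ht i)
    (hR.tau_ne_zero ht _ _) (hR.tau_ne_zero ht _ _)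

/-- `θ` with `θᵢ` replaced by `θᵢ - 1`. -/
def lower (θ : Fin (N + 1) → ℂ) (i : Fin (N + 1)) : Fin (N + 1) → ℂ := θ + Pi.single i (-1)

theorem powerSum_lower (θ t : Fin (N + 1) → ℂ) (i : Fin (N + 1)) :
    powerSum (lower θ i) t = powerSum θ t - shiftBy (t i) := by
  rw [lower, powerSum_add_single, neg_smul, one_smul, sub_eq_add_neg]

theorem gFamily_eq_sigma (hτ : IsTauSequence L d Ω τ) (hR : IsReductionDomain Ω τ θ T W)
    (hT0 : ∀ t ∈ T, ∀ i, t i ≠ 0) (ht : t ∈ T) (i : Fin (N + 1)) (j : ℤ) :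
    gFamily τ θ i j t = θ i * (sigma τ (j - 1) (-j - 1) (lower θ i) t * sigma τ j (-j) (raise θ i) t /
        (sigma τ j (-j - 1) θ t * sigma τ (j - 1) (-j) θ t)) := by
  rw [gFamily_apply hτ hR hT0 ht, sigma_raise, sigma, powerSum_lower, mul_assoc, mul_div_assoc]
  rfl

theorem differentiableAt_sigma_raise (hτ : IsTauSequence L d Ω τ)
    (hR : IsReductionDomain Ω τ θ T W) (hT0 : ∀ t ∈ T, ∀ i, t i ≠ 0) (ht : t ∈ T) (m n : ℤ)
    (i : Fin (N + 1)) : DifferentiableAt ℂ (sigma τ m n (raise θ i)) t :=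
  differentiableAt_sigma hτ m n (hT0 t ht) (by rw [powerSum_raise]; exact hR.add_mem ht i)

theorem differentiableAt_sigma_lower (hτ : IsTauSequence L d Ω τ)
    (hR : IsReductionDomain Ω τ θ T W) (hT0 : ∀ t ∈ T, ∀ i, t i ≠ 0) (ht : t ∈ T) (m n : ℤ)
    (i : Fin (N + 1)) : DifferentiableAt ℂ (sigma τ m n (lower θ i)) t :=
  differentiableAt_sigma hτ m n (hT0 t ht) (by rw [powerSum_lower]; exact hR.sub_mem ht i)

theorem sum_range_sub_pred_of_periodic {F : ℤ → ℂ} (hF : ∀ j, F (j + L) = F j) :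
    ∑ j ∈ Finset.range L, (F j - F (j - 1)) = 0 := by
  have h := Finset.sum_range_sub (fun j : ℕ => F ((j : ℤ) - 1)) L
  have e : F ((L : ℤ) - 1) = F (((0 : ℕ) : ℤ) - 1) := by
    rw [← hF (((0 : ℕ) : ℤ) - 1)]; congr 1
  rw [e, sub_self] at h
  rw [← h]
  refine Finset.sum_congr rfl fun j _ => ?_
  push_cast
  rw [add_sub_cancel_right]

theorem prod_range_div_pred_of_periodic {F : ℤ → ℂ} (hF : ∀ j, F (j + L) = F j)
    (h0 : ∀ j, F j ≠ 0) : ∏ j ∈ Finset.range L, (F j / F (j - 1)) = 1 := by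
  have h : ∀ n : ℕ, ∏ j ∈ Finset.range n, (F j / F (j - 1)) = F ((n : ℤ) - 1) / F (-1) := by
    intro n
    induction n with
    | zero => simp [h0]
    | succ n ih =>
      rw [Finset.prod_range_succ, ih]
      push_cast
      rw [add_sub_cancel_right]
      have := h0 ((n : ℤ) - 1)
      have := h0 (-1)
      field_simp
  rw [h, ← hF (-1), neg_add_eq_sub, div_self (h0 _)]

theorem sigma_periodic (hτ : IsTauSequence L d Ω τ) (m n : ℤ) (hp : powerSum θ t ∈ Ω) :
    sigma τ (m + L) (n - L) θ t = sigma τ m n θ t := by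
  have h := hτ.periodic_right m (n - L) _ hp
  rw [sub_add_cancel] at h
  rw [sigma, hτ.periodic_left m _ _ hp, ← h, sigma]

/-- Along the antidiagonal f_j has the form F_j / F_{j-1}, and g_j - θ_i the form F_j - F_{j-1},
with L-periodic F. The conservation laws over a period are then telescoping identities. The sum of g
over i involves the Euler field and comes from the degrees of the tau functions. -/
theorem isAdmissible_of_tau (hT : IsOpen T) (hτ : IsTauSequence L d Ω τ)
    (hR : IsReductionDomain Ω τ θ T W) (hT0 : ∀ t ∈ T, ∀ i, t i ≠ 0) :
    IsAdmissible L d θ T (fFamily τ θ) (gFamily τ θ) := by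
  have memr : ∀ t ∈ T, ∀ i, powerSum (raise θ i) t ∈ Ω := fun t ht i => by
    rw [powerSum_raise]; exact hR.add_mem ht i
  have meml : ∀ t ∈ T, ∀ i, powerSum (lower θ i) t ∈ Ω := fun t ht i => by
    rw [powerSum_lower]; exact hR.sub_mem ht i
  have shift : ∀ t ∈ T, ∀ ϑ : Fin (N + 1) → ℂ, powerSum ϑ t ∈ Ω → ∀ a b j : ℤ,
      sigma τ (j + L + a) (-(j + L) + b) ϑ t = sigma τ (j + a) (-j + b) ϑ t := by
    intro t ht ϑ hϑ a b j
    rw [← sigma_periodic hτ (j + a) (-j + b) hϑ]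
    congr 1 <;> ring
  have gsum : ∀ t ∈ T, ∀ i j, gFamily τ θ i j t =
      (t i * pd i (sigma τ j (-j - 1) θ) t / sigma τ j (-j - 1) θ t -
        t i * pd i (sigma τ (j - 1) (-j) θ) t / sigma τ (j - 1) (-j) θ t) + θ i :=
    fun t ht i j => gVar_eq_logDeriv i (hR.sigma_ne_zero t ht _ _) (hR.sigma_ne_zero t ht _ _)
  have hF : ∀ t ∈ T, ∀ i j, pd i (sigma τ (j + L) (-(j + L) - 1) θ) t =
      pd i (sigma τ j (-j - 1) θ) t := fun t ht i j => by
    refine pd_congr_of_eqOn hT ht i fun s hs => ?_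
    have := shift s hs θ (hR.mem hs) 0 (-1) j
    simpa [← sub_eq_add_neg] using this
  refine ⟨?_, ?_, ?_, ?_, ?_, ?_, ?_, ?_⟩
  · intro i j t ht
    refine DifferentiableAt.differentiableWithinAt ?_
    simp only [funext fun t => fFamily_apply τ θ t i j]
    exact differentiableAt_div ((differentiableAt_sigma_raise hτ hR hT0 ht _ _ i).fun_mul
        (differentiableAt_sigma hτ _ _ (hT0 t ht) (hR.mem ht)))
      ((differentiableAt_sigma_raise hτ hR hT0 ht _ _ i).fun_mul
        (differentiableAt_sigma hτ _ _ (hT0 t ht) (hR.mem ht)))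
      (mul_ne_zero (hR.sigma_raise_ne_zero t ht _ _ _) (hR.sigma_ne_zero t ht _ _))
  · intro i j
    refine DifferentiableOn.congr (fun t ht => ?_) fun t ht => gFamily_eq_sigma hτ hR hT0 ht i j
    refine DifferentiableAt.differentiableWithinAt (DifferentiableAt.const_mul ?_ _)
    exact differentiableAt_div ((differentiableAt_sigma_lower hτ hR hT0 ht _ _ i).fun_mul
        (differentiableAt_sigma_raise hτ hR hT0 ht _ _ i))
      ((differentiableAt_sigma hτ _ _ (hT0 t ht) (hR.mem ht)).fun_mul
        (differentiableAt_sigma hτ _ _ (hT0 t ht) (hR.mem ht)))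
      (mul_ne_zero (hR.sigma_ne_zero t ht _ _) (hR.sigma_ne_zero t ht _ _))
  · intro i j t ht
    have e1 := shift t ht _ (memr t ht i) 0 0 j
    have e2 := shift t ht _ (hR.mem ht) (-1) 0 j
    have e3 := shift t ht _ (memr t ht i) (-1) 1 j
    have e4 := shift t ht _ (hR.mem ht) 0 (-1) j
    simp only [add_zero, ← sub_eq_add_neg] at e1 e2 e3 e4
    have e5 : ∀ j : ℤ, 1 - j = -j + 1 := fun j => by ring
    rw [fFamily_apply, fFamily_apply, e5, e5, e1, e2, e3, e4]
  · intro i j t ht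
    have e1 := shift t ht _ (meml t ht i) (-1) (-1) j
    have e2 := shift t ht _ (memr t ht i) 0 0 j
    have e3 := shift t ht _ (hR.mem ht) 0 (-1) j
    have e4 := shift t ht _ (hR.mem ht) (-1) 0 j
    simp only [add_zero, ← sub_eq_add_neg] at e1 e2 e3 e4
    rw [gFamily_eq_sigma hτ hR hT0 ht, gFamily_eq_sigma hτ hR hT0 ht, e1, e2, e3, e4]
  · intro i j t ht
    rw [fFamily_apply]
    exact div_ne_zero
      (mul_ne_zero (hR.sigma_raise_ne_zero t ht _ _ _) (hR.sigma_ne_zero t ht _ _))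
      (mul_ne_zero (hR.sigma_raise_ne_zero t ht _ _ _) (hR.sigma_ne_zero t ht _ _))
  · intro i t ht
    have p := prod_range_div_pred_of_periodic (L := L)
      (F := fun j => sigma τ j (-j) (raise θ i) t / sigma τ j (-j - 1) θ t) (fun j => by
        have e1 := shift t ht _ (memr t ht i) 0 0 j
        have e2 := shift t ht _ (hR.mem ht) 0 (-1) j
        simp only [add_zero, ← sub_eq_add_neg] at e1 e2
        simp only [e1, e2])
      fun j => div_ne_zero (hR.sigma_raise_ne_zero t ht _ _ _) (hR.sigma_ne_zero t ht _ _)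
    rw [← p]
    refine Finset.prod_congr rfl fun j _ => ?_
    have e1 : -((j : ℤ) - 1) = 1 - j := by ring
    have e2 : 1 - (j : ℤ) - 1 = -j := by ring
    rw [fFamily_apply, e1, e2]
    have h1 := hR.sigma_raise_ne_zero t ht ((j : ℤ) - 1) (1 - j) i
    have h2 := hR.sigma_ne_zero t ht (j : ℤ) (-j - 1)
    have h3 := hR.sigma_ne_zero t ht ((j : ℤ) - 1) (-j)
    field_simp
  · intro i t ht
    have p := sum_range_sub_pred_of_periodic (L := L)
      (F := fun j => t i * pd i (sigma τ j (-j - 1) θ) t / sigma τ j (-j - 1) θ t) (fun j => by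
        have e2 := shift t ht _ (hR.mem ht) 0 (-1) j
        simp only [add_zero, ← sub_eq_add_neg] at e2
        simp only [e2, hF t ht])
    have e2 : ∀ j : ℕ, -((j : ℤ) - 1) - 1 = -j := fun j => by ring
    simp only [e2] at p
    simp only [gsum t ht i]
    rw [Finset.sum_add_distrib, p, Finset.sum_const, Finset.card_range, nsmul_eq_mul, zero_add]
  · intro j t ht
    rw [Finset.sum_congr rfl fun i _ => gsum t ht i j, Finset.sum_add_distrib,
      Finset.sum_sub_distrib, ← Finset.sum_div, ← Finset.sum_div,
      sum_mul_pd_sigma hτ _ _ (hT0 t ht) (hR.mem ht),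
      sum_mul_pd_sigma hτ _ _ (hT0 t ht) (hR.mem ht),
      mul_div_cancel_right₀ _ (hR.sigma_ne_zero t ht _ _),
      mul_div_cancel_right₀ _ (hR.sigma_ne_zero t ht _ _), kappa]

end

end

section

variable {N : ℕ}
variable {L : ℕ} {d : ℤ → ℤ → ℂ} {θ : Fin (N + 1) → ℂ} {T : Set (Fin (N + 1) → ℂ)} {f g : Family N}
variable {Ω : Set Pt} {τ : ℤ → ℤ → Pt → ℂ} {W : Set ((Fin (N + 1) → ℂ) × ℂ)}
  {t : Fin (N + 1) → ℂ}

/-! ### The nonlinear system from the UC hierarchy -/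

/-- The auxiliary variable `U^{(l,i)}_j` in terms of tau functions. -/
def tauU (τ : ℤ → ℤ → Pt → ℂ) (θ : Fin (N + 1) → ℂ) (l i : Fin (N + 1)) (j : ℤ)
    (t : Fin (N + 1) → ℂ) : ℂ :=
  t i * θ l / (t l - t i) * (τ j (-j - 1) (powerSum θ t + shiftBy (t i) - shiftBy (t l)) *
    τ j (-j) (powerSum θ t + shiftBy (t l)) /
      (τ j (-j) (powerSum θ t + shiftBy (t i)) * τ j (-j - 1) (powerSum θ t)))

/-- The auxiliary variable `V^{(l,i)}_j` in terms of tau functions. -/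
def tauV (τ : ℤ → ℤ → Pt → ℂ) (θ : Fin (N + 1) → ℂ) (l i : Fin (N + 1)) (j : ℤ)
    (t : Fin (N + 1) → ℂ) : ℂ :=
  t l * θ l / (t l - t i) * (τ j (-j) (powerSum θ t + shiftBy (t l)) *
    τ (j - 1) (-j) (powerSum θ t + shiftBy (t i) - shiftBy (t l)) /
      (τ j (-j) (powerSum θ t + shiftBy (t i)) * τ (j - 1) (-j) (powerSum θ t)))

/-- The first UC equation with t = t_l, s = t_i at the point shifted by [t_i]. Together with
`tauV_eq_mul_tauU`, a mere cancellation of factors, it is the recursion characterizing U. -/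
theorem tauV_eq_tauU_add (hτ : IsTauSequence L d Ω τ) (hR : IsReductionDomain Ω τ θ T W)
    (hT0 : ∀ t ∈ T, ∀ i, t i ≠ 0) (ht : t ∈ T) {l i : Fin (N + 1)} (hli : t l ≠ t i) (j : ℤ) :
    tauV τ θ l i j t = tauU τ θ l i j t + gFamily τ θ l j t := by
  have e := tau_difference hτ j (-j) (p := powerSum θ t + shiftBy (t i)) (hT0 t ht l) (hT0 t ht i)
    (hR.add_mem ht i) (hR.add_sub_mem ht i l)
    (by rw [add_sub_cancel_right]; exact hR.mem ht)
    (by rw [sub_right_comm, add_sub_cancel_right]; exact hR.sub_mem ht l)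
  rw [sub_right_comm _ (shiftBy (t l)), add_sub_cancel_right] at e
  have h1 := hR.tau_ne_zero ht j (-j - 1)
  have h2 := hR.tau_ne_zero ht (j - 1) (-j)
  have h3 := hR.tau_add_ne_zero ht j (-j) i
  have h4 : t l - t i ≠ 0 := sub_ne_zero.mpr hli
  rw [gFamily_apply hτ hR hT0 ht, tauV, tauU]
  field_simp
  linear_combination (-θ l * τ j (-j) (powerSum θ t + shiftBy (t l))) * e

theorem tauV_eq_mul_tauU (hR : IsReductionDomain Ω τ θ T W)
    (hT0 : ∀ t ∈ T, ∀ i, t i ≠ 0) (ht : t ∈ T) {l i : Fin (N + 1)} (hli : t l ≠ t i) (j : ℤ) :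
    tauV τ θ l i j t =
      (t l * fFamily τ θ l j t) / (t i * fFamily τ θ i j t) * tauU τ θ l i (j - 1) t := by
  have h1 := hR.tau_ne_zero ht j (-j - 1)
  have h2 := hR.tau_ne_zero ht (j - 1) (-j)
  have h3 := hR.tau_add_ne_zero ht j (-j) i
  have h4 : t l - t i ≠ 0 := sub_ne_zero.mpr hli
  have h5 := hR.tau_add_ne_zero ht (j - 1) (1 - j) i
  have h6 := hR.tau_add_ne_zero ht (j - 1) (1 - j) l
  have h7 := hT0 t ht i
  have e1 : -(j - 1) = 1 - j := by ring
  have e2 : 1 - j - 1 = -j := by ring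
  rw [fFamily_apply, fFamily_apply, tauV, tauU, e1, e2]
  simp only [sigma_raise]
  simp only [sigma]
  field_simp

theorem auxU_of_tau (hT : IsOpen T) (hτ : IsTauSequence L d Ω τ) (hR : IsReductionDomain Ω τ θ T W)
    (hT0 : ∀ t ∈ T, ∀ i, t i ≠ 0) (hTd : ∀ t ∈ T, ∀ i j, i ≠ j → t i ^ L ≠ t j ^ L)
    (ht : t ∈ T) {l i : Fin (N + 1)} (hli : l ≠ i) (j : ℤ) :
    auxU L (fFamily τ θ) (gFamily τ θ) l i j t = tauU τ θ l i j t := by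
  have hne := hTd t ht l i hli
  have hne' : t l ≠ t i := fun h => hne (by rw [h])
  refine eq_auxU (Y := fun j => tauU τ θ l i j t) (isAdmissible_of_tau hT hτ hR hT0) ht (hT0 t ht l) (hT0 t ht i) hne
    (fun j => ?_) (fun j => ?_) j
  · have per : ∀ m n p, p ∈ Ω → τ (m + L) (n - L) p = τ m n p := fun m n p hp => by
      have h := hτ.periodic_right m (n - L) _ hp
      rw [sub_add_cancel] at h
      rw [hτ.periodic_left m _ _ hp, ← h]
    have e1 : -(j + (L : ℤ)) = -j - L := by ring
    have e2 : -j - (L : ℤ) - 1 = -j - 1 - L := by ring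
    rw [tauU, tauU, e1, e2, per _ _ _ (hR.add_sub_mem ht i l), per _ _ _ (hR.add_mem ht l),
      per _ _ _ (hR.add_mem ht i), per _ _ _ (hR.mem ht)]
  · rw [← tauV_eq_tauU_add hτ hR hT0 ht hne', tauV_eq_mul_tauU hR hT0 ht hne']

/-- The first UC equation at the point shifted by [t_i] + [t_l]. It supplies the logarithmic
derivative of the raised tau quotient that occurs in f^{(i)}. -/
theorem gVar_raise (hτ : IsTauSequence L d Ω τ) (hR : IsReductionDomain Ω τ θ T W)
    (hT0 : ∀ t ∈ T, ∀ i, t i ≠ 0) (ht : t ∈ T) {l i : Fin (N + 1)} (hli : t l ≠ t i) (hil : l ≠ i)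
    (j : ℤ) : gVar τ (raise θ i) l j (1 - j) t = tauV τ θ l i j t - tauU τ θ l i (j - 1) t := by
  have e := tau_difference hτ j (1 - j) (p := powerSum θ t + shiftBy (t i) + shiftBy (t l))
    (hT0 t ht l) (hT0 t ht i) (hR.add_add_mem ht i l)
    (by rw [add_sub_cancel_right]; exact hR.add_mem ht i)
    (by rw [add_right_comm, add_sub_cancel_right]; exact hR.add_mem ht l)
    (by rw [add_sub_cancel_right, add_sub_cancel_right]; exact hR.mem ht)
  rw [add_sub_cancel_right, add_sub_cancel_right, add_right_comm _ _ (shiftBy (t l)),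
    add_sub_cancel_right, add_right_comm _ (shiftBy (t l))] at e
  have e1 : -(j - 1) = 1 - j := by ring
  have e2 : 1 - j - 1 = -j := by ring
  have hg := gVar_eq_of_ne_zero hτ (θ := raise θ i) (hT0 t ht) j (1 - j) l
    (by rw [powerSum_raise]; exact hR.add_mem ht i)
    (by rw [powerSum_raise]; exact hR.add_sub_mem ht i l)
    (by rw [powerSum_raise]; exact hR.add_add_mem ht i l)
    (by rw [powerSum_raise]; exact hR.tau_add_ne_zero ht _ _ i)
    (by rw [powerSum_raise]; exact hR.tau_add_ne_zero ht _ _ i)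
  rw [powerSum_raise] at hg
  have hr : raise θ i l = θ l := by simp [raise, hil]
  have h2 := hR.tau_ne_zero ht (j - 1) (-j)
  have h3 := hR.tau_add_ne_zero ht j (-j) i
  have h4 : t l - t i ≠ 0 := sub_ne_zero.mpr hli
  have h5 := hR.tau_add_ne_zero ht (j - 1) (1 - j) i
  rw [e2] at hg e
  rw [hg, hr, tauV, tauU, e1, e2]
  field_simp
  linear_combination (θ l * τ (j - 1) (-j) (powerSum θ t + shiftBy (t i) - shiftBy (t l))) * e

/-- The elimination behind the t_l-derivative of g^{(i)} = θ_i X Y / (V Z). Primes stand for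
δ_{t_l}, with c = t_l and a = t_i; `e1` and `e2` are the mixed UC equation for the pairs X, V and Z,
Y. -/
theorem mixed_algebra {a c θi θl X X' Y Y' Z Z' V V' P₁ P₂ P₃ Q : ℂ} (hac : c - a ≠ 0) (hZ : Z ≠ 0)
    (hV : V ≠ 0) (hY : Y ≠ 0) (hQ : Q ≠ 0)
    (e1 : X' * V - X * V' + c / (a - c) * (X * V) + c / (c - a) * (P₁ * P₂) = 0)
    (e2 : Z' * Y - Z * Y' + c / (a - c) * (Z * Y) + c / (c - a) * (P₃ * Q) = 0) :
    θi * ((θl * X' * Y + X * (θl * Y')) / (V * Z) -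
        X * Y * (θl * V' * Z + V * (θl * Z')) / (V * Z) ^ 2) =
      c * θi / (a - c) * (P₂ * Y / (Q * V)) * (θl * P₁ * Q / (V * Z)) +
        c * θl / (c - a) * (Q * P₃ / (Y * Z)) * (θi * X * Y / (V * Z)) := by
  have hac' : a - c = -(c - a) := by ring
  rw [hac'] at e1 e2 ⊢
  generalize c - a = b at *
  field_simp at e1 e2 ⊢
  linear_combination (θi * θl) * (Y * Z * e1 - X * V * e2)

theorem fderiv_fFamily (hτ : IsTauSequence L d Ω τ) (hR : IsReductionDomain Ω τ θ T W)
    (hT0 : ∀ t ∈ T, ∀ i, t i ≠ 0) (ht : t ∈ T) (i : Fin (N + 1)) (j : ℤ) (v : Fin (N + 1) → ℂ) :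
    fderiv ℂ (fFamily τ θ i j) t v =
      (fderiv ℂ (sigma τ j (-j) (raise θ i)) t v / sigma τ j (-j) (raise θ i) t
        - fderiv ℂ (sigma τ (j - 1) (1 - j) (raise θ i)) t v / sigma τ (j - 1) (1 - j) (raise θ i) t
        + fderiv ℂ (sigma τ (j - 1) (-j) θ) t v / sigma τ (j - 1) (-j) θ t
        - fderiv ℂ (sigma τ j (-j - 1) θ) t v / sigma τ j (-j - 1) θ t) * fFamily τ θ i j t := by
  have h1 := hR.sigma_raise_ne_zero t ht j (-j) i
  have h2 := hR.sigma_raise_ne_zero t ht (j - 1) (1 - j) i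
  have h3 := hR.sigma_ne_zero t ht (j - 1) (-j)
  have h4 := hR.sigma_ne_zero t ht j (-j - 1)
  rw [show fFamily τ θ i j = _ from funext fun t => fFamily_apply τ θ t i j]
  refine (fderiv_crossRatio v (differentiableAt_sigma_raise hτ hR hT0 ht _ _ i)
    (differentiableAt_sigma hτ _ _ (hT0 t ht) (hR.mem ht))
    (differentiableAt_sigma_raise hτ hR hT0 ht _ _ i)
    (differentiableAt_sigma hτ _ _ (hT0 t ht) (hR.mem ht)) h2 h4).trans ?_
  field_simp
  ring

theorem fderiv_gFamily (hT : IsOpen T) (hτ : IsTauSequence L d Ω τ)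
    (hR : IsReductionDomain Ω τ θ T W)
    (hT0 : ∀ t ∈ T, ∀ i, t i ≠ 0) (ht : t ∈ T) (i : Fin (N + 1)) (j : ℤ) (v : Fin (N + 1) → ℂ) :
    fderiv ℂ (gFamily τ θ i j) t v = θ i *
      ((fderiv ℂ (sigma τ (j - 1) (-j - 1) (lower θ i)) t v * sigma τ j (-j) (raise θ i) t +
          sigma τ (j - 1) (-j - 1) (lower θ i) t * fderiv ℂ (sigma τ j (-j) (raise θ i)) t v) /
        (sigma τ j (-j - 1) θ t * sigma τ (j - 1) (-j) θ t) -
      sigma τ (j - 1) (-j - 1) (lower θ i) t * sigma τ j (-j) (raise θ i) t *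
        (fderiv ℂ (sigma τ j (-j - 1) θ) t v * sigma τ (j - 1) (-j) θ t +
          sigma τ j (-j - 1) θ t * fderiv ℂ (sigma τ (j - 1) (-j) θ) t v) /
        (sigma τ j (-j - 1) θ t * sigma τ (j - 1) (-j) θ t) ^ 2) := by
  have h3 := hR.sigma_ne_zero t ht (j - 1) (-j)
  have h4 := hR.sigma_ne_zero t ht j (-j - 1)
  have hA := differentiableAt_sigma_lower hτ hR hT0 ht (j - 1) (-j - 1) i
  have hB := differentiableAt_sigma_raise hτ hR hT0 ht j (-j) i
  have hC := differentiableAt_sigma hτ j (-j - 1) (hT0 t ht) (hR.mem ht)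
  have hD := differentiableAt_sigma hτ (j - 1) (-j) (hT0 t ht) (hR.mem ht)
  rw [fderiv_congr_of_eqOn v hT ht fun s hs => gFamily_eq_sigma hτ hR hT0 hs i j,
    fderiv_const_mul (differentiableAt_div (hA.fun_mul hB) (hC.fun_mul hD) (mul_ne_zero h4 h3)),
    ← fderiv_crossRatio v hA hB hC hD h4 h3]
  rfl

theorem solvesFlow_of_tau (hd : IsDegreeArray L d) (hT : IsOpen T) (hτ : IsTauSequence L d Ω τ)
    (hR : IsReductionDomain Ω τ θ T W) (hT0 : ∀ t ∈ T, ∀ i, t i ≠ 0)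
    (hTd : ∀ t ∈ T, ∀ i j, i ≠ j → t i ^ L ≠ t j ^ L) :
    SolvesFlow L d θ T (fFamily τ θ) (gFamily τ θ) := by
  have h := isAdmissible_of_tau hT hτ hR hT0
  have hU := fun {t} ht {l i} hli j => auxU_of_tau (t := t) hT hτ hR hT0 hTd ht (l := l) (i := i) hli j
  have hne : ∀ t ∈ T, ∀ l i, l ≠ i → t l ≠ t i := fun t ht l i hli h => hTd t ht l i hli (by rw [h])
  have memr : ∀ t ∈ T, ∀ i, powerSum (raise θ i) t ∈ Ω := fun t ht i => by
    rw [powerSum_raise]; exact hR.add_mem ht i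
  have meml : ∀ t ∈ T, ∀ i, powerSum (lower θ i) t ∈ Ω := fun t ht i => by
    rw [powerSum_lower]; exact hR.sub_mem ht i
  have fsum : ∀ t ∈ T, ∀ m n ϑ, powerSum ϑ t ∈ Ω →
      fderiv ℂ (sigma τ m n ϑ) t t = d m n * sigma τ m n ϑ t := fun t ht m n ϑ hp => by
    rw [← sum_mul_pd_eq_fderiv (differentiableAt_sigma hτ _ _ (hT0 t ht) hp),
      sum_mul_pd_sigma hτ _ _ (hT0 t ht) hp]
  have fone : ∀ t ∈ T, ∀ m n ϑ l, powerSum ϑ t ∈ Ω →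
      fderiv ℂ (sigma τ m n ϑ) t (Pi.single l (t l)) =
        ϑ l * delta (t l) (τ m n) (powerSum ϑ t) := fun t ht m n ϑ l hp => by
    rw [← mul_pd_eq_fderiv l (differentiableAt_sigma hτ _ _ (hT0 t ht) hp),
      mul_pd_sigma hτ _ _ (hT0 t ht) hp]
  refine ⟨fun t ht i l hil j => ?_, fun t ht i l hil j => ?_, fun t ht i j => ?_, fun t ht i j => ?_⟩
  · have hg := gVar_raise hτ hR hT0 ht (hne t ht l i hil.symm) hil.symm j
    have e2 : 1 - j - 1 = -j := by ring
    have hr : raise θ i l = θ l := by simp [raise, hil.symm]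
    have h1 := hR.sigma_raise_ne_zero t ht j (-j) i
    have h2 := hR.sigma_raise_ne_zero t ht (j - 1) (1 - j) i
    have h3 := hR.sigma_ne_zero t ht (j - 1) (-j)
    have h4 := hR.sigma_ne_zero t ht j (-j - 1)
    -- The logarithmic t_l-derivative of f^{(i)}_j is the raised g^{(l)} minus the unraised one: two
    -- different relations between U, V and g combine here.
    have hV := tauV_eq_tauU_add hτ hR hT0 ht (hne t ht l i hil.symm) j
    have hgl : gFamily τ θ l j t = gVar τ θ l j (-j) t := rfl
    rw [mul_pd_eq_fderiv l ((h.holomorphic_f i j).differentiableAt (hT.mem_nhds ht)),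
      fderiv_fFamily hτ hR hT0 ht, hU ht hil.symm, hU ht hil.symm]
    congr 1
    rw [gVar_eq_logDeriv l (by rw [e2]; exact h1) h2, e2, hr] at hg
    rw [hgl, gVar_eq_logDeriv l h4 h3] at hV
    rw [← mul_pd_eq_fderiv l (differentiableAt_sigma_raise hτ hR hT0 ht _ _ i),
      ← mul_pd_eq_fderiv l (differentiableAt_sigma_raise hτ hR hT0 ht _ _ i),
      ← mul_pd_eq_fderiv l (differentiableAt_sigma hτ _ _ (hT0 t ht) (hR.mem ht)),
      ← mul_pd_eq_fderiv l (differentiableAt_sigma hτ _ _ (hT0 t ht) (hR.mem ht))]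
    linear_combination hg + hV
  · have h1 := hR.tau_ne_zero ht (j - 1) (-j)
    have h2 := hR.tau_ne_zero ht j (-j - 1)
    have h3 := hR.tau_add_ne_zero ht j (-j) i
    have h4 := hR.tau_add_ne_zero ht j (-j) l
    have h5 : t l - t i ≠ 0 := sub_ne_zero.mpr (hne t ht l i hil.symm)
    have hV := tauV_eq_tauU_add hτ hR hT0 ht (hne t ht l i hil.symm) j
    have hr : raise θ i l = θ l := by simp [raise, hil.symm]
    have hl : lower θ i l = θ l := by simp [lower, hil.symm]
    -- The base points p and p + [t_i] are chosen so that the two mixed equations pair one numerator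
    -- factor of g^{(i)} with one denominator factor each.
    have e1 := hτ.mixed (j - 1) (-j - 1) (powerSum θ t) (t l) (t i) (hT0 t ht l) (hT0 t ht i)
      (hne t ht l i hil.symm) (hR.mem ht) (hR.sub_mem ht i) (hR.sub_mem ht l)
      (hR.add_sub_mem ht l i)
    have e2 := hτ.mixed (j - 1) (-j) (powerSum θ t + shiftBy (t i)) (t l) (t i) (hT0 t ht l)
      (hT0 t ht i) (hne t ht l i hil.symm) (hR.add_mem ht i)
      (by rw [add_sub_cancel_right]; exact hR.mem ht) (hR.add_sub_mem ht i l)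
      (by rw [add_right_comm, add_sub_cancel_right]; exact hR.add_mem ht l)
    rw [hirotaDelta, delta_translate] at e1 e2
    rw [add_right_comm _ _ (shiftBy (t l)), add_sub_cancel_right, add_sub_cancel_right] at e2
    simp only [sub_add_cancel] at e1 e2
    have e3 : auxU L (fFamily τ θ) (gFamily τ θ) i l j t * gFamily τ θ l j t +
        auxU L (fFamily τ θ) (gFamily τ θ) l i j t * gFamily τ θ i j t +
        gFamily τ θ i j t * gFamily τ θ l j t =
        tauU τ θ i l j t * gFamily τ θ l j t + tauV τ θ l i j t * gFamily τ θ i j t := by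
      rw [hV, hU ht hil, hU ht hil.symm]
      ring
    rw [e3, mul_pd_eq_fderiv l ((h.holomorphic_g i j).differentiableAt (hT.mem_nhds ht)),
      fderiv_gFamily hT hτ hR hT0 ht, fone t ht _ _ _ _ (hR.mem ht), fone t ht _ _ _ _ (hR.mem ht),
      fone t ht _ _ _ _ (memr t ht i), fone t ht _ _ _ _ (meml t ht i), hr, hl, sigma_raise,
      powerSum_raise, powerSum_lower, gFamily_apply hτ hR hT0 ht, gFamily_apply hτ hR hT0 ht, tauU,
      tauV]
    simp only [sigma, powerSum_lower]
    exact mixed_algebra h5 h1 h2 h3 h4 e1 e2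
  · rw [sum_mul_pd_eq_fderiv ((h.holomorphic_f i j).differentiableAt (hT.mem_nhds ht)),
      fderiv_fFamily hτ hR hT0 ht, fsum t ht _ _ _ (hR.mem ht), fsum t ht _ _ _ (hR.mem ht),
      fsum t ht _ _ _ (memr t ht i), fsum t ht _ _ _ (memr t ht i),
      mul_div_cancel_right₀ _ (hR.sigma_ne_zero t ht _ _),
      mul_div_cancel_right₀ _ (hR.sigma_ne_zero t ht _ _),
      mul_div_cancel_right₀ _ (hR.sigma_raise_ne_zero t ht _ _ _),
      mul_div_cancel_right₀ _ (hR.sigma_raise_ne_zero t ht _ _ _), kappa, kappa,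
      show 1 - j - 1 = -j by ring]
    ring
  -- By the balancing condition the numerator and the denominator of g have equal degree, so g is
  -- homogeneous of degree 0.
  · have hb := hd.balanced (j - 1) (-j - 1)
    simp only [sub_add_cancel] at hb
    have h3 := hR.sigma_ne_zero t ht (j - 1) (-j)
    have h4 := hR.sigma_ne_zero t ht j (-j - 1)
    rw [sum_mul_pd_eq_fderiv ((h.holomorphic_g i j).differentiableAt (hT.mem_nhds ht)),
      fderiv_gFamily hT hτ hR hT0 ht, fsum t ht _ _ _ (hR.mem ht), fsum t ht _ _ _ (hR.mem ht),
      fsum t ht _ _ _ (memr t ht i), fsum t ht _ _ _ (meml t ht i)]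
    field_simp
    linear_combination (θ i * sigma τ (j - 1) (-j - 1) (lower θ i) t *
      sigma τ j (-j) (raise θ i) t) * hb

end

section

variable {N : ℕ}
variable {L : ℕ} {d : ℤ → ℤ → ℂ} {θ : Fin (N + 1) → ℂ} {T : Set (Fin (N + 1) → ℂ)} {f g : Family N}
variable {Ω : Set Pt} {τ : ℤ → ℤ → Pt → ℂ} {W : Set ((Fin (N + 1) → ℂ) × ℂ)}
  {t : Fin (N + 1) → ℂ} {k : ℂ}

/-! ### The reduced wave functions -/

/-- The exponent `∑ₙ xₙ kⁿ` after the substitution. -/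
def waveExponent (θ : Fin (N + 1) → ℂ) (q : (Fin (N + 1) → ℂ) × ℂ) : ℂ :=
  ∑ i, θ i * -Complex.log (1 - q.1 i * q.2)

theorem hasSum_pnat_neg_log {z : ℂ} (hz : ‖z‖ < 1) :
    HasSum (fun n : ℕ+ => z ^ (n : ℕ) / ((n : ℕ) : ℂ)) (-Complex.log (1 - z)) := by
  have h := Complex.hasSum_taylorSeries_neg_log hz
  refine (Function.Injective.hasSum_iff (f := fun n : ℕ => z ^ n / (n : ℂ)) PNat.coe_injective
    fun n hn => ?_).mpr h
  have : n = 0 := by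
    by_contra h0
    exact hn ⟨⟨n, Nat.pos_of_ne_zero h0⟩, rfl⟩
  simp [this]

theorem tsum_powerSum_mul_pow (θ : Fin (N + 1) → ℂ) (h : ∀ i, ‖t i * k‖ < 1) :
    ∑' j : ℕ+, (powerSum θ t).1 j * k ^ (j : ℕ) = waveExponent θ (t, k) := by
  have hs := hasSum_sum (s := Finset.univ) fun i (_ : i ∈ Finset.univ) =>
    (hasSum_pnat_neg_log (h i)).mul_left (θ i)
  rw [waveExponent, ← hs.tsum_eq]
  refine tsum_congr fun n => ?_
  simp only [powerSum, Finset.mul_sum, Finset.sum_mul]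
  refine Finset.sum_congr rfl fun i _ => ?_
  rw [mul_pow]
  ring

theorem phi_eq (τ : ℤ → ℤ → Pt → ℂ) (m n : ℤ) (θ : Fin (N + 1) → ℂ) (h : ∀ i, ‖t i * k‖ < 1) :
    phi τ m n θ t k = τ m (n - 1) (powerSum θ t - shiftBy k⁻¹) / τ m n (powerSum θ t) *
      Complex.exp (waveExponent θ (t, k)) := by
  rw [phi, psi, tsum_powerSum_mul_pow θ h]

theorem one_sub_mem_slitPlane {z : ℂ} (hz : ‖z‖ < 1) : 1 - z ∈ Complex.slitPlane := by
  rw [sub_eq_add_neg]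
  exact Complex.mem_slitPlane_of_norm_lt_one (by rwa [norm_neg])

theorem differentiableAt_waveExponent (θ : Fin (N + 1) → ℂ) (h : ∀ i, ‖t i * k‖ < 1) :
    DifferentiableAt ℂ (waveExponent θ) (t, k) := by
  refine DifferentiableAt.fun_sum fun i _ => DifferentiableAt.const_mul (DifferentiableAt.fun_neg ?_) _
  have h1 : DifferentiableAt ℂ (fun q : (Fin (N + 1) → ℂ) × ℂ => 1 - q.1 i * q.2) (t, k) := by
    fun_prop
  exact h1.clog (one_sub_mem_slitPlane (h i))

theorem exp_waveExponent_raise (θ : Fin (N + 1) → ℂ) (h : ∀ i, ‖t i * k‖ < 1) (i : Fin (N + 1)) :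
    Complex.exp (waveExponent (raise θ i) (t, k)) =
      Complex.exp (waveExponent θ (t, k)) / (1 - t i * k) := by
  have e : waveExponent (raise θ i) (t, k) =
      waveExponent θ (t, k) - Complex.log (1 - t i * k) := by
    simp only [waveExponent, raise, Pi.add_apply, add_mul, Finset.sum_add_distrib]
    rw [sub_eq_add_neg]
    congr 1
    rw [Finset.sum_eq_single i (fun j _ hj => by simp [hj]) (by simp)]
    simp
  rw [e, Complex.exp_sub, Complex.exp_log (Complex.slitPlane_ne_zero (one_sub_mem_slitPlane (h i)))]

theorem mul_pd_waveExponent (θ : Fin (N + 1) → ℂ) (h : ∀ i, ‖t i * k‖ < 1) (i : Fin (N + 1)) :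
    t i * pd i (fun s => waveExponent θ (s, k)) t = θ i * (t i * k / (1 - t i * k)) := by
  have hd : ∀ j, DifferentiableAt ℂ (fun s : Fin (N + 1) → ℂ => θ j * -Complex.log (1 - s j * k)) t :=
    fun j => by
      have h1 : DifferentiableAt ℂ (fun s : Fin (N + 1) → ℂ => 1 - s j * k) t := by fun_prop
      exact (h1.clog (one_sub_mem_slitPlane (h j))).fun_neg.const_mul _
  have e : pd i (fun s => waveExponent θ (s, k)) t =
      ∑ j, pd i (fun s => θ j * -Complex.log (1 - s j * k)) t := pd_sum _ i fun j _ => hd j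
  rw [e, Finset.sum_eq_single i]
  · have h1 : HasDerivAt (fun s : ℂ => θ i * -Complex.log (1 - s * k))
        (θ i * -(-k / (1 - t i * k))) (t i) := by
      refine HasDerivAt.const_mul _ (HasDerivAt.neg ?_)
      refine HasDerivAt.clog ?_ (one_sub_mem_slitPlane (h i))
      simpa using ((hasDerivAt_id (t i)).mul_const k).const_sub 1
    have h2 : pd i (fun s => θ i * -Complex.log (1 - s i * k)) t = θ i * -(-k / (1 - t i * k)) := by
      simp only [pd, Function.update_self]
      exact h1.deriv
    rw [h2]
    ring
  · intro j _ hj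
    simp only [pd, Function.update_of_ne hj]
    simp
  · simp

theorem mul_deriv_waveExponent (θ : Fin (N + 1) → ℂ) (h : ∀ i, ‖t i * k‖ < 1) :
    k * deriv (fun k' => waveExponent θ (t, k')) k = ∑ i, θ i * (t i * k / (1 - t i * k)) := by
  have h1 : HasDerivAt (fun k' => waveExponent θ (t, k'))
      (∑ i, θ i * -(-t i / (1 - t i * k))) k := by
    refine HasDerivAt.fun_sum fun i _ => HasDerivAt.const_mul _ (HasDerivAt.neg ?_)
    refine HasDerivAt.clog ?_ (one_sub_mem_slitPlane (h i))
    simpa using ((hasDerivAt_id k).const_mul (t i)).const_sub 1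
  rw [h1.deriv, Finset.mul_sum]
  refine Finset.sum_congr rfl fun i _ => ?_
  ring

/-! #### Tau functions at shifted arguments -/

theorem differentiableAt_snoc_inv (t : Fin (N + 1) → ℂ) {k : ℂ} (hk : k ≠ 0) :
    DifferentiableAt ℂ (fun q : (Fin (N + 1) → ℂ) × ℂ =>
      (Fin.snoc (α := fun _ => ℂ) q.1 q.2⁻¹ : Fin (N + 2) → ℂ)) (t, k) := by
  rw [differentiableAt_pi]
  intro i
  refine Fin.lastCases ?_ (fun j => ?_) i
  · simp only [Fin.snoc_last]
    exact DifferentiableAt.fun_inv (by fun_prop) hk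
  · simp only [Fin.snoc_castSucc]
    fun_prop

theorem snoc_ne_zero (h0 : ∀ i, t i ≠ 0) {q : ℂ} (hq : q ≠ 0) (i : Fin (N + 2)) :
    (Fin.snoc (α := fun _ => ℂ) t q : Fin (N + 2) → ℂ) i ≠ 0 := by
  refine Fin.lastCases ?_ (fun j => ?_) i
  · simpa using hq
  · simpa using h0 j

theorem differentiableAt_tau_wave (hτ : IsTauSequence L d Ω τ) (m n : ℤ) (h0 : ∀ i, t i ≠ 0)
    (hk : k ≠ 0) (hp : powerSum θ t - shiftBy k⁻¹ ∈ Ω) :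
    DifferentiableAt ℂ (fun q : (Fin (N + 1) → ℂ) × ℂ =>
      τ m n (powerSum θ q.1 - shiftBy q.2⁻¹)) (t, k) := by
  have h := differentiableAt_sigma hτ m n (θ := Fin.snoc (α := fun _ => ℂ) θ (-1))
    (snoc_ne_zero h0 (inv_ne_zero hk)) (by rwa [powerSum_snoc])
  have h2 := DifferentiableAt.comp (t, k) h (differentiableAt_snoc_inv t hk)
  simpa only [Function.comp_def, sigma, powerSum_snoc] using h2

theorem mul_pd_tau_wave (hτ : IsTauSequence L d Ω τ) (m n : ℤ) (h0 : ∀ i, t i ≠ 0)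
    (hk : k ≠ 0) (hp : powerSum θ t - shiftBy k⁻¹ ∈ Ω) (i : Fin (N + 1)) :
    t i * pd i (fun s => τ m n (powerSum θ s - shiftBy k⁻¹)) t =
      θ i * delta (t i) (τ m n) (powerSum θ t - shiftBy k⁻¹) := by
  have h := mul_pd_sigma hτ m n (θ := Fin.snoc (α := fun _ => ℂ) θ (-1))
    (snoc_ne_zero h0 (inv_ne_zero hk)) (by rwa [powerSum_snoc]) i.castSucc
  rw [powerSum_snoc, Fin.snoc_castSucc, Fin.snoc_castSucc] at h
  rw [← h]
  simp only [pd, sigma, Fin.snoc_castSucc, ← Fin.snoc_update, powerSum_snoc]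

/-- Here k⁻¹ plays the role of the additional variable with exponent -1. Inverting it reverses the
logarithmic derivative, and the two signs cancel. -/
theorem mul_deriv_tau_wave (hτ : IsTauSequence L d Ω τ) (m n : ℤ) (h0 : ∀ i, t i ≠ 0)
    (hk : k ≠ 0) (hp : powerSum θ t - shiftBy k⁻¹ ∈ Ω) :
    k * deriv (fun k' => τ m n (powerSum θ t - shiftBy k'⁻¹)) k =
      delta k⁻¹ (τ m n) (powerSum θ t - shiftBy k⁻¹) := by
  have hs := snoc_ne_zero h0 (inv_ne_zero hk)
  have hp' : powerSum (Fin.snoc (α := fun _ => ℂ) θ (-1)) (Fin.snoc (α := fun _ => ℂ) t k⁻¹) ∈ Ω := by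
    rwa [powerSum_snoc]
  have h := mul_pd_sigma hτ m n hs hp' (Fin.last _)
  have hd := hasDerivAt_comp_update (Fin.last _) (differentiableAt_sigma hτ m n hs hp')
  rw [← pd_eq_fderiv _ (differentiableAt_sigma hτ m n hs hp')] at hd
  simp only [Fin.snoc_last, Fin.update_snoc_last, sigma, powerSum_snoc] at h hd
  have hc := hd.comp k (hasDerivAt_inv hk)
  rw [show (fun k' => τ m n (powerSum θ t - shiftBy k'⁻¹)) =
    (fun s => τ m n (powerSum θ t - shiftBy s)) ∘ fun k' => k'⁻¹ from rfl, hc.deriv]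
  have e : k * (-(k ^ 2)⁻¹) = - k⁻¹ := by field_simp
  rw [mul_left_comm, e]
  linear_combination -h

theorem euler_tau_wave (hτ : IsTauSequence L d Ω τ) (m n : ℤ)
    (hp : powerSum θ t - shiftBy k⁻¹ ∈ Ω) :
    ∑ i, θ i * delta (t i) (τ m n) (powerSum θ t - shiftBy k⁻¹)
      - delta k⁻¹ (τ m n) (powerSum θ t - shiftBy k⁻¹) =
      d m n * τ m n (powerSum θ t - shiftBy k⁻¹) := by
  have hp' : powerSum (Fin.snoc (α := fun _ => ℂ) θ (-1)) (Fin.snoc (α := fun _ => ℂ) t k⁻¹) ∈ Ω := by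
    rwa [powerSum_snoc]
  have h := euler_powerSum hτ.domain (hτ.holomorphic m n) hp'
  rw [hτ.homogeneous m n _ hp', Fin.sum_univ_castSucc] at h
  simp only [Fin.snoc_last, Fin.snoc_castSucc, powerSum_snoc] at h
  linear_combination -h

theorem IsReductionDomain.wave_add_mem (hR : IsReductionDomain Ω τ θ T W) (hW : (t, k) ∈ W)
    (i : Fin (N + 1)) : powerSum θ t + shiftBy (t i) - shiftBy k⁻¹ ∈ Ω := by
  have h := hR.mem_domain_wave _ hW (Pi.single i 1)
  rw [← powerSum_raise]
  convert h using 3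
  funext j
  simp only [raise, Pi.add_apply, Pi.single_apply]
  push_cast
  rfl

theorem IsReductionDomain.wave_mem (hR : IsReductionDomain Ω τ θ T W) (hW : (t, k) ∈ W) :
    powerSum θ t - shiftBy k⁻¹ ∈ Ω := by
  simpa using hR.mem_domain_wave _ hW 0

theorem differentiableAt_phi (hτ : IsTauSequence L d Ω τ) (hR : IsReductionDomain Ω τ θ T W)
    (hT0 : ∀ t ∈ T, ∀ i, t i ≠ 0) (hW : (t, k) ∈ W) (m n : ℤ) :
    DifferentiableAt ℂ (fun q : (Fin (N + 1) → ℂ) × ℂ => phi τ m n θ q.1 q.2) (t, k) := by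
  have ht := hR.mem_T _ hW
  have hk := hR.k_ne_zero _ hW
  have h : (fun q : (Fin (N + 1) → ℂ) × ℂ => phi τ m n θ q.1 q.2) =ᶠ[nhds (t, k)] fun q =>
      τ m (n - 1) (powerSum θ q.1 - shiftBy q.2⁻¹) / τ m n (powerSum θ q.1) *
        Complex.exp (waveExponent θ q) :=
    Filter.eventually_of_mem (hR.isOpen.mem_nhds hW) fun q hq => phi_eq τ m n θ (hR.convergent q hq)
  refine DifferentiableAt.congr_of_eventuallyEq (DifferentiableAt.fun_mul
    (differentiableAt_div (differentiableAt_tau_wave hτ m _ (hT0 t ht) hk (hR.wave_mem hW)) ?_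
      (hR.tau_ne_zero ht m n)) (differentiableAt_waveExponent θ (hR.convergent _ hW)).cexp) h
  exact DifferentiableAt.comp (t, k) (g := sigma τ m n θ) (f := Prod.fst)
    (differentiableAt_sigma hτ m n (hT0 t ht) (hR.mem ht)) differentiableAt_fst

/-- The first UC equation at the point shifted by [t_i], with t = k⁻¹ and s = t_i, multiplied by k.
The factor 1 - t_i k that appears is the one by which raising θ_i divides the exponential. -/
theorem phi_difference (hτ : IsTauSequence L d Ω τ) (hR : IsReductionDomain Ω τ θ T W)
    (hT0 : ∀ t ∈ T, ∀ i, t i ≠ 0) (hW : (t, k) ∈ W) (m n : ℤ) (i : Fin (N + 1)) :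
    phi τ m n θ t k = 1 / fVar τ θ i (m + 1) (n + 1) t * phi τ m (n + 1) (raise θ i) t k
      - t i * k * phi τ (m + 1) n (raise θ i) t k := by
  have ht : t ∈ T := hR.mem_T _ hW
  have hk : k ≠ 0 := hR.k_ne_zero _ hW
  have hc := hR.convergent _ hW
  have e := tau_difference hτ (m + 1) n (p := powerSum θ t + shiftBy (t i)) (inv_ne_zero hk)
    (hT0 t ht i) (hR.add_mem ht i) (hR.wave_add_mem hW i)
    (by rw [add_sub_cancel_right]; exact hR.mem ht)
    (by rw [sub_right_comm, add_sub_cancel_right]; exact hR.wave_mem hW)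
  rw [sub_right_comm _ (shiftBy k⁻¹), add_sub_cancel_right, add_sub_cancel_right] at e
  have h1 := hR.tau_ne_zero ht m n
  have h2 := hR.tau_ne_zero ht (m + 1) (n - 1)
  have h3 := hR.tau_add_ne_zero ht m (n + 1) i
  have h4 := hR.tau_add_ne_zero ht (m + 1) n i
  have h5 : 1 - t i * k ≠ 0 := Complex.slitPlane_ne_zero (one_sub_mem_slitPlane (hc i))
  rw [phi_eq τ m n θ hc, phi_eq τ m (n + 1) _ hc, phi_eq τ (m + 1) n _ hc,
    exp_waveExponent_raise θ hc, fVar]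
  simp only [sigma_raise, powerSum_raise, add_sub_cancel_right,
    show n + 1 - 2 = n - 1 by ring]
  simp only [sigma]
  have e' := congrArg (k * ·) e
  simp only [mul_zero, mul_add, mul_sub, ← mul_assoc, mul_inv_cancel₀ hk, sub_mul, one_mul] at e'
  generalize shiftBy k⁻¹ = q at *
  generalize hb : 1 - t i * k = b at *
  field_simp
  linear_combination e' - τ m (n - 1) (powerSum θ t - q) *
    τ (m + 1) n (powerSum θ t + shiftBy (t i)) * hb

theorem mul_pd_phi (hτ : IsTauSequence L d Ω τ) (hR : IsReductionDomain Ω τ θ T W)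
    (hT0 : ∀ t ∈ T, ∀ i, t i ≠ 0) (hW : (t, k) ∈ W) (m n : ℤ) (i : Fin (N + 1)) :
    t i * pd i (fun s => phi τ m n θ s k) t =
      (θ i * delta (t i) (τ m (n - 1)) (powerSum θ t - shiftBy k⁻¹) / τ m n (powerSum θ t) -
        τ m (n - 1) (powerSum θ t - shiftBy k⁻¹) *
          (θ i * delta (t i) (τ m n) (powerSum θ t)) / τ m n (powerSum θ t) ^ 2 +
        τ m (n - 1) (powerSum θ t - shiftBy k⁻¹) / τ m n (powerSum θ t) *
          (θ i * (t i * k / (1 - t i * k)))) * Complex.exp (waveExponent θ (t, k)) := by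
  have ht : t ∈ T := hR.mem_T _ hW
  have hk : k ≠ 0 := hR.k_ne_zero _ hW
  have hc := hR.convergent _ hW
  have hi : DifferentiableAt ℂ (fun s : Fin (N + 1) → ℂ => (s, k)) t := by fun_prop
  have h : (fun s => phi τ m n θ s k) =ᶠ[nhds t] fun s =>
      τ m (n - 1) (powerSum θ s - shiftBy k⁻¹) / τ m n (powerSum θ s) *
        Complex.exp (waveExponent θ (s, k)) :=
    (hi.continuousAt.eventually (hR.isOpen.mem_nhds hW)).mono fun s hs =>
      phi_eq τ m n θ (hR.convergent _ hs)
  have d1 : DifferentiableAt ℂ (fun s => τ m (n - 1) (powerSum θ s - shiftBy k⁻¹)) t :=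
    DifferentiableAt.comp t (f := fun s : Fin (N + 1) → ℂ => (s, k))
      (differentiableAt_tau_wave hτ m (n - 1) (hT0 t ht) hk (hR.wave_mem hW)) hi
  have d2 : DifferentiableAt ℂ (fun s => τ m n (powerSum θ s)) t :=
    differentiableAt_sigma hτ m n (hT0 t ht) (hR.mem ht)
  have d3 : DifferentiableAt ℂ (fun s => waveExponent θ (s, k)) t :=
    DifferentiableAt.comp t (g := waveExponent θ) (f := fun s : Fin (N + 1) → ℂ => (s, k))
      (differentiableAt_waveExponent θ hc) hi
  have h0 := hR.tau_ne_zero ht m n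
  have e2 : t i * pd i (fun s => τ m n (powerSum θ s)) t = _ :=
    mul_pd_sigma hτ m n (hT0 t ht) (hR.mem ht) i
  rw [pd_congr i h, pd_mul i (differentiableAt_div d1 d2 h0) d3.cexp, pd_div i d1 d2 h0, pd_exp i d3,
    ← mul_pd_tau_wave hτ m (n - 1) (hT0 t ht) hk (hR.wave_mem hW), ← e2,
    ← mul_pd_waveExponent θ hc]
  field_simp

/-- The mixed UC equation with t = t_i and s = k⁻¹. Both forms of g are used: the logarithmic
derivative for the term proportional to φ_{m,n}, and the quotient of tau functions for the raised
term. -/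
theorem phi_differential (hτ : IsTauSequence L d Ω τ)
    (hR : IsReductionDomain Ω τ θ T W)
    (hT0 : ∀ t ∈ T, ∀ i, t i ≠ 0) (hW : (t, k) ∈ W) (m n : ℤ) (i : Fin (N + 1)) :
    t i * pd i (fun s => phi τ m n θ s k) t =
      (gVar τ θ i (m + 1) n t - θ i) * phi τ m n θ t k
        + t i * k * gVar τ θ i (m + 1) n t * phi τ (m + 1) n (raise θ i) t k := by
  have ht : t ∈ T := hR.mem_T _ hW
  have hk : k ≠ 0 := hR.k_ne_zero _ hW
  have hc := hR.convergent _ hW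
  have h1 := hR.tau_ne_zero ht m n
  have h2 := hR.tau_ne_zero ht (m + 1) (n - 1)
  have h4 := hR.tau_add_ne_zero ht (m + 1) n i
  have h5 : 1 - t i * k ≠ 0 := Complex.slitPlane_ne_zero (one_sub_mem_slitPlane (hc i))
  have hne : t i ≠ k⁻¹ := fun h => h5 (by rw [h, inv_mul_cancel₀ hk, sub_self])
  have e := hτ.mixed m (n - 1) (powerSum θ t) (t i) k⁻¹ (hT0 t ht i) (inv_ne_zero hk) hne
    (hR.mem ht) (hR.wave_mem hW) (hR.sub_mem ht i) (hR.wave_add_mem hW i)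
  have hs : t i / (k⁻¹ - t i) = t i * k / (1 - t i * k) := by
    have : k⁻¹ - t i ≠ 0 := sub_ne_zero.mpr hne.symm
    field_simp
  have hs' : t i / (t i - k⁻¹) = - (t i * k / (1 - t i * k)) := by
    rw [← hs, ← div_neg, neg_sub]
  rw [hirotaDelta, delta_translate, hs, hs'] at e
  have hg1 : gVar τ θ i (m + 1) n t - θ i =
      θ i * delta (t i) (τ (m + 1) (n - 1)) (powerSum θ t) / τ (m + 1) (n - 1) (powerSum θ t) -
        θ i * delta (t i) (τ m n) (powerSum θ t) / τ m n (powerSum θ t) := by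
    have h := gVar_eq_logDeriv (τ := τ) (m := m + 1) (n := n) i h2
      (by rw [add_sub_cancel_right]; exact h1)
    rw [add_sub_cancel_right, mul_pd_sigma hτ _ _ (hT0 t ht) (hR.mem ht),
      mul_pd_sigma hτ _ _ (hT0 t ht) (hR.mem ht)] at h
    rw [h, add_sub_cancel_right]
    rfl
  have hg2 := gVar_eq_of_ne_zero hτ (hT0 t ht) (m + 1) n i (hR.mem ht) (hR.sub_mem ht i)
    (hR.add_mem ht i) h2 (by rw [add_sub_cancel_right]; exact h1)
  rw [add_sub_cancel_right] at hg2
  rw [mul_pd_phi hτ hR hT0 hW, hg1, hg2, phi_eq τ m n θ hc, phi_eq τ (m + 1) n _ hc,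
    exp_waveExponent_raise θ hc, powerSum_raise]
  generalize shiftBy k⁻¹ = q at *
  generalize 1 - t i * k = b at *
  field_simp at e ⊢
  linear_combination θ i * τ m n (powerSum θ t) * e

/-- The wave exponent depends only on the products t_i k, so k ∂/∂k - ∑ t_i ∂/∂t_i annihilates it.
What remains are the degrees of the two tau functions. -/
theorem phi_euler (hτ : IsTauSequence L d Ω τ)
    (hR : IsReductionDomain Ω τ θ T W)
    (hT0 : ∀ t ∈ T, ∀ i, t i ≠ 0) (hW : (t, k) ∈ W) (m n : ℤ) :
    k * deriv (fun k' => phi τ m n θ t k') k - ∑ i, t i * pd i (fun s => phi τ m n θ s k) t =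
      (d m n - d m (n - 1)) * phi τ m n θ t k := by
  have ht : t ∈ T := hR.mem_T _ hW
  have hk : k ≠ 0 := hR.k_ne_zero _ hW
  have hc := hR.convergent _ hW
  have h0 := hR.tau_ne_zero ht m n
  have hi : DifferentiableAt ℂ (fun k' : ℂ => (t, k')) k := by fun_prop
  have h : (fun k' => phi τ m n θ t k') =ᶠ[nhds k] fun k' =>
      τ m (n - 1) (powerSum θ t - shiftBy k'⁻¹) / τ m n (powerSum θ t) *
        Complex.exp (waveExponent θ (t, k')) :=
    (hi.continuousAt.eventually (hR.isOpen.mem_nhds hW)).mono fun s hs =>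
      phi_eq τ m n θ (hR.convergent _ hs)
  have d1 : DifferentiableAt ℂ (fun k' => τ m (n - 1) (powerSum θ t - shiftBy k'⁻¹)) k :=
    DifferentiableAt.comp k (f := fun k' : ℂ => (t, k'))
      (differentiableAt_tau_wave hτ m (n - 1) (hT0 t ht) hk (hR.wave_mem hW)) hi
  have d3 : DifferentiableAt ℂ (fun k' => waveExponent θ (t, k')) k :=
    DifferentiableAt.comp k (g := waveExponent θ) (f := fun k' : ℂ => (t, k'))
      (differentiableAt_waveExponent θ hc) hi
  have hd := (d1.hasDerivAt.div_const (τ m n (powerSum θ t))).mul d3.hasDerivAt.cexp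
  have e1 := mul_deriv_tau_wave hτ m (n - 1) (hT0 t ht) hk (hR.wave_mem hW)
  have e2 := mul_deriv_waveExponent θ hc
  have e3 := euler_tau_wave hτ m (n - 1) (hR.wave_mem hW)
  have e4 := (euler_powerSum hτ.domain (hτ.holomorphic m n) (hR.mem ht)).symm.trans
    (hτ.homogeneous m n _ (hR.mem ht))
  rw [h.deriv_eq, phi_eq τ m n θ hc, Finset.sum_congr rfl fun i _ => mul_pd_phi hτ hR hT0 hW m n i,
    ← Finset.sum_mul, Finset.sum_add_distrib, Finset.sum_sub_distrib, ← Finset.sum_div,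
    ← Finset.sum_div, ← Finset.mul_sum, ← Finset.mul_sum, ← e2, e4]
  refine (congrArg (k * · - _) hd.deriv).trans ?_
  simp only []
  rw [eq_add_of_sub_eq e3, ← e1]
  field_simp
  ring

end

section

variable {N : ℕ}
variable {L : ℕ} {d : ℤ → ℤ → ℂ} {θ : Fin (N + 1) → ℂ} {T : Set (Fin (N + 1) → ℂ)} {f g : Family N}
variable {Ω : Set Pt} {τ : ℤ → ℤ → Pt → ℂ} {W : Set ((Fin (N + 1) → ℂ) × ℂ)}
  {t : Fin (N + 1) → ℂ} {k : ℂ}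

/-! ### The linear system for the wave functions -/

theorem coeffB_mulVec (L : ℕ) (θ : Fin (N + 1) → ℂ) (f g : Family N) (i : Fin (N + 1))
    (t : Fin (N + 1) → ℂ) (z : ℂ) (x : Fin L → ℂ) (j : Fin L) :
    (coeffB L θ f g i t z).mulVec x j =
      (θ i / (L * (t i ^ L)⁻¹) - vEntry L f g i t j j) * x j + 1 / (z - (t i ^ L)⁻¹) *
        ∑ n, (if n ≤ j then z else 1) * (vEntry L f g i t j n * x n) := by
  rw [coeffB, Matrix.add_mulVec, Matrix.add_mulVec, Matrix.smul_mulVec, Matrix.smul_mulVec]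
  simp only [Pi.add_apply, Pi.smul_apply, Matrix.mulVec_diagonal, smul_eq_mul]
  simp only [Matrix.mulVec, dotProduct, Matrix.of_apply, Finset.mul_sum]
  rw [add_assoc, ← Finset.sum_add_distrib]
  congr 1
  refine Finset.sum_congr rfl fun n _ => ?_
  by_cases h : n ≤ j
  · simp only [h, h.not_gt, if_true, if_false]; ring
  · simp only [h, not_le.mp h, if_true, if_false]; ring

/-- For entries above the diagonal 1/z - 1/(z - u_i) = -u_i/(z(z - u_i)), which matches the factor
of the remaining entries up to z. A is thereby expressed by the same row sums as the B_i in
`coeffB_mulVec`. -/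
theorem coeffA_mulVec (d : ℤ → ℤ → ℂ) (f g : Family N) {t : Fin (N + 1) → ℂ} {z : ℂ} (hz : z ≠ 0)
    (h0 : ∀ i, t i ≠ 0) (hzu : ∀ i, z - (t i ^ L)⁻¹ ≠ 0) (x : Fin L → ℂ) (j : Fin L) :
    (coeffA L d f g t z).mulVec x j = expZero L d j / z * x j -
      ∑ i, (t i ^ L)⁻¹ / (z * (z - (t i ^ L)⁻¹)) *
        ∑ n, (if n ≤ j then z else 1) * (vEntry L f g i t j n * x n) := by
  have hZ : (resZero L d f g t).mulVec x j = expZero L d j * x j +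
      ∑ i, ∑ n, (if n ≤ j then 0 else 1) * (vEntry L f g i t j n * x n) := by
    rw [Finset.sum_comm, Matrix.mulVec, dotProduct]
    have e : expZero L d j * x j = ∑ n, if j = n then expZero L d n * x n else 0 := by simp
    rw [e, ← Finset.sum_add_distrib]
    refine Finset.sum_congr rfl fun n _ => ?_
    rw [resZero, Matrix.of_apply]
    rcases lt_trichotomy j n with h | rfl | h
    · simp [h.ne, h, h.not_ge, Finset.sum_mul]
    · simp
    · simp [h.ne', h.le, h.not_gt]
  rw [coeffA, Matrix.sum_mulVec, Finset.sum_apply, Fin.sum_univ_castSucc]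
  simp only [residues_castSucc, residues_last, sing_castSucc, sing_last, Matrix.smul_mulVec,
    Pi.smul_apply, smul_eq_mul, sub_zero]
  rw [hZ, mul_add, ← add_assoc, add_right_comm, Finset.mul_sum, ← Finset.sum_add_distrib,
    add_comm, sub_eq_add_neg, ← Finset.sum_neg_distrib]
  congr 1
  · ring
  refine Finset.sum_congr rfl fun i _ => ?_
  rw [Matrix.mulVec, dotProduct, Finset.mul_sum, Finset.mul_sum, Finset.mul_sum,
    ← Finset.sum_add_distrib, ← Finset.sum_neg_distrib]
  refine Finset.sum_congr rfl fun n _ => ?_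
  have hu := hzu i
  have hi := inv_ne_zero (pow_ne_zero L (h0 i))
  rw [resA, Matrix.of_apply]
  generalize (t i ^ L)⁻¹ = u at *
  by_cases h : n ≤ j
  · simp only [h, h.not_gt, if_true, if_false]
    field_simp
    ring
  · simp only [h, not_le.mp h, if_true, if_false]
    field_simp
    ring

theorem phi_periodic (hτ : IsTauSequence L d Ω τ) (m n : ℤ)
    (h1 : powerSum θ t ∈ Ω) (h2 : powerSum θ t - shiftBy k⁻¹ ∈ Ω) :
    phi τ (m + L) (n - L) θ t k = phi τ m n θ t k := by
  have per : ∀ m n p, p ∈ Ω → τ (m + L) (n - L) p = τ m n p := fun m n p hp => by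
    have h := hτ.periodic_right m (n - L) _ hp
    rw [sub_add_cancel] at h
    rw [hτ.periodic_left m _ _ hp, ← h]
  rw [phi, psi, phi, psi, per _ _ _ h1, sub_right_comm, per _ _ _ h2]

theorem pow_ne_inv_pow (hL : L ≠ 0) {i : Fin (N + 1)} (h0 : t i ≠ 0) (h : ‖t i * k‖ < 1) :
    k ^ L - (t i ^ L)⁻¹ ≠ 0 := by
  intro h'
  have h1 : (t i * k) ^ L = 1 := by
    rw [mul_pow, sub_eq_zero.mp h', mul_inv_cancel₀ (pow_ne_zero L h0)]
  have h2 := congrArg norm h1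
  rw [norm_pow, norm_one] at h2
  exact (pow_lt_one₀ (norm_nonneg _) h hL).ne h2

/-- Along (m, -m) the difference equation links consecutive raised wave functions, with the unraised
ones as source. Multiplied by k^n c_n it is a summation, closed up by periodicity with multiplier
u_i/z. Its solution eliminates the raised functions in favour of Φ. -/
theorem wave_recursion (hL : L ≠ 0) (hT : IsOpen T) (hτ : IsTauSequence L d Ω τ)
    (hR : IsReductionDomain Ω τ θ T W)
    (hT0 : ∀ t ∈ T, ∀ i, t i ≠ 0) (hW : (t, k) ∈ W) (i : Fin (N + 1)) (j : Fin L) :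
    t i * k * gFamily τ θ i (j : ℤ) t * (k ^ (j : ℕ) * phi τ (j : ℤ) (-(j : ℤ)) (raise θ i) t k) =
      -(L * (t i ^ L)⁻¹ / (k ^ L - (t i ^ L)⁻¹)) *
        ∑ n, (if n ≤ j then k ^ L else 1) *
          (vEntry L (fFamily τ θ) (gFamily τ θ) i t j n * PhiVec L τ θ t k n) := by
  have ht : t ∈ T := hR.mem_T _ hW
  have hk : k ≠ 0 := hR.k_ne_zero _ hW
  have h0 := hT0 t ht
  have h := isAdmissible_of_tau hT hτ hR hT0
  have hzu : k ^ L - (t i ^ L)⁻¹ ≠ 0 := pow_ne_inv_pow hL (h0 i) (hR.convergent _ hW i)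
  have hL' : (L : ℂ) ≠ 0 := by exact_mod_cast hL
  set γ := cNat (fFamily τ θ) i t
  have hγd : ∀ n, cNat (fFamily τ θ) i t n = γ n := fun _ => rfl
  have hγ : ∀ n, γ n ≠ 0 := fun n => cNat_ne_zero h ht (h0 i) n
  have hrec : ∀ m : ℤ, phi τ m (-m) (raise θ i) t k = fFamily τ θ i (m + 1) t *
      (phi τ m (-(m + 1)) θ t k + t i * k * phi τ (m + 1) (-(m + 1)) (raise θ i) t k) := by
    intro m
    have e := phi_difference hτ hR hT0 hW m (-(m + 1)) i
    rw [show -(m + 1) + 1 = 1 - (m + 1) by ring] at e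
    have hf : fVar τ θ i (m + 1) (1 - (m + 1)) t = fFamily τ θ i (m + 1) t := rfl
    rw [hf] at e
    have hf0 := h.f_ne_zero i (m + 1) t ht
    rw [e, show 1 - (m + 1) = -m by ring]
    field_simp
    ring
  have hr1 : powerSum (raise θ i) t ∈ Ω := by rw [powerSum_raise]; exact hR.add_mem ht i
  have hr2 : powerSum (raise θ i) t - shiftBy k⁻¹ ∈ Ω := by
    rw [powerSum_raise]; exact hR.wave_add_mem hW i
  have key := quasiperiodic_recursion (L := L)
    (X := fun n => t i * k * (k ^ n * γ n * phi τ (n : ℤ) (-(n : ℤ)) (raise θ i) t k))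
    (y := fun n => γ n * (k ^ n * phi τ ((n : ℤ) - 1) (-(n : ℤ)) θ t k))
    (q := (t i ^ L)⁻¹ / k ^ L)
    (fun n => by
      rw [hrec n]
      push_cast
      rw [add_sub_cancel_right, show γ (n + 1) = γ n * _ from cNat_succ _ i t n]
      ring)
    (by
      have e := phi_periodic hτ 0 (-0) hr1 hr2
      rw [zero_add, neg_zero, zero_sub] at e
      rw [show γ L = _ from cNat_period h ht i, e]
      have h1 := pow_ne_zero L (h0 i)
      simp only [γ, cNat_zero, Nat.cast_zero, pow_zero, neg_zero]
      field_simp)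
    (by
      have e := phi_periodic hτ (-1) 0 (hR.mem ht) (hR.wave_mem hW)
      rw [zero_sub, neg_add_eq_sub] at e
      rw [show γ L = _ from cNat_period h ht i, e]
      have h1 := pow_ne_zero L (h0 i)
      simp only [γ, cNat_zero, Nat.cast_zero, pow_zero, neg_zero, zero_sub]
      field_simp) j.2
  rw [Finset.sum_range] at key
  have hsum : ∑ n, (if n ≤ j then k ^ L else 1) *
          (vEntry L (fFamily τ θ) (gFamily τ θ) i t j n * PhiVec L τ θ t k n) =
      gFamily τ θ i (j : ℤ) t / (L * γ j) * (t i ^ L * k ^ L) *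
        ∑ n : Fin L, (if (n : ℕ) ≤ j then 1 else (t i ^ L)⁻¹ / k ^ L) *
          (γ n * (k ^ (n : ℕ) * phi τ ((n : ℤ) - 1) (-(n : ℤ)) θ t k)) := by
    rw [Finset.mul_sum]
    refine Finset.sum_congr rfl fun n _ => ?_
    have h1 := hγ j
    have h2 := pow_ne_zero L (h0 i)
    by_cases hn : n ≤ j
    · rw [vEntry_eq_of_le h ht (h0 i) hn, if_pos hn, if_pos (Fin.le_def.mp hn), PhiVec]
      simp only [hγd]
      field_simp
    · rw [vEntry_eq_of_lt h ht (h0 i) (not_le.mp hn), if_neg hn,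
        if_neg (fun hn' => hn (Fin.le_def.mpr hn')), PhiVec]
      simp only [hγd]
      field_simp
  rw [hsum, ← key]
  have h1 := hγ j
  have h2 := inv_ne_zero (pow_ne_zero L (h0 i))
  have h3 := pow_ne_zero L hk
  generalize hu : (t i ^ L)⁻¹ = u at *
  rw [show t i ^ L = u⁻¹ by rw [← hu, inv_inv]]
  field_simp
  ring

theorem mul_pd_PhiVec (hL : L ≠ 0) (hT : IsOpen T) (hτ : IsTauSequence L d Ω τ)
    (hR : IsReductionDomain Ω τ θ T W)
    (hT0 : ∀ t ∈ T, ∀ i, t i ≠ 0) (hW : (t, k) ∈ W) (i : Fin (N + 1)) (j : Fin L) :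
    t i * pd i (fun s => PhiVec L τ θ s k j) t =
      (gFamily τ θ i (j : ℤ) t - θ i) * PhiVec L τ θ t k j
      - L * (t i ^ L)⁻¹ / (k ^ L - (t i ^ L)⁻¹) *
        ∑ n, (if n ≤ j then k ^ L else 1) *
          (vEntry L (fFamily τ θ) (gFamily τ θ) i t j n * PhiVec L τ θ t k n) := by
  have e := wave_recursion hL hT hτ hR hT0 hW i j
  have e2 := phi_differential hτ hR hT0 hW ((j : ℤ) - 1) (-(j : ℤ)) i
  rw [sub_add_cancel] at e2
  have hg : gVar τ θ i (j : ℤ) (-(j : ℤ)) t = gFamily τ θ i (j : ℤ) t := rfl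
  rw [hg] at e2
  have e3 : pd i (fun s => PhiVec L τ θ s k j) t =
      k ^ (j : ℕ) * pd i (fun s => phi τ ((j : ℤ) - 1) (-(j : ℤ)) θ s k) t := pd_const_mul _ _
  rw [e3, mul_left_comm, e2, sub_eq_add_neg _ (_ * _), ← neg_mul, ← e]
  simp only [PhiVec]
  ring

theorem pdU_PhiVec (hL : L ≠ 0) (hT : IsOpen T) (hτ : IsTauSequence L d Ω τ)
    (hR : IsReductionDomain Ω τ θ T W)
    (hT0 : ∀ t ∈ T, ∀ i, t i ≠ 0) (hW : (t, k) ∈ W) (i : Fin (N + 1)) (j : Fin L) :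
    pdU L i (fun s => PhiVec L τ θ s k j) t =
      (coeffB L θ (fFamily τ θ) (gFamily τ θ) i t (k ^ L)).mulVec (PhiVec L τ θ t k) j := by
  have ht : t ∈ T := hR.mem_T _ hW
  have h := isAdmissible_of_tau hT hτ hR hT0
  have hzu : k ^ L - (t i ^ L)⁻¹ ≠ 0 := pow_ne_inv_pow hL (hT0 t ht i) (hR.convergent _ hW i)
  have hL' : (L : ℂ) ≠ 0 := by exact_mod_cast hL
  have h1 := pow_ne_zero L (hT0 t ht i)
  rw [pdU_eq i hL (hT0 t ht i), mul_pd_PhiVec hL hT hτ hR hT0 hW, coeffB_mulVec,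
    vEntry_eq_of_le h ht (hT0 t ht i) le_rfl, div_self (cNat_ne_zero h ht (hT0 t ht i) _)]
  have e : t i ^ L * (t i ^ L)⁻¹ = 1 := mul_inv_cancel₀ h1
  generalize k ^ L - (t i ^ L)⁻¹ = b at *
  field_simp
  ring

/-- Homogeneity trades k ∂/∂k for the sum of the deformation equations. With ∑_i g^{(i)}_j =
κ_{j,-j}, the constant terms (the power k^j, the degrees, κ and ∑ θ_i) add up to L e_j. -/
theorem deriv_PhiVec (hL : L ≠ 0) (hT : IsOpen T) (hτ : IsTauSequence L d Ω τ)
    (hR : IsReductionDomain Ω τ θ T W)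
    (hT0 : ∀ t ∈ T, ∀ i, t i ≠ 0) (hW : (t, k) ∈ W) (j : Fin L) :
    deriv (fun k' => PhiVec L τ θ t k' j) k / deriv (fun k' : ℂ => k' ^ L) k =
      (coeffA L d (fFamily τ θ) (gFamily τ θ) t (k ^ L)).mulVec (PhiVec L τ θ t k) j := by
  have ht : t ∈ T := hR.mem_T _ hW
  have hk : k ≠ 0 := hR.k_ne_zero _ hW
  have h := isAdmissible_of_tau hT hτ hR hT0
  have hL' : (L : ℂ) ≠ 0 := by exact_mod_cast hL
  have hzu : ∀ i, k ^ L - (t i ^ L)⁻¹ ≠ 0 := fun i => pow_ne_inv_pow hL (hT0 t ht i) (hR.convergent _ hW i)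
  have hd : DifferentiableAt ℂ (fun k' => phi τ ((j : ℤ) - 1) (-(j : ℤ)) θ t k') k :=
    DifferentiableAt.comp k (f := fun k' : ℂ => (t, k'))
      (differentiableAt_phi hτ hR hT0 hW ((j : ℤ) - 1) (-(j : ℤ))) (by fun_prop)
  have e1 : k * deriv (fun k' => PhiVec L τ θ t k' j) k = j * PhiVec L τ θ t k j +
      k ^ (j : ℕ) * (k * deriv (fun k' => phi τ ((j : ℤ) - 1) (-(j : ℤ)) θ t k') k) := by
    have := (hasDerivAt_pow (j : ℕ) k).mul hd.hasDerivAt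
    refine (congrArg (k * ·) this.deriv).trans ?_
    rw [PhiVec]
    rcases Nat.eq_zero_or_pos (j : ℕ) with h0 | h0
    · simp [h0]
    · have : k ^ (j : ℕ) = k ^ ((j : ℕ) - 1) * k := by rw [← pow_succ, Nat.sub_add_cancel h0]
      rw [this]
      ring
  have e2 := phi_euler hτ hR hT0 hW ((j : ℤ) - 1) (-(j : ℤ))
  have e3 : k ^ (j : ℕ) *
      ∑ i, t i * pd i (fun s => phi τ ((j : ℤ) - 1) (-(j : ℤ)) θ s k) t =
      ∑ i, t i * pd i (fun s => PhiVec L τ θ s k j) t := by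
    rw [Finset.mul_sum]
    refine Finset.sum_congr rfl fun i _ => ?_
    rw [mul_left_comm]
    congr 1
    exact (pd_const_mul _ _).symm
  rw [Finset.sum_congr rfl fun i _ => mul_pd_PhiVec hL hT hτ hR hT0 hW i j,
    Finset.sum_sub_distrib, ← Finset.sum_mul, Finset.sum_sub_distrib, h.sum_g_kappa j t ht,
    kappa] at e3
  have e4 : deriv (fun k' : ℂ => k' ^ L) k = L * k ^ L / k := by
    rw [(hasDerivAt_pow L k).deriv, ← Nat.sub_add_cancel (Nat.pos_of_ne_zero hL), pow_succ]
    field_simp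
    simp
  rw [coeffA_mulVec d _ _ (pow_ne_zero L hk) (hT0 t ht) hzu, e4]
  have e5 : ∑ i, (t i ^ L)⁻¹ / (k ^ L * (k ^ L - (t i ^ L)⁻¹)) *
        ∑ n, (if n ≤ j then k ^ L else 1) *
          (vEntry L (fFamily τ θ) (gFamily τ θ) i t j n * PhiVec L τ θ t k n) =
      1 / (L * k ^ L) * ∑ i, L * (t i ^ L)⁻¹ / (k ^ L - (t i ^ L)⁻¹) *
        ∑ n, (if n ≤ j then k ^ L else 1) *
          (vEntry L (fFamily τ θ) (gFamily τ θ) i t j n * PhiVec L τ θ t k n) := by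
    rw [Finset.mul_sum]
    refine Finset.sum_congr rfl fun i _ => ?_
    have := hzu i
    generalize k ^ L - (t i ^ L)⁻¹ = b at *
    field_simp
  rw [e5, expZero]
  have e6 : PhiVec L τ θ t k j = k ^ (j : ℕ) * phi τ ((j : ℤ) - 1) (-(j : ℤ)) θ t k := rfl
  have e7 : deriv (fun k' => PhiVec L τ θ t k' j) k / (L * k ^ L / k) =
      1 / (L * k ^ L) * (k * deriv (fun k' => PhiVec L τ θ t k' j) k) := by
    field_simp
  rw [e7, e1, eq_add_of_sub_eq e2, mul_add (k ^ (j : ℕ)), e3, e6]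
  field_simp
  ring

end

end UCReduction

end

/-! ### The main theorem -/

theorem mainTheorem3 (L N : ℕ) (hL : 2 ≤ L) (hN : 1 ≤ N)
    (θ : Fin (N + 1) → ℂ) (d : ℤ → ℤ → ℂ) (hd : UCReduction.IsDegreeArray L d)
    (T : Set (Fin (N + 1) → ℂ)) (hT : IsOpen T)
    (hT0 : ∀ t ∈ T, ∀ i, t i ≠ 0)
    (hTd : ∀ t ∈ T, ∀ i j, i ≠ j → t i ^ L ≠ t j ^ L) :
    -- the wave functions
    (∀ (Ω : Set UCReduction.Pt) (τ : ℤ → ℤ → UCReduction.Pt → ℂ)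
        (W : Set ((Fin (N + 1) → ℂ) × ℂ)),
      UCReduction.IsTauSequence L d Ω τ → UCReduction.IsReductionDomain Ω τ θ T W →
      -- the reduced wave functions are holomorphic and satisfy the linear equations
      (∀ m n, DifferentiableOn ℂ (fun q => UCReduction.phi τ m n θ q.1 q.2) W) ∧
      (∀ t k, (t, k) ∈ W → ∀ m n i,
        UCReduction.phi τ m n θ t k =
          1 / UCReduction.fVar τ θ i (m + 1) (n + 1) t *
              UCReduction.phi τ m (n + 1) (UCReduction.raise θ i) t k
            - t i * k * UCReduction.phi τ (m + 1) n (UCReduction.raise θ i) t k) ∧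
      (∀ t k, (t, k) ∈ W → ∀ m n i,
        t i * UCReduction.pd i (fun s => UCReduction.phi τ m n θ s k) t =
          (UCReduction.gVar τ θ i (m + 1) n t - θ i) * UCReduction.phi τ m n θ t k
            + t i * k * UCReduction.gVar τ θ i (m + 1) n t *
              UCReduction.phi τ (m + 1) n (UCReduction.raise θ i) t k) ∧
      (∀ t k, (t, k) ∈ W → ∀ m n,
        k * deriv (fun k' => UCReduction.phi τ m n θ t k') k
            - ∑ i, t i * UCReduction.pd i (fun s => UCReduction.phi τ m n θ s k) t =
          (d m n - d m (n - 1)) * UCReduction.phi τ m n θ t k) ∧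
      -- the dependent variables given by the tau functions are admissible, and the vector `Φ`
      -- satisfies the linear system in `z = k ^ L` and the deformation equations
      UCReduction.IsAdmissible L d θ T (UCReduction.fFamily τ θ) (UCReduction.gFamily τ θ) ∧
      (∀ t k, (t, k) ∈ W → ∀ j : Fin L,
        deriv (fun k' => UCReduction.PhiVec L τ θ t k' j) k / deriv (fun k' : ℂ => k' ^ L) k =
          (UCReduction.coeffA L d (UCReduction.fFamily τ θ) (UCReduction.gFamily τ θ)
            t (k ^ L)).mulVec (UCReduction.PhiVec L τ θ t k) j) ∧
      (∀ t k, (t, k) ∈ W → ∀ (i : Fin (N + 1)) (j : Fin L),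
        UCReduction.pdU L i (fun s => UCReduction.PhiVec L τ θ s k j) t =
          (UCReduction.coeffB L θ (UCReduction.fFamily τ θ) (UCReduction.gFamily τ θ)
            i t (k ^ L)).mulVec (UCReduction.PhiVec L τ θ t k) j) ∧
      UCReduction.SolvesG L d θ T (UCReduction.fFamily τ θ) (UCReduction.gFamily τ θ) ∧
      UCReduction.IsCompatible L d θ T (UCReduction.fFamily τ θ) (UCReduction.gFamily τ θ)) ∧
    -- the linear system attached to arbitrary admissible dependent variables
    (∀ f g : UCReduction.Family N, UCReduction.IsAdmissible L d θ T f g →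
      -- singular points, exponents and spectral type
      (∀ t ∈ T, Function.Injective (UCReduction.sing L t)) ∧
      (∀ t ∈ T, ∀ i : Fin (N + 1),
        UCReduction.resA L f g i t =
          Matrix.vecMulVec (UCReduction.bVec L f g i t) (UCReduction.cVec L f i t) ∧
        dotProduct (UCReduction.cVec L f i t) (UCReduction.bVec L f g i t) = - θ i ∧
        (UCReduction.resA L f g i t).charpoly =
          Polynomial.X ^ (L - 1) * (Polynomial.X - Polynomial.C (- θ i)) ∧
        (θ i ≠ 0 → (UCReduction.resA L f g i t).rank = 1 ∧
          UCReduction.multiplicities (UCReduction.resA L f g i t) = {L - 1, 1})) ∧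
      (∀ t ∈ T,
        (UCReduction.resZero L d f g t).charpoly =
          ∏ n : Fin L, (Polynomial.X - Polynomial.C (UCReduction.expZero L d n)) ∧
        (Function.Injective (UCReduction.expZero L d) →
          UCReduction.multiplicities (UCReduction.resZero L d f g t) =
            Multiset.replicate L 1)) ∧
      (∀ t ∈ T,
        (UCReduction.resInfty L d f g t).charpoly =
          ∏ n : Fin L, (Polynomial.X -
            Polynomial.C (UCReduction.kappaBar L d θ n - UCReduction.expZero L d n)) ∧
        (Function.Injective
            (fun n : Fin L => UCReduction.kappaBar L d θ n - UCReduction.expZero L d n) →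
          UCReduction.multiplicities (UCReduction.resInfty L d f g t) =
            Multiset.replicate L 1)) ∧
      -- the nonlinear system is the compatibility condition, and it is a Schlesinger system
      (UCReduction.SolvesG L d θ T f g →
        UCReduction.IsCompatible L d θ T f g ∧
        UCReduction.IsSchlesingerUpToGauge L d θ T f g) ∧
      ((∀ i, θ i ≠ 0) →
        (UCReduction.IsCompatible L d θ T f g → UCReduction.SolvesG L d θ T f g) ∧
        (UCReduction.IsSchlesingerUpToGauge L d θ T f g →
          UCReduction.SolvesG L d θ T f g))) ∧
    -- the relations among the exponents
    (∑ n : Fin L, UCReduction.expZero L d n = ((L : ℂ) - 1) / 2 ∧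
      ∑ n : Fin L, UCReduction.kappaBar L d θ n = ∑ i, θ i) := by
  have hL0 : L ≠ 0 := by omega
  refine ⟨fun Ω τ W hτ hR => ?_, fun f g h => ?_, UCReduction.sum_expZero hL0 hd,
    UCReduction.sum_kappaBar hL0 hd⟩
  · have h := UCReduction.isAdmissible_of_tau hT hτ hR hT0
    have hF := UCReduction.solvesFlow_of_tau hd hT hτ hR hT0 hTd
    refine ⟨fun m n q hq => ?_, fun t k hW m n i => UCReduction.phi_difference hτ hR hT0 hW m n i,
      fun t k hW m n i => UCReduction.phi_differential hτ hR hT0 hW m n i,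
      fun t k hW m n => UCReduction.phi_euler hτ hR hT0 hW m n, h,
      fun t k hW j => UCReduction.deriv_PhiVec hL0 hT hτ hR hT0 hW j,
      fun t k hW i j => UCReduction.pdU_PhiVec hL0 hT hτ hR hT0 hW i j,
      (UCReduction.solvesG_iff_flow h hT0 hTd).mpr hF,
      (UCReduction.isCompatible_iff hL0 h hT hT0 hTd).mpr
        (UCReduction.solvesResidue_of_flow hL0 hd h hT hT0 hTd hF)⟩
    exact (UCReduction.differentiableAt_phi hτ hR hT0 hq m n).differentiableWithinAt
  · have hC := UCReduction.isCompatible_iff hL0 h hT hT0 hTd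
    have hG := UCReduction.solvesG_iff_flow h hT0 hTd
    refine ⟨fun t ht => UCReduction.sing_injective (hT0 t ht) (hTd t ht), fun t ht i =>
      ⟨UCReduction.resA_eq_vecMulVec h ht (hT0 t ht i),
        UCReduction.cVec_dotProduct_bVec hL0 h ht (hT0 t ht i),
        UCReduction.charpoly_resA hL h ht (hT0 t ht i), fun hθ =>
        ⟨UCReduction.rank_resA hL0 h ht (hT0 t ht i) hθ,
          UCReduction.multiplicities_resA hL h ht (hT0 t ht i) hθ⟩⟩,
      fun t _ => ⟨UCReduction.charpoly_resZero t,
        UCReduction.multiplicities_of_charpoly_eq_prod (UCReduction.charpoly_resZero t)⟩,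
      fun t ht => ⟨UCReduction.charpoly_resInfty h ht (hT0 t ht),
        UCReduction.multiplicities_of_charpoly_eq_prod
          (UCReduction.charpoly_resInfty h ht (hT0 t ht))⟩,
      fun hS => ?_, fun hθ => ⟨fun hc => ?_, fun hs => ?_⟩⟩
    · have hres := UCReduction.solvesResidue_of_flow hL0 hd h hT hT0 hTd (hG.mp hS)
      exact ⟨hC.mpr hres, UCReduction.schlesinger_of_solvesResidue hL0 h hT hT0 hTd hres⟩
    · exact hG.mpr (UCReduction.flow_of_solvesResidue hL0 hd h hT hT0 hTd hθ (hC.mp hc))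
    · exact hG.mpr (UCReduction.flow_of_solvesResidue hL0 hd h hT hT0 hTd hθ
        (UCReduction.solvesResidue_of_schlesinger h hT hT0 hs))
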